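/- Let $k\ge 1$ be an integer and let $f,f^{*}:\mathbb Z\to\mathbb C$ be sequences with period $k$; for $\alpha\in\mathbb Z$ write $A_\alpha=\{f(\alpha n)\}_{n\in\mathbb Z}$, $B_\alpha=\{f^{*}(\alpha n)\}_{n\in\mathbb Z}$, $A=A_1$, $B=B_1$. Let $a,b,c,d\in\mathbb Z$ with $ad-bc=1$, $c>0$, and $Vz=(az+b)/(cz+d)$. Let $r_1,r_2\in\mathbb R$, $R_1=ar_1+cr_2$, $R_2=br_1+dr_2$, and let $\mathbb K=\{x+iy: x>-d/c,\ y>0\}$. Write $e(w)=e^{2\pi i w}$, $[x]$ and $\{x\}$ for the integral and fractional part of a real number $x$, and $\lambda_x=1$ if $x\in\mathbb Z$, $\lambda_x=0$ otherwise (a product with the factor $\lambda_x$ is $0$ if $x\notin\mathbb Z$). Powers $w^{-s}$ are taken with $-\pi\le\arg w<\pi$. For $z$ in the upper half-plane and $k$-periodic $P,Q:\mathbb Z\to\mathbb C$ let $$G(z,s;P,Q;r_1,r_2)=\sum_{\substack{m,n\in\mathbb Z\\ (m,n)\neq(-r_1,-r_2)}}\frac{P(m)Q(n)}{((m+r_1)z+n+r_2)^{s}}\quad(\operatorname{Re}s>2),$$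 $$L(s;P;\theta)=\sum_{n>-\theta}P(n)(n+\theta)^{-s}\quad(\operatorname{Re}s>1,\ \theta\in\mathbb R).$$ For $z\in\mathbb K$, all of the functions $G$ and $L$ that occur below converge absolutely in these half-planes and continue analytically in $s$ to $\mathbb C$ with the possible exception of a simple pole at $s=1$; the same letters denote the continuations. For integers $1\le j\le c$, $0\le\mu,v\le k-1$ and $\rho=\{R_2\}c-\{R_1\}d$ let $$I_{j,\mu,v}(z,s)=\int_{C}u^{s-1}\,\frac{\exp\!\left(-\frac{c\mu+j-\{R_1\}}{ck}(cz+d)ku\right)}{\exp(-ku(cz+d))-1}\cdot\frac{\exp\!\left(\frac{v+\{(dj+\rho)/c\}}{k}\,ku\right)}{\exp(ku)-1}\,du,$$ where $u^{s-1}$ is taken with $0<\arg u<2\pi$ and $C=C_\varepsilon$ is the loop that comes from $+\infty+i\varepsilon$ along $\operatorname{Im}u=\varepsilon$ to $i\varepsilon$, follows the left half of the circle $|u|=\varepsilon$ in the positive direction to $-i\varepsilon$, and returns to $+\infty-i\varepsilon$ along $\operatorname{Im}u=-\varepsilon$; here $\varepsilon>0$ is any number such that $u=0$ is the only zero of $(\exp(-ku(cz+d))-1)(\exp(ku)-1)$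 inside or on $C_\varepsilon$. For $z\in\mathbb K$ such $\varepsilon$ exist, and the integrals converge absolutely for all $s$. (i) If $a\equiv d\equiv 0\pmod k$, then for $z\in\mathbb K$ and all $s$, $$\begin{aligned}(cz+d)^{-s}\Gamma(s)G(Vz,s;A,B;r_1,r_2)={}&\Gamma(s)G(z,s;B_{-b},A_{-c};R_1,R_2)-2i\,\Gamma(s)\sin(\pi s)L(s;A_c;-R_2)f^{*}(bR_1)\lambda_{R_1}\\&+e(-s/2)\sum_{j=1}^{c}\sum_{\mu=0}^{k-1}\sum_{v=0}^{k-1}f\bigl(c([R_2+d(j-\{R_1\})/c]-v)\bigr)f^{*}\bigl(b(\mu c+j+[R_1])\bigr)I_{j,\mu,v}(z,s).\end{aligned}$$ (ii) If $b\equiv c\equiv 0\pmod k$, then for $z\in\mathbb K$ and all $s$, $$\begin{aligned}(cz+d)^{-s}\Gamma(s)G(Vz,s;A,B;r_1,r_2)={}&\Gamma(s)G(z,s;A_{d},B_{a};R_1,R_2)-2i\,\Gamma(s)\sin(\pi s)L(s;B_{-a};-R_2)f(-dR_1)\lambda_{R_1}\\&+e(-s/2)\sum_{j=1}^{c}\sum_{\mu=0}^{k-1}\sum_{v=0}^{k-1}f^{*}\bigl(-a([R_2+d(j-\{R_1\})/c]-v+d\mu)\bigr)f\bigl(-d(j+[R_1])\bigr)I_{j,\mu,v}(z,s).\end{aligned}$$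 Both formulas hold pointwise for every $s\notin\{1,0,-1,-2,\dots\}$; at the remaining points, where single terms may have poles, they hold as identities of meromorphic functions, that is, the left side minus the first two terms on the right tends, as $s$ tends to such a point, to the value of the triple sum term there. -/

import Mathlib

open scoped Topology

noncomputable section

namespace PeriodicEisenstein

/-- The argument of `w`, normalised by `-π ≤ arg w < π`. -/
def branchArg (w : ℂ) : ℝ := if w.arg = Real.pi then -Real.pi else w.arg

/-- The power `w ^ s` for the branch `-π ≤ arg w < π` (used for `w ≠ 0` only). -/
def branchPow (w s : ℂ) : ℂ :=
  Complex.exp (s * ((Real.log ‖w‖ : ℂ) + (branchArg w : ℂ) * Complex.I))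

/-- The power `u ^ s` for the branch `0 < arg u < 2π`, for `u` off the half-line `[0, ∞)`:
the principal argument of `-u` lies in `(-π, π)` there, and `arg u = arg (-u) + π`. -/
def loopPow (u s : ℂ) : ℂ :=
  Complex.exp (s * (Complex.log (-u) + (Real.pi : ℂ) * Complex.I))

/-- `e(z) = exp (2πiz)`. -/
def e (z : ℂ) : ℂ := Complex.exp (2 * (Real.pi : ℂ) * Complex.I * z)

/-- The sequence `{f(αn)}`, written `A_α` when `A = {f(n)}`. -/
def scaled (α : ℤ) (f : ℤ → ℂ) : ℤ → ℂ := fun n => f (α * n)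

/-- The characteristic function of the integers. -/
def charInt (x : ℝ) : ℂ := if x = (⌊x⌋ : ℝ) then 1 else 0

/-- `F` is the analytic continuation in `s` of the series with terms `term i s`: the series
converges absolutely to `F s` for `Re s > σ`, and `F` is holomorphic on the plane except possibly
for a simple pole at `1`. The normal form condition fixes the value at `1` (the value of the
holomorphic extension if there is no pole, and `0` if there is one), so that `F` is unique. -/
structure IsContinuation {ι : Type} (σ : ℝ) (term : ι → ℂ → ℂ) (F : ℂ → ℂ) : Prop where
  hasSum : ∀ s : ℂ, σ < s.re → HasSum (fun i => term i s) (F s)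
  holomorphic : DifferentiableOn ℂ F {1}ᶜ
  normalForm : MeromorphicNFAt F 1
  pole : -1 ≤ meromorphicOrderAt F 1

open Classical in
/-- The analytic continuation of a series (the zero function if there is none). -/
def continuation {ι : Type} (σ : ℝ) (term : ι → ℂ → ℂ) : ℂ → ℂ :=
  if h : ∃ F, IsContinuation σ term F then h.choose else 0

/-- The index set of the Eisenstein series: all pairs `(m, n)` except `(-r₁, -r₂)`. -/
def EisIndex (r₁ r₂ : ℝ) : Type := {p : ℤ × ℤ // ¬ ((p.1 : ℝ) = -r₁ ∧ (p.2 : ℝ) = -r₂)}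

/-- The terms `A(m) B(n) ((m + r₁) z + n + r₂) ^ (-s)`. -/
def eisTerm (z : ℂ) (A B : ℤ → ℂ) (r₁ r₂ : ℝ) (p : EisIndex r₁ r₂) (s : ℂ) : ℂ :=
  A p.1.1 * B p.1.2 *
    branchPow (((p.1.1 : ℂ) + (r₁ : ℂ)) * z + (p.1.2 : ℂ) + (r₂ : ℂ)) (-s)

/-- `G(z, s; A, B; r₁, r₂)`. -/
def G (z s : ℂ) (A B : ℤ → ℂ) (r₁ r₂ : ℝ) : ℂ := continuation 2 (eisTerm z A B r₁ r₂) s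

/-- The terms `A(n) (n + θ) ^ (-s)`, `n > -θ`. -/
def lTerm (A : ℤ → ℂ) (θ : ℝ) (n : {n : ℤ // -θ < (n : ℝ)}) (s : ℂ) : ℂ :=
  A n.1 * branchPow ((n.1 : ℂ) + (θ : ℂ)) (-s)

/-- `L(s; A; θ)`. -/
def L (s : ℂ) (A : ℤ → ℂ) (θ : ℝ) : ℂ := continuation 1 (lTerm A θ) s

/-- The integral of `F` along the loop `C_ε` that comes from `+∞ + iε` along `Im u = ε` to `iε`,
follows the left half of the circle `|u| = ε` in the positive direction to `-iε`, and returns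
to `+∞ - iε` along `Im u = -ε`. -/
def loopIntegral (ε : ℝ) (F : ℂ → ℂ) : ℂ :=
  -(∫ t in Set.Ioi (0 : ℝ), F ((t : ℂ) + (ε : ℂ) * Complex.I))
    + (∫ φ in (Real.pi / 2)..(3 * Real.pi / 2),
        F (circleMap 0 ε φ) * deriv (circleMap 0 ε) φ)
    + ∫ t in Set.Ioi (0 : ℝ), F ((t : ℂ) - (ε : ℂ) * Complex.I)

/-- Absolute convergence of `loopIntegral ε F`. -/
def LoopIntegrable (ε : ℝ) (F : ℂ → ℂ) : Prop :=
  MeasureTheory.IntegrableOn (fun t : ℝ => F ((t : ℂ) + (ε : ℂ) * Complex.I)) (Set.Ioi 0) ∧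
  IntervalIntegrable (fun φ : ℝ => F (circleMap 0 ε φ) * deriv (circleMap 0 ε) φ)
    MeasureTheory.volume (Real.pi / 2) (3 * Real.pi / 2) ∧
  MeasureTheory.IntegrableOn (fun t : ℝ => F ((t : ℂ) - (ε : ℂ) * Complex.I)) (Set.Ioi 0)

/-- The loop `C_ε` together with the region that it encloses. -/
def loopRegion (ε : ℝ) : Set ℂ :=
  {u : ℂ | ‖u‖ ≤ ε} ∪ {u : ℂ | 0 ≤ u.re ∧ |u.im| ≤ ε}

/-- `u = 0` is the only zero of `(exp (-ku(cz+d)) - 1)(exp (ku) - 1)` inside or on `C_ε`. -/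
def AdmissibleLoop (k : ℕ) (c d : ℤ) (z : ℂ) (ε : ℝ) : Prop :=
  0 < ε ∧ ∀ u ∈ loopRegion ε,
    (Complex.exp (-((k : ℂ) * u * ((c : ℂ) * z + (d : ℂ)))) - 1) *
      (Complex.exp ((k : ℂ) * u) - 1) = 0 → u = 0

/-- `ρ(R₁, R₂, c, d) = {R₂} c - {R₁} d`. -/
def rho (R₁ R₂ : ℝ) (c d : ℤ) : ℝ := Int.fract R₂ * (c : ℝ) - Int.fract R₁ * (d : ℝ)

/-- The integrand of the loop integral `I`. -/
def integrand (k : ℕ) (c d : ℤ) (R₁ R₂ : ℝ) (j : ℤ) (μ v : ℕ) (z s u : ℂ) : ℂ :=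
  loopPow u (s - 1) *
    (Complex.exp
        (-(((((c : ℝ) * (μ : ℝ) + (j : ℝ) - Int.fract R₁) / ((c : ℝ) * (k : ℝ)) : ℝ) : ℂ) *
          ((c : ℂ) * z + (d : ℂ)) * (k : ℂ) * u)) /
      (Complex.exp (-((k : ℂ) * u * ((c : ℂ) * z + (d : ℂ)))) - 1)) *
    (Complex.exp
        (((((v : ℝ) + Int.fract (((d : ℝ) * (j : ℝ) + rho R₁ R₂ c d) / (c : ℝ))) / (k : ℝ) : ℝ) : ℂ)
          * (k : ℂ) * u) /
      (Complex.exp ((k : ℂ) * u) - 1))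

/-- The integral `I(z, s, c, d, r₁, r₂)` along `C_ε`; it also depends on `k`, `j`, `μ`, `v`, and
on `r₁`, `r₂` through `R₁`, `R₂`. -/
def I (ε : ℝ) (k : ℕ) (c d : ℤ) (R₁ R₂ : ℝ) (j : ℤ) (μ v : ℕ) (z s : ℂ) : ℂ :=
  loopIntegral ε (integrand k c d R₁ R₂ j μ v z s)

/-- The identity `P(s) = Q(s) + T(s)` for all `s`, where `P`, `Q` may have poles at
`1, 0, -1, -2, …`: it holds pointwise at all other `s`, and everywhere (in particular at these
points) `P - Q` has the limit `T`. -/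
def HoldsForAll (P Q T : ℂ → ℂ) : Prop :=
  (∀ s : ℂ, s ≠ 1 → (∀ N : ℕ, s ≠ -(N : ℂ)) → P s = Q s + T s) ∧
  ∀ s₀ : ℂ, Filter.Tendsto (fun s => P s - Q s) (𝓝[≠] s₀) (𝓝 (T s₀))

end PeriodicEisenstein

end

/-!
Both formulas come from one computation. Write `f (d M - c N) f* (-b M + a N) = p M q N`; this
factorization is all that the congruences modulo `k` are needed for. Put `ω = cz + d` and
`W = (M + R₁) z + N + R₂`. Substituting `M = a m + c n`, `N = b m + d n` turns the terms of the
series for `ω ^ (-s) G (Vz)` into those of the series for `G z` with coefficients `p`, `q` and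
shifts `R₁`, `R₂`, except for the branch of the power: the arguments of `ω` and `W / ω` add up to
that of `W`, unless `M + R₁ ≤ 0` and `c (N + R₂) < d (M + R₁)`, where they exceed it by `2π`
(`branchPow_mul_branchPow`, `branchPow_mul_latticeTerm`). On this cone `-W` has positive real part,
and after reversal of all signs the discrepancy becomes `-2i sin (πs)` times the sum of
`p (-M) q (-N) ((M - R₁) z + N - R₂) ^ (-s)` over the cone `M ≥ R₁`, `d (M - R₁) < c (N - R₂)`
(`branchPow_mul_sum`).

The row `M = R₁` of the cone contributes the function `L` (`hasSum_boundary_row`). The other rows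
are split into residue classes, of the row number modulo `ck` and of the column number modulo `k`;
each class is a translated lattice cone, and the sum over it is a Barnes double zeta function, that
is, `1 / Γ(s)` times the Mellin transform of a product of two geometric series (`hasSum_barnes`,
`hasSum_cone`). For large `Re s` this Mellin transform is `(exp (2πis) - 1)⁻¹` times the loop
integral, by contracting the loop to the half-line (`loopIntegral_loopFun`).

This proves the formulas for `Re s > 3`. All terms continue analytically: `L` by the Hurwitz zeta
function (`isContinuation_L`); the rows of `G` off the real axis by the Lipschitz formula, which
turns them into exponentially convergent series entire in `s`, and the real row by `L`
(`isContinuation_G`); the loop integrals because they converge locally uniformly in `s`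
(`loopIntegrable_and_differentiable`). The identity theorem on the plane without `1`, applied after
division by `Γ`, whose inverse is entire, gives the formulas in general (`holdsForAll_of_re_gt`).
-/

open scoped Topology

noncomputable section

open MeasureTheory Filter Set Complex

namespace PeriodicEisenstein

/-! ### Integrals depending holomorphically on a parameter -/

/-- The integral of `exp (s ℓ) φ` is holomorphic in `s` wherever the integrand stays integrable
after multiplication by `exp (ρ ‖ℓ‖)` for some `ρ > 0`. -/
lemma differentiableAt_integral_exp_mul {α : Type*} [MeasurableSpace α] {μ : Measure α}
    {ℓ φ : α → ℂ} {s₀ : ℂ} {ρ : ℝ} (hρ : 0 < ρ)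
    (hℓ : AEStronglyMeasurable ℓ μ) (hφ : AEStronglyMeasurable φ μ)
    (hb : Integrable (fun t => Real.exp ((s₀ * ℓ t).re + ρ * ‖ℓ t‖) * ‖φ t‖) μ) :
    DifferentiableAt ℂ (fun s => ∫ t, cexp (s * ℓ t) * φ t ∂μ) s₀ := by
  have key : ∀ s ∈ Metric.ball s₀ (ρ / 2), ∀ t,
      (s * ℓ t).re ≤ (s₀ * ℓ t).re + ρ / 2 * ‖ℓ t‖ := by
    intro s hs t
    have h1 : (s * ℓ t).re = (s₀ * ℓ t).re + ((s - s₀) * ℓ t).re := by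
      rw [← Complex.add_re]; congr 1; ring
    have h2 : ((s - s₀) * ℓ t).re ≤ ρ / 2 * ‖ℓ t‖ := by
      refine (Complex.re_le_norm _).trans ?_
      rw [norm_mul]
      gcongr
      rw [Metric.mem_ball, dist_eq_norm] at hs
      exact hs.le
    linarith
  have hmeas : ∀ s : ℂ, AEStronglyMeasurable (fun t => cexp (s * ℓ t) * φ t) μ := fun s =>
    (Complex.continuous_exp.comp_aestronglyMeasurable (hℓ.const_mul s)).mul hφ
  have hint : Integrable (fun t => cexp (s₀ * ℓ t) * φ t) μ := by
    refine hb.mono' (hmeas s₀) (Eventually.of_forall fun t => ?_)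
    rw [norm_mul, Complex.norm_exp]
    gcongr
    have : 0 ≤ ρ * ‖ℓ t‖ := by positivity
    linarith
  refine (hasDerivAt_integral_of_dominated_loc_of_deriv_le
    (F' := fun s t => ℓ t * cexp (s * ℓ t) * φ t)
    (bound := fun t => 2 / ρ * (Real.exp ((s₀ * ℓ t).re + ρ * ‖ℓ t‖) * ‖φ t‖))
    (Metric.ball_mem_nhds s₀ (half_pos hρ)) (Eventually.of_forall hmeas) hint
    ?_ ?_ (hb.const_mul _) ?_).2.differentiableAt
  · simp_rw [mul_assoc]
    exact hℓ.mul (hmeas s₀)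
  · refine Eventually.of_forall fun t s hs => ?_
    rw [norm_mul, norm_mul, Complex.norm_exp, ← mul_assoc]
    refine mul_le_mul_of_nonneg_right ?_ (norm_nonneg _)
    have h3 : ρ / 2 * ‖ℓ t‖ ≤ Real.exp (ρ / 2 * ‖ℓ t‖) := by
      have := Real.add_one_le_exp (ρ / 2 * ‖ℓ t‖); linarith
    calc ‖ℓ t‖ * Real.exp ((s * ℓ t).re)
        = 2 / ρ * ((ρ / 2 * ‖ℓ t‖) * Real.exp ((s * ℓ t).re)) := by field_simp
      _ ≤ 2 / ρ * (Real.exp (ρ / 2 * ‖ℓ t‖) *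
            Real.exp ((s₀ * ℓ t).re + ρ / 2 * ‖ℓ t‖)) := by
          gcongr
          exact key s hs t
      _ = 2 / ρ * Real.exp ((s₀ * ℓ t).re + ρ * ‖ℓ t‖) := by
          rw [← Real.exp_add]; congr 2; ring
  · refine Eventually.of_forall fun t s _ => ?_
    have h : HasDerivAt (fun s : ℂ => cexp (s * ℓ t)) (ℓ t * cexp (s * ℓ t)) s := by
      have := ((hasDerivAt_id s).mul_const (ℓ t)).cexp
      simpa [mul_comm] using this
    exact h.mul_const _

lemma integrableOn_rpow_mul_exp_neg_mul {σ r : ℝ} (hσ : 0 < σ) (hr : 0 < r) :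
    IntegrableOn (fun t : ℝ => t ^ (σ - 1) * Real.exp (-(r * t))) (Ioi 0) := by
  have h := integrableOn_rpow_mul_exp_neg_mul_rpow (s := σ - 1) (p := 1) (b := r)
    (by linarith) one_pos hr
  refine h.congr_fun (fun t _ => ?_) measurableSet_Ioi
  simp

lemma norm_cpow_mul_exp_neg_mul {s r : ℂ} {t : ℝ} (ht : 0 < t) :
    ‖(t : ℂ) ^ (s - 1) * cexp (-(r * t))‖ = t ^ (s.re - 1) * Real.exp (-(r.re * t)) := by
  rw [norm_mul, Complex.norm_cpow_eq_rpow_re_of_pos ht, Complex.norm_exp]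
  simp

lemma continuousOn_cpow_mul_exp_neg_mul (s r : ℂ) :
    ContinuousOn (fun t : ℝ => (t : ℂ) ^ (s - 1) * cexp (-(r * t))) (Ioi 0) := by
  refine ContinuousOn.mul (fun t ht => ContinuousAt.continuousWithinAt ?_) (by fun_prop)
  exact continuousAt_ofReal_cpow_const t (s - 1) (Or.inr (ne_of_gt ht))

lemma integrableOn_cpow_mul_exp_neg_mul {s r : ℂ} (hs : 0 < s.re) (hr : 0 < r.re) :
    IntegrableOn (fun t : ℝ => (t : ℂ) ^ (s - 1) * cexp (-(r * t))) (Ioi 0) := by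
  refine Integrable.mono' (integrableOn_rpow_mul_exp_neg_mul hs hr)
    ((continuousOn_cpow_mul_exp_neg_mul s r).aestronglyMeasurable measurableSet_Ioi) ?_
  filter_upwards [ae_restrict_mem measurableSet_Ioi] with t ht
  rw [norm_cpow_mul_exp_neg_mul ht]

/-- The Gamma integral with a complex rate `r`, by analytic continuation in `r` from the positive
half-line. -/
lemma integral_cpow_mul_exp_neg_mul {s r : ℂ} (hs : 0 < s.re) (hr : 0 < r.re) :
    ∫ t in Ioi (0 : ℝ), (t : ℂ) ^ (s - 1) * cexp (-(r * t)) = Complex.Gamma s * r ^ (-s) := by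
  set U : Set ℂ := {r | 0 < r.re} with hU
  have hUo : IsOpen U := isOpen_lt continuous_const Complex.continuous_re
  have hUc : IsPreconnected U := (convex_halfSpace_re_gt 0).isPreconnected
  have hL : DifferentiableOn ℂ
      (fun r : ℂ => ∫ t in Ioi (0 : ℝ), (t : ℂ) ^ (s - 1) * cexp (-(r * t))) U := by
    intro r₀ hr₀
    refine DifferentiableAt.differentiableWithinAt ?_
    have h := differentiableAt_integral_exp_mul (μ := volume.restrict (Ioi (0 : ℝ)))
      (ℓ := fun t : ℝ => -(t : ℂ)) (φ := fun t : ℝ => (t : ℂ) ^ (s - 1)) (s₀ := r₀)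
      (ρ := r₀.re / 2) (half_pos hr₀) (by fun_prop) ?_ ?_
    · refine h.congr_of_eventuallyEq (Eventually.of_forall fun r => ?_)
      simp only
      congr 1; ext t
      rw [mul_comm]; congr 2; ring
    · refine ContinuousOn.aestronglyMeasurable (fun t ht => ContinuousAt.continuousWithinAt ?_)
        measurableSet_Ioi
      exact continuousAt_ofReal_cpow_const t (s - 1) (Or.inr (ne_of_gt ht))
    · refine (integrableOn_rpow_mul_exp_neg_mul hs (half_pos hr₀)).congr_fun (fun t ht => ?_)
        measurableSet_Ioi
      have ht' : (0 : ℝ) < t := ht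
      simp only
      rw [Complex.norm_cpow_eq_rpow_re_of_pos ht', mul_comm]
      congr 2
      simp [abs_of_pos ht']; ring
  have hR : DifferentiableOn ℂ (fun r : ℂ => Complex.Gamma s * r ^ (-s)) U := by
    intro r₀ hr₀
    refine DifferentiableAt.differentiableWithinAt ?_
    exact (differentiableAt_id.cpow_const (Or.inl hr₀)).const_mul _
  refine AnalyticOnNhd.eqOn_of_preconnected_of_frequently_eq (hL.analyticOnNhd hUo)
    (hR.analyticOnNhd hUo) hUc (z₀ := 1) (by simp [hU]) ?_ hr
  -- the two sides agree at all real points `r > 0`, and these accumulate at `1`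
  have hfreq : ∃ᶠ x : ℝ in 𝓝[≠] (1 : ℝ), 0 < x :=
    (((eventually_gt_nhds one_pos).filter_mono nhdsWithin_le_nhds)).frequently
  have htend : Tendsto (fun x : ℝ => (x : ℂ)) (𝓝[≠] (1 : ℝ)) (𝓝[≠] (1 : ℂ)) := by
    refine tendsto_nhdsWithin_iff.2 ⟨?_, ?_⟩
    · have : Tendsto (fun x : ℝ => (x : ℂ)) (𝓝 1) (𝓝 ((1 : ℝ) : ℂ)) :=
        Complex.continuous_ofReal.tendsto 1
      simpa using this.mono_left nhdsWithin_le_nhds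
    · filter_upwards [self_mem_nhdsWithin] with x hx
      simpa using hx
  refine htend.frequently (hfreq.mono fun x hx => ?_)
  rw [Complex.integral_cpow_mul_exp_neg_mul_Ioi hs hx, mul_comm, one_div,
    Complex.inv_cpow _ _ (by rw [Complex.arg_ofReal_of_nonneg hx.le]; exact Real.pi_pos.ne),
    Complex.cpow_neg]

/-! ### Functions with at most a simple pole at `1` -/

/-- `F` is holomorphic on the plane except possibly for a simple pole at `1`. -/
def SimplePoleAtOne (F : ℂ → ℂ) : Prop :=
  ∃ H : ℂ → ℂ, Differentiable ℂ H ∧ ∀ s : ℂ, s ≠ 1 → F s = H s / (s - 1)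

lemma SimplePoleAtOne.of_differentiable {F : ℂ → ℂ} (hF : Differentiable ℂ F) :
    SimplePoleAtOne F := by
  refine ⟨fun s => F s * (s - 1), by fun_prop, fun s hs => ?_⟩
  rw [mul_div_cancel_right₀ _ (sub_ne_zero.2 hs)]

lemma SimplePoleAtOne.add {F G : ℂ → ℂ} (hF : SimplePoleAtOne F) (hG : SimplePoleAtOne G) :
    SimplePoleAtOne (fun s => F s + G s) := by
  obtain ⟨H, hH, hFH⟩ := hF
  obtain ⟨K, hK, hGK⟩ := hG
  refine ⟨fun s => H s + K s, by fun_prop, fun s hs => ?_⟩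
  simp only [hFH s hs, hGK s hs, add_div]

lemma SimplePoleAtOne.mul {F G : ℂ → ℂ} (hG : Differentiable ℂ G) (hF : SimplePoleAtOne F) :
    SimplePoleAtOne (fun s => G s * F s) := by
  obtain ⟨H, hH, hFH⟩ := hF
  refine ⟨fun s => G s * H s, by fun_prop, fun s hs => ?_⟩
  simp only [hFH s hs, mul_div_assoc]

lemma SimplePoleAtOne.sum {ι : Type*} (S : Finset ι) {F : ι → ℂ → ℂ}
    (hF : ∀ i ∈ S, SimplePoleAtOne (F i)) : SimplePoleAtOne (fun s => ∑ i ∈ S, F i s) := by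
  classical
  induction S using Finset.induction_on with
  | empty => simpa using SimplePoleAtOne.of_differentiable (differentiable_const (0 : ℂ))
  | insert i S hi ih =>
    simp_rw [Finset.sum_insert hi]
    exact (hF i (Finset.mem_insert_self i S)).add
      (ih fun j hj => hF j (Finset.mem_insert_of_mem hj))

lemma simplePoleAtOne_hurwitzZeta (x : UnitAddCircle) :
    SimplePoleAtOne (HurwitzZeta.hurwitzZeta x) := by
  classical
  refine ⟨Function.update (fun s => (s - 1) * HurwitzZeta.hurwitzZeta x s) 1 1, ?_,
    fun s hs => ?_⟩
  · have hd : ∀ s : ℂ, s ≠ 1 →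
        DifferentiableAt ℂ (fun s => (s - 1) * HurwitzZeta.hurwitzZeta x s) s := fun s hs =>
      (by fun_prop : DifferentiableAt ℂ (fun s : ℂ => s - 1) s).mul
        (HurwitzZeta.differentiableAt_hurwitzZeta x hs)
    intro s
    by_cases hs : s = 1
    · subst hs
      refine (analyticAt_of_differentiable_on_punctured_nhds_of_continuousAt ?_ ?_).differentiableAt
      · filter_upwards [self_mem_nhdsWithin] with s hs
        refine (hd s hs).congr_of_eventuallyEq ?_
        filter_upwards [isOpen_ne.mem_nhds hs] with w hw
        exact Function.update_of_ne hw _ _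
      · rw [continuousAt_update_same]
        exact HurwitzZeta.hurwitzZeta_residue_one x
    · refine (hd s hs).congr_of_eventuallyEq ?_
      filter_upwards [isOpen_ne.mem_nhds hs] with w hw
      exact Function.update_of_ne hw _ _
  · rw [Function.update_of_ne hs, mul_div_cancel_left₀ _ (sub_ne_zero.2 hs)]

/-- A series whose sum agrees, to the right of `σ`, with a function that has at most a simple pole
at `1` has a continuation. -/
lemma exists_isContinuation {ι : Type} {σ : ℝ} (hσ : 1 ≤ σ) {term : ι → ℂ → ℂ} {F : ℂ → ℂ}
    (hF : SimplePoleAtOne F)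
    (hsum : ∀ s : ℂ, σ < s.re → HasSum (fun i => term i s) (F s)) :
    ∃ F, IsContinuation σ term F := by
  obtain ⟨H, hH, hFH⟩ := hF
  have hHm : MeromorphicAt H 1 := (hH.analyticAt 1).meromorphicAt
  have hlin : MeromorphicAt (fun s : ℂ => s - 1) 1 := by fun_prop
  set Q : ℂ → ℂ := fun s => H s / (s - 1) with hQ
  have hQm : MeromorphicAt Q 1 := hHm.div hlin
  have heq : EqOn Q (toMeromorphicNFAt Q 1) {1}ᶜ := hQm.eqOn_compl_singleton_toMeromorphicNFAt
  refine ⟨toMeromorphicNFAt Q 1, ?_, ?_, meromorphicNFAt_toMeromorphicNFAt, ?_⟩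
  · intro s hs
    have hs1 : s ≠ 1 := by
      rintro rfl
      simp at hs; linarith
    rw [← heq hs1]
    simp only [hQ]
    rw [← hFH s hs1]
    exact hsum s hs
  · refine DifferentiableOn.congr ?_ (fun s hs => (heq hs).symm)
    exact hH.differentiableOn.div (by fun_prop) fun s hs => sub_ne_zero.2 hs
  · rw [hQm.meromorphicOrderAt_toMeromorphicNFAt]
    have h1 : meromorphicOrderAt (fun s : ℂ => s - 1) 1 = 1 := by
      have := meromorphicOrderAt_eq_int_iff (n := 1) hlin
      exact this.2 ⟨fun _ => 1, analyticAt_const, one_ne_zero, by simp⟩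
    have h2 : meromorphicOrderAt Q 1 = meromorphicOrderAt H 1 + (-1 : ℤ) := by
      have : Q = H * (fun s : ℂ => s - 1)⁻¹ := by ext s; simp [hQ, div_eq_mul_inv]
      rw [this, meromorphicOrderAt_mul hHm hlin.inv, meromorphicOrderAt_inv, h1]
      rfl
    rw [h2]
    have h3 : 0 ≤ meromorphicOrderAt H 1 := (hH.analyticAt 1).meromorphicOrderAt_nonneg
    calc (-1 : WithTop ℤ) = 0 + (-1 : ℤ) := by simp
      _ ≤ _ := by gcongr

lemma isContinuation_continuation {ι : Type} {σ : ℝ} {term : ι → ℂ → ℂ}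
    (h : ∃ F, IsContinuation σ term F) : IsContinuation σ term (continuation σ term) := by
  unfold continuation
  rw [dif_pos h]
  exact h.choose_spec

/-! ### The branch `-π ≤ arg < π` -/

lemma branchPow_eq_cpow {w : ℂ} (hw : w ≠ 0) (h : w.arg ≠ Real.pi) (s : ℂ) :
    branchPow w s = w ^ s := by
  rw [branchPow, branchArg, if_neg h, Complex.cpow_def_of_ne_zero hw, Complex.log, mul_comm]

lemma branchPow_of_im_pos {w : ℂ} (hw : 0 < w.im) (s : ℂ) : branchPow w s = w ^ s := by
  refine branchPow_eq_cpow ?_ ?_ s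
  · rintro rfl; simp at hw
  · intro h; exact hw.ne' (Complex.arg_eq_pi_iff.1 h).2

lemma branchPow_of_re_pos {w : ℂ} (hw : 0 < w.re) (s : ℂ) : branchPow w s = w ^ s := by
  refine branchPow_eq_cpow ?_ ?_ s
  · rintro rfl; simp at hw
  · intro h; exact (Complex.arg_eq_pi_iff.1 h).1.not_gt hw

/-- On the lower half-plane together with the negative half-line, the power `w ^ s` is a multiple
of the principal power of `-w`. -/
lemma branchPow_eq_exp_mul_neg_cpow {w : ℂ} (hw : w.im < 0 ∨ (w.im = 0 ∧ w.re < 0)) (s : ℂ) :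
    branchPow w s = cexp (-(Real.pi * Complex.I * s)) * (-w) ^ s := by
  have hw0 : w ≠ 0 := by
    rintro rfl; simp at hw
  have harg : ((branchArg w : ℝ) : ℂ) = (-w).arg - Real.pi := by
    rcases hw with hw | ⟨h1, h2⟩
    · have : w.arg ≠ Real.pi := fun h => hw.ne (Complex.arg_eq_pi_iff.1 h).2
      rw [branchArg, if_neg this, Complex.arg_neg_eq_arg_add_pi_of_im_neg hw]
      push_cast; ring
    · have h3 : w.arg = Real.pi := Complex.arg_eq_pi_iff.2 ⟨h2, h1⟩
      have h4 : (-w).arg = 0 := Complex.arg_eq_zero_iff.2 ⟨by simp [h2.le], by simp [h1]⟩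
      rw [branchArg, if_pos h3, h4]; simp
  rw [branchPow, Complex.cpow_def_of_ne_zero (neg_ne_zero.2 hw0), ← Complex.exp_add, Complex.log,
    harg, norm_neg]
  congr 1; ring

lemma neg_pi_le_branchArg (w : ℂ) : -Real.pi ≤ branchArg w := by
  unfold branchArg
  split_ifs
  · exact le_rfl
  · exact (Complex.neg_pi_lt_arg w).le

lemma branchArg_lt_pi (w : ℂ) : branchArg w < Real.pi := by
  unfold branchArg
  split_ifs with h
  · linarith [Real.pi_pos]
  · exact lt_of_le_of_ne (Complex.arg_le_pi w) h

lemma norm_branchPow_le {w : ℂ} (hw : w ≠ 0) (s : ℂ) :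
    ‖branchPow w s‖ ≤ Real.exp (Real.pi * ‖s‖) * ‖w‖ ^ s.re := by
  rw [branchPow, Complex.norm_exp, Real.rpow_def_of_pos (norm_pos_iff.2 hw), ← Real.exp_add]
  gcongr
  have h1 : (s * ((Real.log ‖w‖ : ℂ) + (branchArg w : ℂ) * Complex.I)).re
      = Real.log ‖w‖ * s.re - s.im * branchArg w := by simp; ring
  have h2 : |branchArg w| ≤ Real.pi := abs_le.2 ⟨neg_pi_le_branchArg w, (branchArg_lt_pi w).le⟩
  have h3 : -(s.im * branchArg w) ≤ Real.pi * ‖s‖ := by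
    refine (neg_le_abs _).trans ?_
    rw [abs_mul, mul_comm]
    exact mul_le_mul h2 (Complex.abs_im_le_norm s) (abs_nonneg _) Real.pi_pos.le
  rw [h1]; linarith

lemma exp_branchArg (w : ℂ) : (‖w‖ : ℂ) * cexp (branchArg w * Complex.I) = w := by
  unfold branchArg
  split_ifs with h
  · have := Complex.norm_mul_exp_arg_mul_I w
    rw [h, Complex.exp_pi_mul_I] at this
    push_cast
    rw [neg_mul, Complex.exp_neg, Complex.exp_pi_mul_I]
    simpa using this
  · exact Complex.norm_mul_exp_arg_mul_I w

lemma branchArg_nonneg_iff {w : ℂ} :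
    0 ≤ branchArg w ↔ ¬ (w.im < 0 ∨ (w.im = 0 ∧ w.re < 0)) := by
  unfold branchArg
  split_ifs with h
  · have := Complex.arg_eq_pi_iff.1 h
    simp [this, Real.pi_pos]
  · rw [Complex.arg_nonneg_iff]
    constructor
    · rintro h1 (h2 | h2)
      · exact h2.not_ge h1
      · exact h (Complex.arg_eq_pi_iff.2 ⟨h2.2, h2.1⟩)
    · intro h1
      push Not at h1
      exact h1.1

/-- Multiplicativity of powers up to the jump of the argument: `ω` lies in the open first quadrant,
so that multiplying `w` by `ω` crosses the cut exactly if `w` lies in the upper half-plane and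
`ω * w` in the lower one (negative reals included). -/
lemma branchPow_mul_branchPow {ω w : ℂ} (h1 : 0 < ω.re) (h2 : 0 < ω.im) (hw : w ≠ 0) (s : ℂ) :
    branchPow ω s * branchPow w s = branchPow (ω * w) s *
      (if ((ω * w).im < 0 ∨ ((ω * w).im = 0 ∧ (ω * w).re < 0)) ∧ 0 < w.im
        then cexp (2 * Real.pi * Complex.I * s) else 1) := by
  have hω : ω ≠ 0 := by rintro rfl; simp at h1
  have hW : ω * w ≠ 0 := mul_ne_zero hω hw
  have ha0 : branchArg ω = ω.arg := by
    rw [branchArg, if_neg]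
    intro h; exact h2.ne' (Complex.arg_eq_pi_iff.1 h).2
  have ha1 : 0 < branchArg ω := by
    rw [ha0]
    refine lt_of_le_of_ne (Complex.arg_nonneg_iff.2 h2.le) fun h => ?_
    exact h2.ne' (Complex.arg_eq_zero_iff.1 h.symm).2
  have ha2 : branchArg ω < Real.pi / 2 := by
    rw [ha0, Complex.arg_lt_pi_div_two_iff]
    exact Or.inl h1
  obtain ⟨n, hn⟩ : ∃ n : ℤ, branchArg ω + branchArg w = branchArg (ω * w) + n * (2 * Real.pi) := by
    have e1 : cexp ((branchArg ω + branchArg w : ℝ) * Complex.I)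
        = cexp ((branchArg (ω * w) : ℝ) * Complex.I) := by
      have hn1 : (‖ω * w‖ : ℂ) ≠ 0 := by exact_mod_cast norm_ne_zero_iff.2 hW
      apply mul_left_cancel₀ hn1
      rw [exp_branchArg]
      conv_rhs => rw [← exp_branchArg ω, ← exp_branchArg w]
      rw [norm_mul]; push_cast
      rw [add_mul, Complex.exp_add]; ring
    obtain ⟨n, hn⟩ := Complex.exp_eq_exp_iff_exists_int.1 e1
    refine ⟨n, ?_⟩
    have := congrArg Complex.im hn
    simpa using this
  have b1 := neg_pi_le_branchArg w
  have b2 := branchArg_lt_pi w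
  have b3 := neg_pi_le_branchArg (ω * w)
  have b4 := branchArg_lt_pi (ω * w)
  have hpi := Real.pi_pos
  -- the argument of `ω` lies in `(0, π / 2)`, which leaves only `n = 0` and `n = 1`
  have hn0 : 0 ≤ n := by
    by_contra hcon
    have : (n : ℝ) ≤ -1 := by exact_mod_cast (by omega : n ≤ -1)
    nlinarith
  have hn1 : n ≤ 1 := by
    by_contra hcon
    have : (2 : ℝ) ≤ n := by exact_mod_cast (by omega : 2 ≤ n)
    nlinarith
  have hmul : branchPow ω s * branchPow w s
      = branchPow (ω * w) s * cexp (2 * Real.pi * Complex.I * s * n) := by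
    have hl : Real.log ‖ω * w‖ = Real.log ‖ω‖ + Real.log ‖w‖ := by
      rw [norm_mul, Real.log_mul (norm_ne_zero_iff.2 hω) (norm_ne_zero_iff.2 hw)]
    have hn' : (branchArg ω : ℂ) + branchArg w = branchArg (ω * w) + n * (2 * Real.pi) := by
      exact_mod_cast hn
    simp only [branchPow, ← Complex.exp_add, hl]
    congr 1
    push_cast
    linear_combination s * Complex.I * hn'
  have himw : 0 < w.im → 0 < branchArg w := by
    intro hi
    rw [branchArg, if_neg]
    · refine lt_of_le_of_ne (Complex.arg_nonneg_iff.2 hi.le) fun h => ?_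
      exact hi.ne' (Complex.arg_eq_zero_iff.1 h.symm).2
    · intro h; exact hi.ne' (Complex.arg_eq_pi_iff.1 h).2
  have himw' : ¬ 0 < w.im → branchArg w ≤ 0 := by
    intro hi
    rw [branchArg]
    split_ifs with h
    · linarith
    · by_contra hcon
      push Not at hcon hi
      have h3 := Complex.arg_nonneg_iff.1 hcon.le
      have h4 : w.im = 0 := le_antisymm hi h3
      rcases lt_or_ge w.re 0 with h5 | h5
      · exact h (Complex.arg_eq_pi_iff.2 ⟨h5, h4⟩)
      · exact hcon.ne' (Complex.arg_eq_zero_iff.2 ⟨h5, h4⟩)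
  rw [hmul]
  split_ifs with hS
  · have hneg : branchArg (ω * w) < 0 := by
      by_contra hcon
      exact branchArg_nonneg_iff.1 (not_lt.1 hcon) hS.1
    have : n = 1 := by
      rcases (by omega : n = 0 ∨ n = 1) with rfl | rfl
      · have := himw hS.2
        simp at hn; linarith
      · rfl
    simp [this]
  · have : n = 0 := by
      rcases (by omega : n = 0 ∨ n = 1) with rfl | rfl
      · rfl
      · exfalso
        simp at hn
        apply hS
        constructor
        · by_contra hcon
          have := branchArg_nonneg_iff.2 hcon
          linarith
        · by_contra hcon
          have := himw' hcon
          linarith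
    simp [this]

/-! ### Absolute convergence of the Eisenstein series -/

lemma exists_norm_le_of_periodic {k : ℕ} (hk : 0 < k) {p : ℤ → ℂ}
    (hp : Function.Periodic p (k : ℤ)) : ∃ C, 0 ≤ C ∧ ∀ n, ‖p n‖ ≤ C := by
  have hk' : (0 : ℤ) < k := by exact_mod_cast hk
  refine ⟨∑ i ∈ Finset.Ico (0 : ℤ) k, ‖p i‖, Finset.sum_nonneg fun _ _ => norm_nonneg _,
    fun n => ?_⟩
  obtain ⟨y, hy, hny⟩ := hp.exists_mem_Ico₀ hk' n
  rw [hny]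
  exact Finset.single_le_sum (f := fun i => ‖p i‖) (fun _ _ => norm_nonneg _)
    (by simpa using hy)

/-- For `z` off the real axis, `|x z + y|` is comparable with `max |x| |y|`. -/
lemma exists_mul_max_le_norm {z : ℂ} (hz : 0 < z.im) :
    ∃ c : ℝ, 0 < c ∧ ∀ x y : ℝ, c * max |x| |y| ≤ ‖(x : ℂ) * z + y‖ := by
  have h1z : 0 < 1 + ‖z‖ := by positivity
  refine ⟨min (z.im / 2) (z.im / (2 * (1 + ‖z‖))), by positivity, fun x y => ?_⟩
  have him : |x| * z.im ≤ ‖(x : ℂ) * z + y‖ := by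
    have := Complex.abs_im_le_norm ((x : ℂ) * z + y)
    simpa [abs_mul, abs_of_pos hz] using this
  have hy : |y| ≤ ‖(x : ℂ) * z + y‖ + |x| * ‖z‖ := by
    have : ‖(y : ℂ)‖ ≤ ‖(x : ℂ) * z + y‖ + ‖(x : ℂ) * z‖ := by
      have := norm_sub_le ((x : ℂ) * z + y) ((x : ℂ) * z)
      simpa using this
    simpa using this
  have hzn : z.im ≤ ‖z‖ := (le_abs_self _).trans (Complex.abs_im_le_norm z)
  set D := ‖(x : ℂ) * z + y‖
  have hD : 0 ≤ D := norm_nonneg _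
  rcases max_cases |x| |y| with ⟨h, _⟩ | ⟨h, _⟩ <;> rw [h]
  · calc _ ≤ z.im / 2 * |x| := by gcongr; exact min_le_left _ _
      _ ≤ D := by nlinarith [abs_nonneg x]
  · calc _ ≤ z.im / (2 * (1 + ‖z‖)) * |y| := by gcongr; exact min_le_right _ _
      _ ≤ z.im / (2 * (1 + ‖z‖)) * (D + |x| * ‖z‖) := by gcongr
      _ = (z.im * D + |x| * z.im * ‖z‖) / (2 * (1 + ‖z‖)) := by ring
      _ ≤ D := by
        rw [div_le_iff₀ (by positivity)]
        nlinarith [mul_le_mul_of_nonneg_right him (norm_nonneg z),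
          mul_le_mul_of_nonneg_right hzn hD]

lemma summable_max_rpow {σ : ℝ} (hσ : 2 < σ) :
    Summable fun p : ℤ × ℤ => (max |(p.1 : ℝ)| |(p.2 : ℝ)|) ^ (-σ) := by
  have h := EisensteinSeries.summable_one_div_norm_rpow hσ
  rw [← (finTwoArrowEquiv ℤ).symm.summable_iff] at h
  refine h.congr fun p => ?_
  simp only [Function.comp, finTwoArrowEquiv_symm_apply]
  congr 1
  rw [EisensteinSeries.norm_eq_max_natAbs]
  push_cast
  simp [Nat.cast_natAbs]

/-- The terms of the Eisenstein series as a family over all of `ℤ × ℤ`. -/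
def latticeTerm (z : ℂ) (p q : ℤ → ℂ) (r₁ r₂ : ℝ) (s : ℂ) (x : ℤ × ℤ) : ℂ :=
  p x.1 * q x.2 * branchPow (((x.1 : ℂ) + r₁) * z + x.2 + r₂) (-s)

lemma lattice_ne_zero {z : ℂ} (hz : 0 < z.im) {x y : ℝ} (h : ¬ (x = 0 ∧ y = 0)) :
    (x : ℂ) * z + y ≠ 0 := by
  intro h0
  have h1 : x = 0 := by
    have := congrArg Complex.im h0
    simpa [hz.ne'] using this
  refine h ⟨h1, ?_⟩
  simpa [h1] using h0

lemma summable_latticeTerm {k : ℕ} (hk : 0 < k) {z : ℂ} (hz : 0 < z.im) {p q : ℤ → ℂ}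
    (hp : Function.Periodic p (k : ℤ)) (hq : Function.Periodic q (k : ℤ)) (r₁ r₂ : ℝ) {s : ℂ}
    (hs : 2 < s.re) : Summable fun x => ‖latticeTerm z p q r₁ r₂ s x‖ := by
  obtain ⟨A, hA, hpA⟩ := exists_norm_le_of_periodic hk hp
  obtain ⟨B, hB, hqB⟩ := exists_norm_le_of_periodic hk hq
  obtain ⟨c, hc, hcz⟩ := exists_mul_max_le_norm hz
  have hσ : 0 < s.re := by linarith
  refine Summable.of_norm_bounded_eventually
    (g := fun x : ℤ × ℤ => A * B * Real.exp (Real.pi * ‖-s‖) * (c / 2) ^ (-s.re) *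
      (max |(x.1 : ℝ)| |(x.2 : ℝ)|) ^ (-s.re))
    ((summable_max_rpow hs).mul_left _) ?_
  -- the shift `(r₁, r₂)` costs at most a factor `2` outside a finite box
  obtain ⟨R, hR⟩ := exists_nat_gt (2 * max |r₁| |r₂|)
  have hfin : ((Finset.Icc (-(R : ℤ)) R ×ˢ Finset.Icc (-(R : ℤ)) R : Finset (ℤ × ℤ)) :
      Set (ℤ × ℤ)).Finite := Finset.finite_toSet _
  filter_upwards [hfin.compl_mem_cofinite] with x hx
  rw [norm_norm]
  set m := max |(x.1 : ℝ)| |(x.2 : ℝ)| with hm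
  have hbig : (R : ℝ) < m := by
    by_contra hcon
    push Not at hcon
    apply hx
    have e1 : |(x.1 : ℝ)| ≤ R := (le_max_left _ _).trans hcon
    have e2 : |(x.2 : ℝ)| ≤ R := (le_max_right _ _).trans hcon
    rw [abs_le] at e1 e2
    simp only [Finset.coe_product, Finset.coe_Icc, Set.mem_prod, Set.mem_Icc]
    exact ⟨⟨by exact_mod_cast e1.1, by exact_mod_cast e1.2⟩,
      by exact_mod_cast e2.1, by exact_mod_cast e2.2⟩
  have hr1 : |r₁| ≤ m / 2 := by linarith [le_max_left |r₁| |r₂|]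
  have hr2 : |r₂| ≤ m / 2 := by linarith [le_max_right |r₁| |r₂|]
  have hmpos : 0 < m := lt_of_le_of_lt (Nat.cast_nonneg R) hbig
  have hmax : m / 2 ≤ max |(x.1 : ℝ) + r₁| |(x.2 : ℝ) + r₂| := by
    have t1 : |(x.1 : ℝ)| - |r₁| ≤ |(x.1 : ℝ) + r₁| := by
      have := abs_sub_abs_le_abs_sub (x.1 : ℝ) (-r₁)
      simpa using this
    have t2 : |(x.2 : ℝ)| - |r₂| ≤ |(x.2 : ℝ) + r₂| := by
      have := abs_sub_abs_le_abs_sub (x.2 : ℝ) (-r₂)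
      simpa using this
    rcases max_cases |(x.1 : ℝ)| |(x.2 : ℝ)| with ⟨h, _⟩ | ⟨h, _⟩
    · exact le_trans (by rw [← hm] at h; linarith) (le_max_left _ _)
    · exact le_trans (by rw [← hm] at h; linarith) (le_max_right _ _)
  set w : ℂ := ((x.1 : ℂ) + r₁) * z + x.2 + r₂ with hw
  have hwlow : c / 2 * m ≤ ‖w‖ := by
    have := hcz ((x.1 : ℝ) + r₁) ((x.2 : ℝ) + r₂)
    push_cast at this
    rw [← add_assoc] at this
    calc c / 2 * m = c * (m / 2) := by ring
      _ ≤ _ := by gcongr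
      _ ≤ _ := this
  have hw0 : w ≠ 0 := by
    rw [← norm_pos_iff]; exact lt_of_lt_of_le (by positivity) hwlow
  rw [latticeTerm, norm_mul, norm_mul]
  calc ‖p x.1‖ * ‖q x.2‖ * ‖branchPow w (-s)‖
      ≤ A * B * (Real.exp (Real.pi * ‖-s‖) * ‖w‖ ^ (-s).re) := by
        gcongr
        · exact hpA _
        · exact hqB _
        · exact norm_branchPow_le hw0 _
    _ ≤ A * B * (Real.exp (Real.pi * ‖-s‖) * (c / 2 * m) ^ (-s.re)) := by
        gcongr
        rw [Complex.neg_re]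
        exact Real.rpow_le_rpow_of_nonpos (by positivity) hwlow (by linarith)
    _ = _ := by
        rw [Real.mul_rpow (by positivity) hmpos.le]; ring

/-- The index set of the Eisenstein series as a set. -/
def eisSet (r₁ r₂ : ℝ) : Set (ℤ × ℤ) := {x | ¬ ((x.1 : ℝ) = -r₁ ∧ (x.2 : ℝ) = -r₂)}

lemma hasSum_eisTerm_iff {z : ℂ} {p q : ℤ → ℂ} {r₁ r₂ : ℝ} {s a : ℂ} :
    HasSum (fun i => eisTerm z p q r₁ r₂ i s) a ↔
      HasSum ((eisSet r₁ r₂).indicator (latticeTerm z p q r₁ r₂ s)) a :=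
  hasSum_subtype_iff_indicator (f := latticeTerm z p q r₁ r₂ s) (s := eisSet r₁ r₂)

/-! ### The Lipschitz formula with a complex exponent -/

/-- The function `x ^ (s - 1) e(τ x)` for `x > 0`, continued by zero. -/
def lipschitzFun (τ s : ℂ) (x : ℝ) : ℂ :=
  ((max x 0 : ℝ) : ℂ) ^ (s - 1) * cexp (2 * Real.pi * Complex.I * τ * x)

lemma lipschitzFun_of_nonpos {τ s : ℂ} (hs : 1 < s.re) {x : ℝ} (hx : x ≤ 0) :
    lipschitzFun τ s x = 0 := by
  have : s - 1 ≠ 0 := by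
    intro h
    have := congrArg Complex.re h
    simp at this; linarith
  simp [lipschitzFun, max_eq_right hx, Complex.zero_cpow this]

lemma lipschitzFun_of_pos {τ s : ℂ} {x : ℝ} (hx : 0 < x) :
    lipschitzFun τ s x = (x : ℂ) ^ (s - 1) * cexp (2 * Real.pi * Complex.I * τ * x) := by
  rw [lipschitzFun, max_eq_left hx.le]

lemma continuous_lipschitzFun {τ s : ℂ} (hs : 1 < s.re) : Continuous (lipschitzFun τ s) := by
  have h1 : Continuous fun x : ℝ => (x : ℂ) ^ (s - 1) :=
    Complex.continuous_ofReal_cpow_const (by simpa using hs)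
  exact (h1.comp (continuous_id.max continuous_const)).mul (by fun_prop)

lemma lipschitzFun_isBigO {τ s : ℂ} (hτ : 0 < τ.im) (hs : 1 < s.re) (b : ℝ) :
    lipschitzFun τ s =O[cocompact ℝ] fun x => |x| ^ (-b) := by
  rw [cocompact_eq_atBot_atTop, Asymptotics.isBigO_sup]
  constructor
  · refine Asymptotics.IsBigO.of_bound 0 ?_
    filter_upwards [eventually_le_atBot 0] with x hx
    simp [lipschitzFun_of_nonpos hs hx]
  · have h1 := isLittleO_exp_neg_mul_rpow_atTop (a := 2 * Real.pi * τ.im) (by positivity)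
      (-b - (s.re - 1))
    have h2 := (Asymptotics.isBigO_refl (fun x : ℝ => x ^ (s.re - 1)) atTop).mul h1.isBigO
    refine Asymptotics.IsBigO.trans (Asymptotics.IsBigO.of_norm_eventuallyLE ?_)
      (h2.congr' EventuallyEq.rfl ?_)
    · filter_upwards [eventually_gt_atTop 0] with x hx
      rw [lipschitzFun_of_pos hx, norm_mul, Complex.norm_cpow_eq_rpow_re_of_pos hx,
        Complex.norm_exp]
      apply le_of_eq
      simp
    · filter_upwards [eventually_gt_atTop 0] with x hx
      rw [← Real.rpow_add hx, abs_of_pos hx]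
      congr 1; ring

lemma fourier_lipschitzFun {τ s : ℂ} (hτ : 0 < τ.im) (hs : 1 < s.re) (ξ : ℝ) :
    FourierTransform.fourier (lipschitzFun τ s) ξ
      = Complex.Gamma s * (2 * Real.pi * Complex.I * (ξ - τ)) ^ (-s) := by
  rw [Real.fourier_eq', ← integral_cpow_mul_exp_neg_mul (by linarith)
    (r := 2 * Real.pi * Complex.I * (ξ - τ)) (by simp; positivity),
    ← integral_indicator measurableSet_Ioi]
  congr 1; ext x
  by_cases hx : 0 < x
  · rw [indicator_of_mem (show x ∈ Ioi (0 : ℝ) from hx), lipschitzFun_of_pos hx, smul_eq_mul,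
      mul_left_comm, ← Complex.exp_add]
    congr 2
    simp
    ring
  · rw [indicator_of_notMem (show x ∉ Ioi (0 : ℝ) from hx),
      lipschitzFun_of_nonpos hs (not_lt.1 hx), smul_zero]

lemma fourier_lipschitzFun_isBigO {τ s : ℂ} (hτ : 0 < τ.im) (hs : 1 < s.re) :
    FourierTransform.fourier (lipschitzFun τ s) =O[cocompact ℝ] fun x => |x| ^ (-s.re) := by
  refine Asymptotics.IsBigO.of_bound
    (‖Complex.Gamma s‖ * (Real.exp (Real.pi * ‖-s‖) * Real.pi ^ (-s.re))) ?_
  have hlarge : ∀ᶠ x : ℝ in cocompact ℝ, 2 * ‖τ‖ + 1 ≤ ‖x‖ :=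
    tendsto_norm_cocompact_atTop.eventually_ge_atTop _
  filter_upwards [hlarge] with x hx
  have hxpos : 0 < |x| := by
    rw [Real.norm_eq_abs] at hx
    have := norm_nonneg τ
    linarith
  have hre : 0 < (2 * Real.pi * Complex.I * ((x : ℂ) - τ)).re := by simp; positivity
  have hlow : Real.pi * |x| ≤ ‖2 * Real.pi * Complex.I * ((x : ℂ) - τ)‖ := by
    have h1 : ‖(x : ℂ)‖ - ‖τ‖ ≤ ‖(x : ℂ) - τ‖ := norm_sub_norm_le _ _
    rw [Complex.norm_real] at h1
    rw [Real.norm_eq_abs] at h1 hx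
    have h2 : |x| / 2 ≤ ‖(x : ℂ) - τ‖ := by linarith
    have h3 : ‖2 * (Real.pi : ℂ) * Complex.I * ((x : ℂ) - τ)‖ = 2 * Real.pi * ‖(x : ℂ) - τ‖ := by
      simp [abs_of_pos Real.pi_pos]
    rw [h3]
    nlinarith [Real.pi_pos]
  have hne : (2 * Real.pi * Complex.I * ((x : ℂ) - τ)) ≠ 0 := by
    intro h; rw [h] at hre; simp at hre
  rw [fourier_lipschitzFun hτ hs, norm_mul, ← branchPow_of_re_pos hre,
    mul_assoc ‖Complex.Gamma s‖]
  refine mul_le_mul_of_nonneg_left ?_ (norm_nonneg _)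
  refine (norm_branchPow_le hne _).trans ?_
  rw [mul_assoc (Real.exp _)]
  refine mul_le_mul_of_nonneg_left ?_ (Real.exp_pos _).le
  rw [Real.norm_of_nonneg (by positivity), ← Real.mul_rpow Real.pi_pos.le (abs_nonneg x),
    Complex.neg_re]
  exact Real.rpow_le_rpow_of_nonpos (by positivity) hlow (by linarith)

/-- The Lipschitz formula: Poisson summation for `x ^ (s - 1) e(τ x)`. -/
lemma tsum_lipschitz {τ s : ℂ} (hτ : 0 < τ.im) (hs : 1 < s.re) :
    ∑' n : ℤ, (-(2 * Real.pi * Complex.I * (τ + n))) ^ (-s) = (Complex.Gamma s)⁻¹ *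
      ∑' n : ℕ, ((n + 1 : ℕ) : ℂ) ^ (s - 1) *
        cexp (2 * Real.pi * Complex.I * τ * (n + 1 : ℕ)) := by
  have h := Real.tsum_eq_tsum_fourier_of_rpow_decay (continuous_lipschitzFun (τ := τ) hs) hs
    (lipschitzFun_isBigO hτ hs s.re) (fourier_lipschitzFun_isBigO hτ hs) 0
  have hΓ : Complex.Gamma s ≠ 0 := Complex.Gamma_ne_zero_of_re_pos (by linarith)
  simp only [zero_add, fourier_lipschitzFun hτ hs, QuotientAddGroup.mk_zero, fourier_eval_zero,
    mul_one] at h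
  have hinj : Function.Injective (fun n : ℕ => ((n + 1 : ℕ) : ℤ)) := fun a b hab => by
    simpa using hab
  have hsupp : Function.support (fun n : ℤ => lipschitzFun τ s n)
      ⊆ range (fun n : ℕ => ((n + 1 : ℕ) : ℤ)) := by
    intro n hn
    have hpos : 0 < n := by
      by_contra hcon
      exact hn (lipschitzFun_of_nonpos hs (by exact_mod_cast not_lt.1 hcon))
    exact ⟨(n - 1).toNat, by push_cast; omega⟩
  rw [← hinj.tsum_eq hsupp, tsum_mul_left] at h
  rw [← (Equiv.neg ℤ).tsum_eq]
  have h2 : ∀ n : ℤ, (-(2 * Real.pi * Complex.I * (τ + ((Equiv.neg ℤ) n : ℤ)))) ^ (-s)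
      = (2 * Real.pi * Complex.I * (((n : ℝ) : ℂ) - τ)) ^ (-s) := by
    intro n
    congr 1
    simp; ring
  simp_rw [h2]
  rw [eq_inv_mul_iff_mul_eq₀ hΓ, ← h]
  refine tsum_congr fun n => ?_
  rw [lipschitzFun_of_pos (by positivity)]
  push_cast
  rfl

/-- A quarter turn moves the upper half-plane, where the terms of the Eisenstein series live, to
the right half-plane of the Lipschitz formula. -/
lemma neg_I_mul_cpow {w : ℂ} (hw : 0 < w.im) {r : ℝ} (hr : 0 < r) (s : ℂ) :
    w ^ (-s) = (r : ℂ) ^ s * cexp (-(Real.pi * Complex.I * s / 2)) *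
      (-(r * Complex.I * w)) ^ (-s) := by
  have hw0 : w ≠ 0 := by rintro rfl; simp at hw
  have hr0 : (r : ℂ) ≠ 0 := by exact_mod_cast hr.ne'
  have hlog : Complex.log (-(r * Complex.I * w))
      = Real.log r + Complex.log w - Real.pi / 2 * Complex.I := by
    have ha1 : 0 ≤ w.arg := Complex.arg_nonneg_iff.2 hw.le
    have hI : -Complex.I ≠ 0 := neg_ne_zero.2 Complex.I_ne_zero
    have h1 : Complex.log (-Complex.I * w) = Complex.log (-Complex.I) + Complex.log w := by
      rw [Complex.log_mul_eq_add_log_iff hI hw0, Complex.arg_neg_I]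
      constructor <;> linarith [Real.pi_pos, Complex.arg_le_pi w]
    rw [show -(r * Complex.I * w) = (r : ℂ) * (-Complex.I * w) by ring,
      Complex.log_ofReal_mul hr (mul_ne_zero hI hw0), h1, Complex.log_neg_I]
    ring
  have hne : -(r * Complex.I * w) ≠ 0 := by simp [hr0, hw0]
  rw [Complex.cpow_def_of_ne_zero hw0, Complex.cpow_def_of_ne_zero hr0,
    Complex.cpow_def_of_ne_zero hne, hlog, ← Complex.exp_add, ← Complex.exp_add,
    ← Complex.ofReal_log hr.le]
  congr 1; ring

/-- The Lipschitz formula with periodic coefficients. -/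
lemma tsum_periodic_lipschitz {k : ℕ} [NeZero k] {q : ℤ → ℂ} (hq : Function.Periodic q (k : ℤ))
    {τ s : ℂ} (hτ : 0 < τ.im) (hs : 1 < s.re)
    (hsum : Summable fun n : ℤ => q n * (τ + n) ^ (-s)) :
    ∑' n : ℤ, q n * (τ + n) ^ (-s) =
      ((2 * Real.pi / k : ℝ) : ℂ) ^ s * cexp (-(Real.pi * Complex.I * s / 2)) *
        (Complex.Gamma s)⁻¹ * ∑ i : Fin k, q (i : ℕ) *
          ∑' n : ℕ, ((n + 1 : ℕ) : ℂ) ^ (s - 1) *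
            cexp (2 * Real.pi * Complex.I * ((τ + (i : ℕ)) / k) * (n + 1 : ℕ)) := by
  have hk : (0 : ℝ) < k := by exact_mod_cast Nat.pos_of_ne_zero (NeZero.ne k)
  have hkc : (k : ℂ) ≠ 0 := by exact_mod_cast NeZero.ne k
  obtain ⟨e, heq⟩ : ∃ e : Fin k × ℤ ≃ ℤ, ∀ x, e x = x.2 * k + ((x.1 : ℕ) : ℤ) :=
    ⟨((Int.divModEquiv k).trans (Equiv.prodComm _ _)).symm, fun x => rfl⟩
  have hsum' : Summable fun x : Fin k × ℤ => q (e x) * (τ + (e x : ℤ)) ^ (-s) :=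
    e.summable_iff.2 hsum
  rw [← e.tsum_eq, hsum'.tsum_prod, tsum_fintype, Finset.mul_sum]
  refine Finset.sum_congr rfl fun i _ => ?_
  have hτi : 0 < ((τ + (i : ℕ)) / k).im := by
    rw [show (k : ℂ) = ((k : ℝ) : ℂ) by simp, Complex.div_ofReal_im]
    simp; positivity
  have hterm : ∀ h : ℤ, q (e (i, h)) * (τ + (e (i, h) : ℤ)) ^ (-s)
      = q (i : ℕ) * (((2 * Real.pi / k : ℝ) : ℂ) ^ s * cexp (-(Real.pi * Complex.I * s / 2))) *
        (-(2 * Real.pi * Complex.I * ((τ + (i : ℕ)) / k + h))) ^ (-s) := by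
    intro h
    have hqi : q (e (i, h)) = q (i : ℕ) := by
      rw [heq]
      simp only
      rw [add_comm]
      exact hq.int_mul h _
    have hw : 0 < (τ + (e (i, h) : ℤ)).im := by simpa using hτ
    rw [hqi, neg_I_mul_cpow hw (r := 2 * Real.pi / k) (by positivity), ← mul_assoc]
    congr 2
    rw [heq]
    push_cast
    field_simp
    ring
  simp_rw [hterm]
  rw [tsum_mul_left, tsum_lipschitz hτi hs]
  ring

/-! ### Analytic continuation of `L` and `G` -/

lemma hasSum_indicator_iff_of_range {β γ : Type*} {φ : β → γ} (hφ : Function.Injective φ)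
    {S : Set γ} (hS : range φ = S) {f : γ → ℂ} {a : ℂ} :
    HasSum (S.indicator f) a ↔ HasSum (fun b => f (φ b)) a := by
  rw [← hφ.hasSum_iff]
  · have : S.indicator f ∘ φ = fun b => f (φ b) := by
      ext b
      exact indicator_of_mem (hS ▸ mem_range_self b) f
    rw [this]
  · intro x hx
    exact indicator_of_notMem (hS ▸ hx) f

lemma hasSum_prod_fintype {β ι : Type*} [Fintype ι] {f : β × ι → ℂ} {a : ι → ℂ}
    (h : ∀ i, HasSum (fun b => f (b, i)) (a i)) : HasSum f (∑ i, a i) := by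
  classical
  have h1 : ∀ i, HasSum ({x : β × ι | x.2 = i}.indicator f) (a i) := fun i =>
    (hasSum_indicator_iff_of_range (φ := fun b : β => (b, i)) (fun a b hab => by simpa using hab)
      (by ext ⟨x, y⟩; simp [eq_comm])).2 (h i)
  have h2 := hasSum_sum (s := Finset.univ) fun i _ => h1 i
  refine h2.congr_fun fun x => ?_
  simp [indicator_apply]

/-- The continuation of `L` as a combination of Hurwitz zeta functions. -/
lemma exists_simplePole_hasSum_lTerm {k : ℕ} [NeZero k] {q : ℤ → ℂ}
    (hq : Function.Periodic q (k : ℤ)) (θ : ℝ) :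
    ∃ F, SimplePoleAtOne F ∧ ∀ s : ℂ, 1 < s.re → HasSum (fun n => lTerm q θ n s) (F s) := by
  have hk : (0 : ℝ) < k := by exact_mod_cast Nat.pos_of_ne_zero (NeZero.ne k)
  have hkc : (k : ℂ) ≠ 0 := by exact_mod_cast NeZero.ne k
  set n₀ : ℤ := ⌊-θ⌋ + 1 with hn₀
  have h0 : 0 < n₀ + θ := by
    have := Int.lt_floor_add_one (-θ)
    rw [hn₀]; push_cast; linarith
  have h1 : n₀ + θ ≤ 1 := by
    have := Int.floor_le (-θ)
    rw [hn₀]; push_cast; linarith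
  refine ⟨fun s => ∑ i : Fin k, (q (n₀ + (i : ℕ)) * (k : ℂ) ^ (-s)) *
    HurwitzZeta.hurwitzZeta (((n₀ + (i : ℕ) + θ) / k : ℝ) : UnitAddCircle) s, ?_, ?_⟩
  · refine SimplePoleAtOne.sum _ fun i _ => SimplePoleAtOne.mul ?_ (simplePoleAtOne_hurwitzZeta _)
    refine (differentiable_const _).mul ?_
    exact (differentiable_id.neg).const_cpow (Or.inl hkc)
  · intro s hs
    let e : ℕ × Fin k → {n : ℤ // -θ < (n : ℝ)} := fun x => ⟨n₀ + ((x.1 * k + (x.2 : ℕ) : ℕ) : ℤ), by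
      have : (0 : ℝ) ≤ ((x.1 * k + (x.2 : ℕ) : ℕ) : ℝ) := by positivity
      rw [Int.cast_add, Int.cast_natCast]
      linarith⟩
    have he : Function.Bijective e := by
      constructor
      · intro x y hxy
        have : x.1 * k + (x.2 : ℕ) = y.1 * k + (y.2 : ℕ) := by
          have := congrArg Subtype.val hxy
          simp only [e] at this
          omega
        exact (Nat.divModEquiv k).symm.injective this
      · rintro ⟨n, hn⟩
        have hn' : n₀ ≤ n := by
          rw [hn₀]
          exact Int.add_one_le_of_lt (Int.floor_lt.2 hn)
        refine ⟨Nat.divModEquiv k (n - n₀).toNat, Subtype.ext ?_⟩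
        have : (Nat.divModEquiv k (n - n₀).toNat).1 * k + (Nat.divModEquiv k (n - n₀).toNat).2
            = (n - n₀).toNat := (Nat.divModEquiv k).symm_apply_apply _
        simp only [e, this]
        omega
    rw [← (Equiv.ofBijective e he).hasSum_iff]
    refine hasSum_prod_fintype fun i => ?_
    have hi : ((i : ℕ) : ℝ) ≤ k - 1 := by
      have : (i : ℕ) + 1 ≤ k := i.2
      have : (((i : ℕ) + 1 : ℕ) : ℝ) ≤ k := by exact_mod_cast this
      push_cast at this; linarith
    have hi0 : (0 : ℝ) ≤ ((i : ℕ) : ℝ) := by positivity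
    have hpos : 0 < (n₀ + (i : ℕ) + θ) / k := by apply div_pos _ hk; linarith
    have hle : (n₀ + (i : ℕ) + θ) / k ≤ 1 := by rw [div_le_one hk]; linarith
    have hz := (HurwitzZeta.hasSum_hurwitzZeta_of_one_lt_re ⟨hpos.le, hle⟩ hs).mul_left
      (q (n₀ + (i : ℕ)) * (k : ℂ) ^ (-s))
    refine hz.congr_fun fun h => ?_
    have hterm : ((n₀ + ((h * k + (i : ℕ) : ℕ) : ℤ) : ℤ) : ℂ) + θ
        = ((k : ℝ) : ℂ) * ((h + (n₀ + (i : ℕ) + θ) / k : ℝ) : ℂ) := by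
      push_cast; field_simp; ring
    have hhpos : 0 < h + (n₀ + (i : ℕ) + θ) / k := by positivity
    simp only [Function.comp, Equiv.ofBijective_apply, lTerm, e]
    rw [hterm, branchPow_of_re_pos (by rw [← Complex.ofReal_mul, Complex.ofReal_re]; positivity),
      Complex.mul_cpow_ofReal_nonneg hk.le hhpos.le, one_div, ← Complex.cpow_neg]
    have hqq : q (n₀ + ((h * k + (i : ℕ) : ℕ) : ℤ)) = q (n₀ + (i : ℕ)) := by
      have := hq.int_mul h (n₀ + (i : ℕ))
      rw [← this]
      congr 1; push_cast; ring
    rw [hqq]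
    push_cast
    ring

lemma isContinuation_L {k : ℕ} [NeZero k] {q : ℤ → ℂ}
    (hq : Function.Periodic q (k : ℤ)) (θ : ℝ) :
    IsContinuation 1 (lTerm q θ) (fun s => L s q θ) := by
  obtain ⟨F, hF, hsum⟩ := exists_simplePole_hasSum_lTerm hq θ
  exact isContinuation_continuation (exists_isContinuation le_rfl hF hsum)

/-- The terms of the Fourier expansion of the part `m + r₁ > 0` of the Eisenstein series; `i` is a
residue class of `n` modulo `k`, and `m = ⌊-r₁⌋ + 1 + x.1`. -/
def fourierTerm (k : ℕ) (z : ℂ) (p q : ℤ → ℂ) (r₁ r₂ : ℝ) (i : Fin k) (s : ℂ) (x : ℕ × ℕ) : ℂ :=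
  p (⌊-r₁⌋ + 1 + x.1) * q (i : ℕ) * (((x.2 + 1 : ℕ) : ℂ) ^ (s - 1) *
    cexp (2 * Real.pi * Complex.I *
      ((((⌊-r₁⌋ + 1 + x.1 : ℤ) + r₁) * z + r₂ + (i : ℕ)) / k) * (x.2 + 1 : ℕ)))

/-- A summable bound for the Fourier terms, uniform in the left half-planes `Re s ≤ N`: they decay
exponentially in both summation variables. -/
lemma exists_fourierTerm_bound {k : ℕ} [NeZero k] {z : ℂ} (hz : 0 < z.im) {p q : ℤ → ℂ}
    (hp : Function.Periodic p (k : ℤ)) (hq : Function.Periodic q (k : ℤ)) (r₁ r₂ : ℝ) (N : ℕ) :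
    ∃ u : ℕ × ℕ → ℝ, Summable u ∧ ∀ i : Fin k, ∀ s : ℂ, s.re ≤ N → ∀ x,
      ‖fourierTerm k z p q r₁ r₂ i s x‖ ≤ u x := by
  have hk0 : 0 < k := Nat.pos_of_ne_zero (NeZero.ne k)
  have hk : (0 : ℝ) < k := by exact_mod_cast hk0
  obtain ⟨A, hA, hpA⟩ := exists_norm_le_of_periodic hk0 hp
  obtain ⟨B, hB, hqB⟩ := exists_norm_le_of_periodic hk0 hq
  set x₀ : ℝ := (⌊-r₁⌋ + 1 : ℤ) + r₁ with hx₀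
  have h0 : 0 < x₀ := by
    have := Int.lt_floor_add_one (-r₁)
    rw [hx₀]; push_cast; linarith
  set δ : ℝ := 2 * Real.pi * z.im / k with hδ
  have hδ0 : 0 < δ := by positivity
  refine ⟨fun x => A * B * (Real.exp (-δ * x.1) *
    (((x.2 + 1 : ℕ) : ℝ) ^ N * Real.exp (-(δ * x₀) * (x.2 + 1 : ℕ)))), ?_, ?_⟩
  · refine Summable.mul_left _ (Summable.mul_of_nonneg (f := fun j : ℕ => Real.exp (-δ * j))
      (g := fun n : ℕ => ((n + 1 : ℕ) : ℝ) ^ N * Real.exp (-(δ * x₀) * (n + 1 : ℕ))) ?_ ?_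
      (fun _ => by positivity) (fun _ => by positivity))
    · simpa using Real.summable_pow_mul_exp_neg_nat_mul 0 hδ0
    · exact (summable_nat_add_iff 1).2
        (Real.summable_pow_mul_exp_neg_nat_mul N (mul_pos hδ0 h0))
  · intro i s hs x
    rw [fourierTerm, norm_mul, norm_mul, norm_mul, Complex.norm_exp,
      Complex.norm_natCast_cpow_of_pos (Nat.succ_pos _)]
    have hre : (2 * Real.pi * Complex.I *
      ((((⌊-r₁⌋ + 1 + x.1 : ℤ) + (r₁ : ℂ)) * z + r₂ + (i : ℕ)) / k) * (x.2 + 1 : ℕ)).re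
        = -(δ * ((x₀ + x.1) * (x.2 + 1 : ℕ))) := by
      have e1 : 2 * (Real.pi : ℂ) * Complex.I *
          ((((⌊-r₁⌋ + 1 + x.1 : ℤ) + (r₁ : ℂ)) * z + r₂ + (i : ℕ)) / k) * (x.2 + 1 : ℕ)
          = ((2 * Real.pi / k * (x.2 + 1 : ℕ) : ℝ) : ℂ) * (Complex.I *
            (((x₀ + x.1 : ℝ) : ℂ) * z + ((r₂ + (i : ℕ) : ℝ) : ℂ))) := by
        rw [hx₀]; push_cast; ring
      rw [e1, Complex.re_ofReal_mul, Complex.I_mul_re, Complex.add_im, Complex.im_ofReal_mul,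
        Complex.ofReal_im, hδ]
      ring
    rw [hre]
    have hn : (1 : ℝ) ≤ ((x.2 + 1 : ℕ) : ℝ) := by exact_mod_cast Nat.succ_le_succ (Nat.zero_le _)
    calc ‖p (⌊-r₁⌋ + 1 + x.1)‖ * ‖q (i : ℕ)‖ * (((x.2 + 1 : ℕ) : ℝ) ^ (s - 1).re *
            Real.exp (-(δ * ((x₀ + x.1) * (x.2 + 1 : ℕ)))))
        ≤ A * B * (((x.2 + 1 : ℕ) : ℝ) ^ (N : ℝ) *
            Real.exp (-δ * x.1 + -(δ * x₀) * (x.2 + 1 : ℕ))) := by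
          gcongr
          · exact hpA _
          · exact hqB _
          · simp; linarith
          · have : (x.1 : ℝ) ≤ x.1 * (x.2 + 1 : ℕ) := le_mul_of_one_le_right (by positivity) hn
            have := mul_le_mul_of_nonneg_left this hδ0.le
            linarith
      _ = _ := by rw [Real.exp_add, Real.rpow_natCast]; ring

/-- The part `m + r₁ > 0` of the Eisenstein series is entire in `s`: the Lipschitz formula turns
the sum over `n` into an exponentially decaying one. -/
lemma exists_differentiable_hasSum_upper {k : ℕ} [NeZero k] {z : ℂ} (hz : 0 < z.im) {p q : ℤ → ℂ}
    (hp : Function.Periodic p (k : ℤ)) (hq : Function.Periodic q (k : ℤ)) (r₁ r₂ : ℝ) :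
    ∃ F, Differentiable ℂ F ∧ ∀ s : ℂ, 2 < s.re →
      HasSum ({x : ℤ × ℤ | 0 < x.1 + r₁}.indicator (latticeTerm z p q r₁ r₂ s)) (F s) := by
  have hk0 : 0 < k := Nat.pos_of_ne_zero (NeZero.ne k)
  have hk : (0 : ℝ) < k := by exact_mod_cast hk0
  have hsumF : ∀ i : Fin k, ∀ s, Summable (fourierTerm k z p q r₁ r₂ i s) := by
    intro i s
    obtain ⟨N, hN⟩ := exists_nat_ge s.re
    obtain ⟨u, hu, hb⟩ := exists_fourierTerm_bound hz hp hq r₁ r₂ N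
    exact Summable.of_norm_bounded hu fun x => hb i s hN x
  refine ⟨fun s => ((2 * Real.pi / k : ℝ) : ℂ) ^ s * cexp (-(Real.pi * Complex.I * s / 2)) *
        (Complex.Gamma s)⁻¹ * ∑ i : Fin k, ∑' x, fourierTerm k z p q r₁ r₂ i s x, ?_, ?_⟩
  · have hd : ∀ i : Fin k, Differentiable ℂ fun s => ∑' x, fourierTerm k z p q r₁ r₂ i s x := by
      intro i s₀
      obtain ⟨N, hN⟩ := exists_nat_gt s₀.re
      obtain ⟨u, hu, hb⟩ := exists_fourierTerm_bound hz hp hq r₁ r₂ N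
      have hopen : IsOpen {s : ℂ | s.re < N} := isOpen_lt Complex.continuous_re continuous_const
      refine (Complex.differentiableOn_tsum_of_summable_norm (F := fun x s =>
        fourierTerm k z p q r₁ r₂ i s x) hu (fun x => ?_) hopen
        fun x s hs => hb i s (le_of_lt hs) x).differentiableAt (hopen.mem_nhds hN)
      refine Differentiable.differentiableOn ?_
      unfold fourierTerm
      refine Differentiable.const_mul (Differentiable.mul_const ?_ _) _
      exact (differentiable_id.sub_const 1).const_cpow
        (Or.inl (by exact_mod_cast Nat.succ_ne_zero x.2))
    have hc : Differentiable ℂ fun s : ℂ => ((2 * Real.pi / k : ℝ) : ℂ) ^ s :=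
      differentiable_id.const_cpow (Or.inl (by
        exact_mod_cast (by positivity : 2 * Real.pi / (k : ℝ) ≠ 0)))
    exact ((hc.mul (by fun_prop)).mul Complex.differentiable_one_div_Gamma).mul
      (Differentiable.fun_sum fun i _ => hd i)
  · intro s hs
    set φ : ℕ × ℤ → ℤ × ℤ := fun x => (⌊-r₁⌋ + 1 + x.1, x.2) with hφ
    have hinj : Function.Injective φ := by
      rintro ⟨a, b⟩ ⟨a', b'⟩ h
      simp only [hφ, Prod.mk.injEq] at h
      ext <;> simp <;> omega
    have hrange : range φ = {x : ℤ × ℤ | 0 < x.1 + r₁} := by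
      ext ⟨m, n⟩
      simp only [mem_range, mem_ofPred_eq, hφ]
      have : 0 < (m : ℝ) + r₁ ↔ ⌊-r₁⌋ < m := by
        rw [Int.floor_lt]; constructor <;> intro h <;> linarith
      rw [this]
      constructor
      · rintro ⟨⟨j, n'⟩, h⟩
        simp only [Prod.mk.injEq] at h
        omega
      · intro h
        refine ⟨⟨(m - ⌊-r₁⌋ - 1).toNat, n⟩, ?_⟩
        simp only [Prod.mk.injEq, and_true]
        omega
    rw [hasSum_indicator_iff_of_range hinj hrange]
    have hs0 : Summable fun x : ℕ × ℤ => latticeTerm z p q r₁ r₂ s (φ x) :=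
      (summable_latticeTerm hk0 hz hp hq r₁ r₂ hs).of_norm.comp_injective hinj
    refine hs0.hasSum_iff.2 ?_
    rw [hs0.tsum_prod]
    simp_rw [fun i => (hsumF i s).tsum_prod]
    rw [← Summable.tsum_finsetSum fun i _ => (hsumF i s).prod, ← tsum_mul_left]
    refine tsum_congr fun j => ?_
    set τ : ℂ := ((⌊-r₁⌋ + 1 + j : ℤ) + (r₁ : ℂ)) * z + r₂ with hτdef
    have hτ : 0 < τ.im := by
      have h0 : 0 < ((⌊-r₁⌋ + 1 + j : ℤ) : ℝ) + r₁ := by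
        have h1 := Int.lt_floor_add_one (-r₁)
        have h2 : (0 : ℝ) ≤ j := by positivity
        push_cast; linarith
      have h1 : τ = (((⌊-r₁⌋ + 1 + j : ℤ) + r₁ : ℝ) : ℂ) * z + r₂ := by
        rw [hτdef]; push_cast; ring
      rw [h1, Complex.add_im, Complex.im_ofReal_mul, Complex.ofReal_im, add_zero]
      positivity
    have hterm : ∀ n : ℤ, latticeTerm z p q r₁ r₂ s (φ (j, n))
        = p (⌊-r₁⌋ + 1 + j) * (q n * (τ + n) ^ (-s)) := by
      intro n
      have hn : 0 < (τ + n).im := by simpa using hτ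
      rw [latticeTerm, ← branchPow_of_im_pos hn, mul_assoc]
      congr 3
      simp only [hτdef, hφ]; push_cast; ring
    by_cases hp0 : p (⌊-r₁⌋ + 1 + j) = 0
    · simp [hterm, fourierTerm, hp0]
    have hsj : Summable fun n : ℤ => q n * (τ + n) ^ (-s) := by
      have := hs0.prod_factor j
      simp_rw [hterm] at this
      exact (summable_mul_left_iff hp0).1 this
    simp_rw [hterm]
    rw [tsum_mul_left, tsum_periodic_lipschitz hq hτ (by linarith) hsj, mul_left_comm]
    congr 1
    rw [Finset.mul_sum]
    refine Finset.sum_congr rfl fun i _ => ?_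
    rw [← tsum_mul_left, ← tsum_mul_left]
    refine tsum_congr fun n => ?_
    rw [fourierTerm]
    ring

/-- Passing from `x` to `-x` in the lattice, on the side where the imaginary part is positive. -/
lemma latticeTerm_neg {z : ℂ} {p q : ℤ → ℂ} {r₁ r₂ : ℝ} {s : ℂ} {x : ℤ × ℤ}
    (hx : 0 < ((((x.1 : ℂ) + (-r₁ : ℝ)) * z + x.2 + (-r₂ : ℝ))).im ∨
      ((((x.1 : ℂ) + (-r₁ : ℝ)) * z + x.2 + (-r₂ : ℝ))).im = 0 ∧
        0 < ((((x.1 : ℂ) + (-r₁ : ℝ)) * z + x.2 + (-r₂ : ℝ))).re) :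
    latticeTerm z p q r₁ r₂ s (-x) = cexp (Real.pi * Complex.I * s) *
      latticeTerm z (fun n => p (-n)) (fun n => q (-n)) (-r₁) (-r₂) s x := by
  set w : ℂ := ((x.1 : ℂ) + (-r₁ : ℝ)) * z + x.2 + (-r₂ : ℝ) with hw
  have hneg : (((-x).1 : ℂ) + r₁) * z + (-x).2 + r₂ = -w := by
    rw [hw]; simp only [Prod.fst_neg, Prod.snd_neg]; push_cast; ring
  have h1 : branchPow w (-s) = w ^ (-s) := by
    rcases hx with hx | hx
    · exact branchPow_of_im_pos hx _
    · exact branchPow_of_re_pos hx.2 _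
  have h2 : branchPow (-w) (-s) = cexp (Real.pi * Complex.I * s) * w ^ (-s) := by
    rw [branchPow_eq_exp_mul_neg_cpow, neg_neg]
    · congr 2; ring
    · rcases hx with hx | hx
      · left; simpa using hx
      · right; simpa using hx
  rw [latticeTerm, latticeTerm, hneg, h2, ← hw, h1]
  simp only [Prod.fst_neg, Prod.snd_neg]
  ring

lemma lattice_im {z : ℂ} (r₁ r₂ : ℝ) (x : ℤ × ℤ) :
    (((x.1 : ℂ) + r₁) * z + x.2 + r₂).im = (x.1 + r₁) * z.im := by
  simp

lemma lattice_re {z : ℂ} (r₁ r₂ : ℝ) (x : ℤ × ℤ) :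
    (((x.1 : ℂ) + r₁) * z + x.2 + r₂).re = (x.1 + r₁) * z.re + x.2 + r₂ := by
  simp

lemma periodic_comp_neg {k : ℕ} {p : ℤ → ℂ} (hp : Function.Periodic p (k : ℤ)) :
    Function.Periodic (fun n => p (-n)) (k : ℤ) := fun n => by
  simp only [neg_add]
  exact hp.sub_eq (-n)

/-- The real row `m + r₁ = 0` of the Eisenstein series, if there is one, consists of two series
of type `L`, one for each sign of `n + r₂`. -/
lemma exists_simplePole_hasSum_zeroRow {k : ℕ} [NeZero k] (z : ℂ) (p : ℤ → ℂ) {q : ℤ → ℂ}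
    (hq : Function.Periodic q (k : ℤ)) (r₁ r₂ : ℝ) :
    ∃ F, SimplePoleAtOne F ∧ ∀ s : ℂ, 1 < s.re →
      HasSum ({x : ℤ × ℤ | x.1 + r₁ = 0 ∧ x.2 + r₂ ≠ 0}.indicator (latticeTerm z p q r₁ r₂ s))
        (F s) := by
  by_cases hr : ∃ m : ℤ, (m : ℝ) + r₁ = 0
  · obtain ⟨m, hm⟩ := hr
    obtain ⟨F₁, hF₁, hs₁⟩ := exists_simplePole_hasSum_lTerm hq r₂
    obtain ⟨F₂, hF₂, hs₂⟩ := exists_simplePole_hasSum_lTerm (periodic_comp_neg hq) (-r₂)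
    have hmC : (m : ℂ) + r₁ = 0 := by exact_mod_cast hm
    refine ⟨fun s => p m * F₁ s + (p m * cexp (Real.pi * Complex.I * s)) * F₂ s,
      (SimplePoleAtOne.mul (differentiable_const _) hF₁).add
        (SimplePoleAtOne.mul (by fun_prop) hF₂), fun s hs => ?_⟩
    set S₁ : Set (ℤ × ℤ) := {x | x.1 + r₁ = 0 ∧ 0 < x.2 + r₂} with hS₁
    set S₂ : Set (ℤ × ℤ) := {x | x.1 + r₁ = 0 ∧ x.2 + r₂ < 0} with hS₂
    have hm' : ∀ n : ℤ, (n : ℝ) + r₁ = 0 ↔ n = m := fun n =>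
      ⟨fun h => by exact_mod_cast (by linarith : (n : ℝ) = m), fun h => h ▸ hm⟩
    have h1 : HasSum (S₁.indicator (latticeTerm z p q r₁ r₂ s)) (p m * F₁ s) := by
      rw [hasSum_indicator_iff_of_range (φ := fun n : {n : ℤ // -r₂ < (n : ℝ)} => (m, n.1))
        (fun a b hab => by simpa [Subtype.ext_iff] using hab)]
      · refine ((hs₁ s hs).mul_left (p m)).congr_fun fun n => ?_
        rw [latticeTerm, lTerm]
        simp only [hmC, zero_mul, zero_add]
        ring
      · ext ⟨a, b⟩
        simp only [mem_range, hS₁, mem_ofPred_eq, hm', Prod.mk.injEq, Subtype.exists]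
        constructor
        · rintro ⟨n, hn, rfl, rfl⟩; exact ⟨rfl, by linarith⟩
        · rintro ⟨rfl, h⟩; exact ⟨b, by linarith, rfl, rfl⟩
    have h2 : HasSum (S₂.indicator (latticeTerm z p q r₁ r₂ s))
        ((p m * cexp (Real.pi * Complex.I * s)) * F₂ s) := by
      rw [hasSum_indicator_iff_of_range
        (φ := fun n : {n : ℤ // -(-r₂) < (n : ℝ)} => (-(-m, n.1) : ℤ × ℤ))
        (fun a b hab => by simpa [Subtype.ext_iff] using hab)]
      · refine ((hs₂ s hs).mul_left (p m * cexp (Real.pi * Complex.I * s))).congr_fun fun n => ?_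
        have hmC' : ((-m : ℤ) : ℂ) + ((-r₁ : ℝ) : ℂ) = 0 := by
          push_cast; linear_combination -hmC
        have hn := n.2
        rw [latticeTerm_neg, latticeTerm, lTerm]
        · simp only [hmC', zero_mul, zero_add, neg_neg]
          ring
        · right
          simp only [hmC', zero_mul, zero_add]
          simp; linarith
      · ext ⟨a, b⟩
        simp only [mem_range, hS₂, mem_ofPred_eq, hm', Prod.mk.injEq, Subtype.exists, Prod.neg_mk,
          neg_neg]
        constructor
        · rintro ⟨n, hn, rfl, rfl⟩; exact ⟨rfl, by push_cast; linarith⟩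
        · rintro ⟨rfl, h⟩; exact ⟨-b, by push_cast; linarith, rfl, by simp⟩
    refine (h1.add h2).congr_fun fun x => ?_
    simp only [indicator_apply, hS₁, hS₂, mem_ofPred_eq]
    by_cases ha : (x.1 : ℝ) + r₁ = 0
    · rcases lt_trichotomy ((x.2 : ℝ) + r₂) 0 with hb | hb | hb
      · simp [ha, hb, hb.ne, hb.not_gt]
      · simp [ha, hb]
      · simp [ha, hb, hb.ne', hb.not_gt]
    · simp [ha]
  · refine ⟨fun _ => 0, SimplePoleAtOne.of_differentiable (differentiable_const 0), fun s _ => ?_⟩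
    refine hasSum_zero.congr_fun fun x => ?_
    refine indicator_of_notMem (fun hx => hr ⟨x.1, hx.1⟩) _

/-- The rows with `m + r₁ > 0` and, by the sign change `(m, n) ↦ (-m, -n)`, those with `m + r₁ < 0`
are entire in `s`; a pole at `1` can only come from the row `m + r₁ = 0`. -/
lemma isContinuation_G {k : ℕ} [NeZero k] {z : ℂ} (hz : 0 < z.im) {p q : ℤ → ℂ}
    (hp : Function.Periodic p (k : ℤ)) (hq : Function.Periodic q (k : ℤ)) (r₁ r₂ : ℝ) :
    IsContinuation 2 (eisTerm z p q r₁ r₂) (fun s => G z s p q r₁ r₂) := by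
  obtain ⟨F₁, hF₁, hs₁⟩ := exists_differentiable_hasSum_upper hz hp hq r₁ r₂
  obtain ⟨F₂, hF₂, hs₂⟩ := exists_differentiable_hasSum_upper hz (periodic_comp_neg hp)
    (periodic_comp_neg hq) (-r₁) (-r₂)
  obtain ⟨F₃, hF₃, hs₃⟩ := exists_simplePole_hasSum_zeroRow z p hq r₁ r₂
  have hF : SimplePoleAtOne fun s => (F₁ s + cexp (Real.pi * Complex.I * s) * F₂ s) + F₃ s :=
    (SimplePoleAtOne.of_differentiable (by fun_prop)).add hF₃
  refine isContinuation_continuation (exists_isContinuation one_le_two hF fun s hs => ?_)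
  rw [hasSum_eisTerm_iff]
  have h2 : HasSum ({x : ℤ × ℤ | x.1 + r₁ < 0}.indicator (latticeTerm z p q r₁ r₂ s))
      (cexp (Real.pi * Complex.I * s) * F₂ s) := by
    rw [← (Equiv.neg (ℤ × ℤ)).hasSum_iff]
    refine ((hs₂ s hs).mul_left (cexp (Real.pi * Complex.I * s))).congr_fun fun x => ?_
    simp only [Function.comp, Equiv.neg_apply, indicator_apply, mem_ofPred_eq]
    have hiff : ((-x).1 : ℝ) + r₁ < 0 ↔ 0 < (x.1 : ℝ) + -r₁ := by
      simp only [Prod.fst_neg, Int.cast_neg]; constructor <;> intro h <;> linarith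
    by_cases h : 0 < (x.1 : ℝ) + -r₁
    · rw [if_pos h, if_pos (hiff.2 h), latticeTerm_neg]
      left
      rw [lattice_im]
      exact mul_pos h hz
    · rw [if_neg h, if_neg (hiff.not.2 h), mul_zero]
  refine (((hs₁ s hs).add h2).add (hs₃ s (by linarith))).congr_fun fun x => ?_
  simp only [indicator_apply, mem_ofPred_eq, eisSet]
  rcases lt_trichotomy ((x.1 : ℝ) + r₁) 0 with h | h | h
  · have h' : ¬ ((x.1 : ℝ) = -r₁ ∧ (x.2 : ℝ) = -r₂) := fun hh => by linarith [hh.1]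
    simp [h, h.ne, h.not_gt, h']
  · have e1 : (x.1 : ℝ) = -r₁ := by linarith
    have e2 : (x.2 : ℝ) = -r₂ ↔ (x.2 : ℝ) + r₂ = 0 := by
      constructor <;> intro hh <;> linarith
    simp only [e1, e2, true_and]
    simp
  · have h' : ¬ ((x.1 : ℝ) = -r₁ ∧ (x.2 : ℝ) = -r₂) := fun hh => by linarith [hh.1]
    simp [h, h.ne', h.not_gt, h']

/-! ### The double geometric series and its Mellin transform -/

/-- The factor of the loop integrand that does not depend on `s`: up to sign, a product of two
geometric series. -/
def loopKernel (ω : ℂ) (κ α β : ℝ) (u : ℂ) : ℂ :=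
  cexp (-(α * ω * u)) / (cexp (-(ω * u)) - 1) * (cexp (β * κ * u) / (cexp (κ * u) - 1))

lemma hasSum_loopKernel {ω : ℂ} {κ α β t : ℝ} (hω : 0 < ω.re) (hκ : 0 < κ) (ht : 0 < t) :
    HasSum (fun x : ℕ × ℕ => cexp (-((ω * (x.1 + α) + κ * (x.2 + 1 - β)) * t)))
      (-loopKernel ω κ α β t) := by
  have n1 : ‖cexp (-(ω * t))‖ < 1 := by
    rw [Complex.norm_exp]
    simpa using mul_pos hω ht
  have n2 : ‖cexp (-(κ * t : ℂ))‖ < 1 := by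
    rw [Complex.norm_exp]
    simpa using mul_pos hκ ht
  have s1 : Summable fun n : ℕ => ‖cexp (-(α * ω * t)) * cexp (-(ω * t)) ^ n‖ := by
    simp_rw [norm_mul, norm_pow]
    exact (summable_geometric_of_lt_one (norm_nonneg _) n1).mul_left _
  have s2 : Summable fun n : ℕ => ‖cexp (-(κ * (1 - β) * t)) * cexp (-(κ * t : ℂ)) ^ n‖ := by
    simp_rw [norm_mul, norm_pow]
    exact (summable_geometric_of_lt_one (norm_nonneg _) n2).mul_left _
  have h := (summable_mul_of_summable_norm s1 s2).hasSum
  rw [← tsum_mul_tsum_of_summable_norm s1 s2, tsum_mul_left, tsum_mul_left,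
    tsum_geometric_of_norm_lt_one n1, tsum_geometric_of_norm_lt_one n2] at h
  have hval : cexp (-(α * ω * t)) * (1 - cexp (-(ω * t)))⁻¹ *
      (cexp (-(κ * (1 - β) * t)) * (1 - cexp (-(κ * t : ℂ)))⁻¹) = -loopKernel ω κ α β t := by
    have d1 : 1 - cexp (-(ω * t)) ≠ 0 := by
      intro h0
      rw [← sub_eq_zero.1 h0] at n1; simp at n1
    have d2 : 1 - cexp (-(κ * t : ℂ)) ≠ 0 := by
      intro h0
      rw [← sub_eq_zero.1 h0] at n2; simp at n2
    have d3 : cexp (κ * t) - 1 ≠ 0 := by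
      intro h0
      apply d2
      rw [Complex.exp_neg, sub_eq_zero.1 h0]; simp
    have d1' : cexp (-(ω * t)) - 1 ≠ 0 := by rwa [← neg_ne_zero, neg_sub]
    have e1 : cexp (-(κ * (1 - β) * t)) * (1 - cexp (-(κ * t : ℂ)))⁻¹
        = cexp (β * κ * t) / (cexp (κ * t) - 1) := by
      rw [eq_div_iff d3, mul_assoc, inv_mul_eq_div]
      have : cexp (κ * t) - 1 = cexp (κ * t) * (1 - cexp (-(κ * t : ℂ))) := by
        rw [mul_sub, ← Complex.exp_add]; simp
      rw [this, mul_div_assoc, div_self d2, mul_one, ← Complex.exp_add]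
      congr 1; ring
    rw [e1, loopKernel, ← neg_sub (cexp (-(ω * t))) 1, inv_neg]
    ring
  rw [hval] at h
  refine h.congr_fun fun x => ?_
  rw [← Complex.exp_nat_mul, ← Complex.exp_nat_mul, ← Complex.exp_add, ← Complex.exp_add,
    ← Complex.exp_add]
  congr 1; ring

/-- Convergence of the Barnes double series for real parameters. -/
lemma summable_add_rpow {a b α γ σ : ℝ} (ha : 0 < a) (hb : 0 < b) (hα : 0 < α) (hγ : 0 < γ)
    (hσ : 2 < σ) :
    Summable fun x : ℕ × ℕ => (a * (x.1 + α) + b * (x.2 + γ)) ^ (-σ) := by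
  have h1 : ∀ {c δ : ℝ}, 0 < c → 0 < δ →
      Summable fun n : ℕ => (c * ((n : ℝ) + δ)) ^ (-(σ / 2)) := by
    intro c δ hc hδ
    have := ((Real.summable_one_div_nat_add_rpow δ (σ / 2)).2 (by linarith)).mul_left
      (c ^ (-(σ / 2)))
    refine this.congr fun n => ?_
    have hn : (0 : ℝ) < n + δ := by positivity
    rw [Real.mul_rpow hc.le hn.le, abs_of_pos hn, one_div, ← Real.rpow_neg hn.le]
  refine Summable.of_nonneg_of_le (fun x => by positivity) (fun x => ?_)
    (Summable.mul_of_nonneg (h1 ha hα) (h1 hb hγ) (fun _ => by positivity)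
      (fun _ => by positivity))
  set A := a * ((x.1 : ℝ) + α) with hA
  set B := b * ((x.2 : ℝ) + γ) with hB
  have hA0 : 0 < A := by positivity
  have hB0 : 0 < B := by positivity
  -- `(A + B) ^ 2 ≥ A B` separates the two variables
  calc (A + B) ^ (-σ) = ((A + B) ^ (2 : ℝ)) ^ (-(σ / 2)) := by
        rw [← Real.rpow_mul (by positivity)]; congr 1; ring
    _ ≤ (A * B) ^ (-(σ / 2)) := by
        refine Real.rpow_le_rpow_of_nonpos (by positivity) ?_ (by linarith)
        rw [Real.rpow_two]; nlinarith
    _ = A ^ (-(σ / 2)) * B ^ (-(σ / 2)) := Real.mul_rpow hA0.le hB0.le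

/-- The Barnes-type double series is the Mellin transform of the double geometric series. -/
lemma hasSum_barnes {ω s : ℂ} {κ α β : ℝ} (hω : 0 < ω.re) (hκ : 0 < κ) (hα : 0 < α) (hβ : β < 1)
    (hs : 2 < s.re) :
    HasSum (fun x : ℕ × ℕ => Complex.Gamma s * (ω * (x.1 + α) + κ * (x.2 + 1 - β)) ^ (-s))
      (-∫ t in Ioi (0 : ℝ), (t : ℂ) ^ (s - 1) * loopKernel ω κ α β t) := by
  have hre : ∀ x : ℕ × ℕ, (ω * (x.1 + α) + κ * (x.2 + 1 - β)).re
      = ω.re * (x.1 + α) + κ * (x.2 + (1 - β)) := by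
    intro x
    have : ω * (x.1 + α) + κ * (x.2 + 1 - β)
        = ω * ((x.1 + α : ℝ) : ℂ) + ((κ * (x.2 + (1 - β)) : ℝ) : ℂ) := by push_cast; ring
    rw [this, Complex.add_re, Complex.re_mul_ofReal, Complex.ofReal_re]
  have hpos : ∀ x : ℕ × ℕ, 0 < (ω * (x.1 + α) + κ * (x.2 + 1 - β)).re := by
    intro x
    rw [hre]
    have : 0 < 1 - β := by linarith
    positivity
  have hs0 : 0 < s.re := by linarith
  have h := hasSum_integral_of_summable_integral_norm (μ := volume.restrict (Ioi (0 : ℝ)))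
    (F := fun (x : ℕ × ℕ) (t : ℝ) => (t : ℂ) ^ (s - 1) *
      cexp (-((ω * (x.1 + α) + κ * (x.2 + 1 - β)) * t)))
    (fun x => integrableOn_cpow_mul_exp_neg_mul hs0 (hpos x)) ?_
  · simp_rw [fun x : ℕ × ℕ => integral_cpow_mul_exp_neg_mul hs0 (hpos x)] at h
    have hval : ∫ t in Ioi (0 : ℝ), ∑' x : ℕ × ℕ, (t : ℂ) ^ (s - 1) *
        cexp (-((ω * (x.1 + α) + κ * (x.2 + 1 - β)) * t))
        = -∫ t in Ioi (0 : ℝ), (t : ℂ) ^ (s - 1) * loopKernel ω κ α β t := by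
      rw [← integral_neg]
      refine setIntegral_congr_fun measurableSet_Ioi fun t ht => ?_
      rw [((hasSum_loopKernel hω hκ ht).mul_left _).tsum_eq]
      ring
    rwa [hval] at h
  · have heq : ∀ x : ℕ × ℕ, ∫ t in Ioi (0 : ℝ), ‖(t : ℂ) ^ (s - 1) *
        cexp (-((ω * (x.1 + α) + κ * (x.2 + 1 - β)) * t))‖
        = Real.Gamma s.re * (ω.re * (x.1 + α) + κ * (x.2 + (1 - β))) ^ (-s.re) := by
      intro x
      have hn := setIntegral_congr_fun (μ := volume) (measurableSet_Ioi (a := (0 : ℝ)))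
        fun t ht => norm_cpow_mul_exp_neg_mul (s := s)
          (r := ω * (x.1 + α) + κ * (x.2 + 1 - β)) (mem_Ioi.1 ht)
      rw [hn, Real.integral_rpow_mul_exp_neg_mul_Ioi hs0 (hpos x), ← hre, one_div,
        Real.inv_rpow (hpos x).le, Real.rpow_neg (hpos x).le, mul_comm]
    simp_rw [heq]
    exact (summable_add_rpow hω hκ hα (by linarith) hs).mul_left _

/-! ### Analytic properties of the kernel -/

/-- In the strip `|Im u| ≤ ε` the kernel decays exponentially as `Re u → ∞`. -/
lemma exists_loopKernel_bound {ω : ℂ} {κ α β : ℝ} (hω : 0 < ω.re) (hκ : 0 < κ) (hα : 0 ≤ α)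
    (ε : ℝ) : ∃ T, ∀ t y : ℝ, T ≤ t → |y| ≤ ε →
      ‖loopKernel ω κ α β (t + y * Complex.I)‖ ≤ 4 * Real.exp (-((1 - β) * κ) * t) := by
  refine ⟨max ((1 + ε * |ω.im|) / ω.re) (1 / κ), fun t y ht hy => ?_⟩
  have ht1 : 1 + ε * |ω.im| ≤ ω.re * t := by
    have := (le_max_left _ _).trans ht
    rw [div_le_iff₀ hω] at this
    linarith
  have ht2 : 1 ≤ κ * t := by
    have := (le_max_right _ _).trans ht
    rw [div_le_iff₀ hκ] at this
    linarith
  have hre : (ω * (t + y * Complex.I)).re = ω.re * t - ω.im * y := by simp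
  have hre1 : 1 ≤ (ω * (t + y * Complex.I)).re := by
    have : ω.im * y ≤ ε * |ω.im| := by
      refine (le_abs_self _).trans ?_
      rw [abs_mul, mul_comm]
      gcongr
    rw [hre]; linarith
  have hexp1 : 2 ≤ Real.exp 1 := by linarith [Real.add_one_le_exp (1 : ℝ)]
  have b1 : ‖cexp (-(α * ω * (t + y * Complex.I)))‖ ≤ 1 := by
    rw [Complex.norm_exp, Real.exp_le_one_iff, mul_assoc, Complex.neg_re, Complex.re_ofReal_mul]
    nlinarith
  have b2 : 1 / 2 ≤ ‖cexp (-(ω * (t + y * Complex.I))) - 1‖ := by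
    have h1 : ‖cexp (-(ω * (t + y * Complex.I)))‖ ≤ 1 / 2 := by
      rw [Complex.norm_exp, Complex.neg_re, Real.exp_neg, one_div]
      exact inv_anti₀ two_pos (hexp1.trans (Real.exp_le_exp.2 hre1))
    have h2 := norm_sub_norm_le (1 : ℂ) (cexp (-(ω * (t + y * Complex.I))))
    rw [norm_sub_rev] at h2
    simp only [norm_one] at h2
    linarith
  have b3 : ‖cexp (β * κ * (t + y * Complex.I))‖ = Real.exp (β * κ * t) := by
    rw [Complex.norm_exp]
    congr 1
    simp
  have b4 : Real.exp (κ * t) / 2 ≤ ‖cexp (κ * (t + y * Complex.I)) - 1‖ := by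
    have h1 : ‖cexp (κ * (t + y * Complex.I))‖ = Real.exp (κ * t) := by
      rw [Complex.norm_exp]
      congr 1
      simp
    have h2 := norm_sub_norm_le (cexp (κ * (t + y * Complex.I))) 1
    rw [h1, norm_one] at h2
    have h3 : 2 ≤ Real.exp (κ * t) := hexp1.trans (Real.exp_le_exp.2 ht2)
    linarith
  rw [loopKernel, norm_mul, norm_div, norm_div, b3]
  calc _ ≤ 1 / (1 / 2) * (Real.exp (β * κ * t) / (Real.exp (κ * t) / 2)) := by
        gcongr
    _ = 4 * (Real.exp (β * κ * t) / Real.exp (κ * t)) := by field_simp; norm_num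
    _ = _ := by rw [← Real.exp_sub]; congr 2; ring

/-- `u = 0` is the only zero of the denominators of the kernel inside or on `C_ε`. -/
def LoopAdmissible (ω : ℂ) (κ ε : ℝ) : Prop :=
  0 < ε ∧ ∀ u ∈ loopRegion ε, (cexp (-(ω * u)) - 1) * (cexp (κ * u) - 1) = 0 → u = 0

lemma differentiableAt_loopKernel {ω : ℂ} {κ α β ε : ℝ} (hadm : LoopAdmissible ω κ ε) {u : ℂ}
    (hu : u ∈ loopRegion ε) (hu0 : u ≠ 0) : DifferentiableAt ℂ (loopKernel ω κ α β) u := by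
  have h := mul_ne_zero_iff.1 (fun h0 => hu0 (hadm.2 u hu h0))
  unfold loopKernel
  refine DifferentiableAt.mul (DifferentiableAt.div (by fun_prop) ?_ h.1)
    (DifferentiableAt.div (by fun_prop) ?_ h.2) <;> fun_prop

/-- The kernel has at most a double pole at `0`. -/
lemma exists_regularization {ω : ℂ} {κ ε : ℝ} (hω : ω ≠ 0) (hκ : κ ≠ 0)
    (hadm : LoopAdmissible ω κ ε) (α β : ℝ) :
    ∃ h : ℂ → ℂ, (∀ u ∈ loopRegion ε, DifferentiableAt ℂ h u) ∧
      ∀ u, u ≠ 0 → loopKernel ω κ α β u = h u / u ^ 2 := by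
  -- `D u = (exp u - 1) / u`, an entire function
  set D : ℂ → ℂ := dslope cexp 0 with hD
  have hDd : Differentiable ℂ D := by
    have h1 : DifferentiableOn ℂ D univ :=
      (Complex.differentiableOn_dslope univ_mem).2 Complex.differentiable_exp.differentiableOn
    exact differentiableOn_univ.1 h1
  have hD1 : ∀ u, cexp u - 1 = u * D u := by
    intro u
    have := sub_smul_dslope cexp 0 u
    simp at this
    exact this.symm
  have hD0 : D 0 = 1 := by simp [hD, dslope_same]
  have hκc : (κ : ℂ) ≠ 0 := by exact_mod_cast hκ
  have hne : ∀ u ∈ loopRegion ε, D (-(ω * u)) ≠ 0 ∧ D (κ * u) ≠ 0 := by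
    intro u hu
    by_cases hu0 : u = 0
    · subst hu0
      simp [hD0]
    · have h := mul_ne_zero_iff.1 (fun h0 => hu0 (hadm.2 u hu h0))
      rw [hD1, hD1] at h
      exact ⟨right_ne_zero_of_mul h.1, right_ne_zero_of_mul h.2⟩
  refine ⟨fun u => -(cexp (-(α * ω * u)) / (ω * D (-(ω * u))) *
    (cexp (β * κ * u) / (κ * D (κ * u)))), fun u hu => ?_, fun u hu0 => ?_⟩
  · obtain ⟨h1, h2⟩ := hne u hu
    refine DifferentiableAt.neg (DifferentiableAt.mul (DifferentiableAt.div (by fun_prop) ?_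
      (mul_ne_zero hω h1)) (DifferentiableAt.div (by fun_prop) ?_ (mul_ne_zero hκc h2)))
    · exact (hDd.differentiableAt.comp u (by fun_prop : DifferentiableAt ℂ
        (fun u : ℂ => -(ω * u)) u)).const_mul ω
    · exact (hDd.differentiableAt.comp u (by fun_prop : DifferentiableAt ℂ
        (fun u : ℂ => κ * u) u)).const_mul (κ : ℂ)
  · rw [loopKernel, hD1, hD1]
    rw [show -(ω * u) * D (-(ω * u)) = -(u * (ω * D (-(ω * u)))) by ring,
      show κ * u * D (κ * u) = u * (κ * D (κ * u)) by ring]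
    rw [div_neg, div_mul_eq_div_div_swap, div_mul_eq_div_div_swap]
    ring

/-! ### The loop integral: convergence and dependence on `s` -/

/-- The logarithm with `0 < arg u < 2π` that defines `loopPow`. -/
def loopLog (u : ℂ) : ℂ := Complex.log (-u) + Real.pi * Complex.I

lemma loopPow_eq (u s : ℂ) : loopPow u s = cexp (s * loopLog u) := rfl

lemma norm_loopLog_le (u : ℂ) : ‖loopLog u‖ ≤ |Real.log ‖u‖| + 2 * Real.pi := by
  have h1 : ‖Complex.log (-u)‖ ≤ |Real.log ‖u‖| + Real.pi := by
    refine (Complex.norm_le_abs_re_add_abs_im _).trans ?_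
    rw [Complex.log_re, norm_neg, Complex.log_im]
    gcongr
    exact Complex.abs_arg_le_pi _
  have h2 : ‖(Real.pi : ℂ) * Complex.I‖ = Real.pi := by simp [abs_of_pos Real.pi_pos]
  refine (norm_add_le _ _).trans ?_
  rw [h2]; linarith

lemma continuousAt_loopLog {u : ℂ} (hu : u.im ≠ 0 ∨ u.re < 0) : ContinuousAt loopLog u := by
  unfold loopLog
  refine ContinuousAt.add (ContinuousAt.clog continuousAt_neg ?_) continuousAt_const
  rcases hu with hu | hu
  · right; simpa using hu
  · left; simpa using hu

lemma loopLog_circleMap {r φ : ℝ} (hr : 0 < r) (h1 : 0 < φ) (h2 : φ < 2 * Real.pi) :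
    loopLog (circleMap 0 r φ) = Real.log r + φ * Complex.I := by
  have e1 : -circleMap 0 r φ = r * cexp ((φ - Real.pi : ℝ) * Complex.I) := by
    rw [circleMap_zero]
    push_cast
    rw [sub_mul, Complex.exp_sub, Complex.exp_pi_mul_I]
    ring
  have e2 : Complex.log (cexp ((φ - Real.pi : ℝ) * Complex.I)) = (φ - Real.pi : ℝ) * Complex.I :=
    Complex.log_exp (by simp; linarith) (by simp; linarith)
  rw [loopLog, e1, Complex.log_ofReal_mul hr (Complex.exp_ne_zero _), e2]
  push_cast
  ring

/-- An integral of `exp (s ℓ) φ` is entire in `s` if `φ` beats every exponential of `‖ℓ‖`. -/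
lemma differentiable_integral_exp_mul {α : Type*} [MeasurableSpace α] {μ : Measure α}
    {ℓ φ : α → ℂ} (hℓ : AEStronglyMeasurable ℓ μ) (hφ : AEStronglyMeasurable φ μ)
    (hb : ∀ x : ℝ, Integrable (fun t => Real.exp (x * ‖ℓ t‖) * ‖φ t‖) μ) :
    (∀ s : ℂ, Integrable (fun t => cexp (s * ℓ t) * φ t) μ) ∧
      Differentiable ℂ (fun s => ∫ t, cexp (s * ℓ t) * φ t ∂μ) := by
  have hre : ∀ (s : ℂ) t, (s * ℓ t).re ≤ ‖s‖ * ‖ℓ t‖ := fun s t =>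
    (Complex.re_le_norm _).trans (norm_mul_le _ _)
  constructor
  · intro s
    refine (hb ‖s‖).mono' ((Complex.continuous_exp.comp_aestronglyMeasurable
      (hℓ.const_mul s)).mul hφ) (Eventually.of_forall fun t => ?_)
    rw [norm_mul, Complex.norm_exp]
    gcongr
    exact hre s t
  · intro s
    refine differentiableAt_integral_exp_mul one_pos hℓ hφ ?_
    refine (hb (‖s‖ + 1)).mono' ?_ (Eventually.of_forall fun t => ?_)
    · refine AEStronglyMeasurable.mul ?_ hφ.norm
      exact Real.continuous_exp.comp_aestronglyMeasurable
        ((Complex.continuous_re.comp_aestronglyMeasurable (hℓ.const_mul s)).add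
          (hℓ.norm.const_mul 1))
    · rw [Real.norm_of_nonneg (by positivity)]
      gcongr
      linarith [hre s t]

lemma mem_loopRegion_strip {ε t y : ℝ} (ht : 0 ≤ t) (hy : |y| ≤ ε) :
    (t + y * Complex.I : ℂ) ∈ loopRegion ε := by
  right
  simpa using ⟨ht, hy⟩

lemma mem_loopRegion_ball {ε r φ : ℝ} (hr : 0 ≤ r) (hrε : r ≤ ε) :
    circleMap 0 r φ ∈ loopRegion ε := by
  left
  simpa [abs_of_nonneg hr] using hrε

section

variable {ω : ℂ} {κ α β ε : ℝ}

lemma integrableOn_loopKernel_ray (hω : 0 < ω.re) (hκ : 0 < κ) (hα : 0 ≤ α) (hβ : β < 1)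
    (hadm : LoopAdmissible ω κ ε) {y : ℝ} (hy : |y| ≤ ε) (hy0 : y ≠ 0) :
    ContinuousOn (fun t : ℝ => loopLog (t + y * Complex.I)) (Ici 0) ∧
    ContinuousOn (fun t : ℝ => loopKernel ω κ α β (t + y * Complex.I)) (Ici 0) ∧
    ∀ x : ℝ, IntegrableOn (fun t : ℝ => Real.exp (x * ‖loopLog (t + y * Complex.I)‖) *
      ‖loopKernel ω κ α β (t + y * Complex.I)‖) (Ioi 0) := by
  have hne : ∀ t : ℝ, (t + y * Complex.I : ℂ).im ≠ 0 := fun t => by simpa using hy0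
  have hc1 : ContinuousOn (fun t : ℝ => loopLog (t + y * Complex.I)) (Ici 0) := by
    intro t _
    have h1 : ContinuousAt loopLog ((fun t : ℝ => (t + y * Complex.I : ℂ)) t) :=
      continuousAt_loopLog (Or.inl (hne t))
    exact (ContinuousAt.comp (f := fun t : ℝ => (t + y * Complex.I : ℂ)) h1
      (by fun_prop)).continuousWithinAt
  have hc2 : ContinuousOn (fun t : ℝ => loopKernel ω κ α β (t + y * Complex.I)) (Ici 0) := by
    intro t ht
    have h1 : ContinuousAt (loopKernel ω κ α β) ((fun t : ℝ => (t + y * Complex.I : ℂ)) t) := by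
      refine (differentiableAt_loopKernel hadm (mem_loopRegion_strip ht hy) ?_).continuousAt
      intro h0
      apply hne t
      rw [h0]; simp
    exact (ContinuousAt.comp (f := fun t : ℝ => (t + y * Complex.I : ℂ)) h1
      (by fun_prop)).continuousWithinAt
  refine ⟨hc1, hc2, fun x => ?_⟩
  set η := (1 - β) * κ with hη
  have hη0 : 0 < η := mul_pos (by linarith) hκ
  refine integrable_of_isBigO_exp_neg (half_pos hη0) ?_ ?_
  · exact ((hc1.norm.const_smul x).rexp).mul hc2.norm
  · obtain ⟨T, hT⟩ := exists_loopKernel_bound (β := β) hω hκ hα ε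
    -- the logarithm grows more slowly than any linear function
    have hlog : ∀ᶠ t : ℝ in atTop, |x| * (Real.log (t + |y|) + 2 * Real.pi) ≤ η / 2 * t := by
      have h1 : (fun t : ℝ => Real.log (t + |y|)) =o[atTop] fun t : ℝ => t := by
        have h2 := Real.isLittleO_log_id_atTop.comp_tendsto
          (tendsto_atTop_add_const_right atTop |y| tendsto_id)
        refine h2.trans_isBigO ?_
        refine Asymptotics.IsBigO.of_bound 2 ?_
        filter_upwards [eventually_ge_atTop |y|] with t ht
        have := abs_nonneg y
        simp only [Function.comp, id]
        rw [Real.norm_of_nonneg (by linarith), Real.norm_of_nonneg (by linarith)]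
        linarith
      have h2 : (fun _ : ℝ => 2 * Real.pi) =o[atTop] fun t : ℝ => t :=
        Asymptotics.isLittleO_const_id_atTop _
      have h3 := ((h1.add h2).const_mul_left |x|).def (half_pos hη0)
      filter_upwards [h3, eventually_ge_atTop 0] with t ht ht0
      rw [Real.norm_of_nonneg ht0] at ht
      exact (le_abs_self _).trans ht
    refine Asymptotics.IsBigO.of_bound 4 ?_
    filter_upwards [hlog, eventually_ge_atTop T, eventually_ge_atTop 1] with t h1 h2 h3
    rw [norm_mul, Real.norm_of_nonneg (Real.exp_pos _).le, norm_norm,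
      Real.norm_of_nonneg (Real.exp_pos _).le]
    have hnorm1 : 1 ≤ ‖(t + y * Complex.I : ℂ)‖ := by
      have := Complex.abs_re_le_norm (t + y * Complex.I : ℂ)
      simp only [add_re, ofReal_re, mul_re, I_re, mul_zero, ofReal_im, I_im, mul_one, sub_self,
        add_zero] at this
      exact h3.trans ((le_abs_self t).trans this)
    have hnorm2 : ‖(t + y * Complex.I : ℂ)‖ ≤ t + |y| := by
      refine (norm_add_le _ _).trans ?_
      simp [abs_of_nonneg (zero_le_one.trans h3)]
    have hL : x * ‖loopLog (t + y * Complex.I)‖ ≤ η / 2 * t := by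
      refine le_trans ?_ h1
      calc x * ‖loopLog (t + y * Complex.I)‖ ≤ |x| * ‖loopLog (t + y * Complex.I)‖ := by
            gcongr; exact le_abs_self x
        _ ≤ |x| * (Real.log (t + |y|) + 2 * Real.pi) := by
            gcongr
            refine (norm_loopLog_le _).trans ?_
            gcongr
            rw [abs_of_nonneg (Real.log_nonneg hnorm1)]
            exact Real.log_le_log (by linarith) hnorm2
    calc _ ≤ Real.exp (η / 2 * t) * (4 * Real.exp (-η * t)) := by
          gcongr
          exact hT t y h2 hy
      _ = 4 * Real.exp (-(η / 2) * t) := by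
          rw [mul_left_comm, ← Real.exp_add]
          congr 2; ring

lemma continuousOn_loop_arc (hε : 0 < ε) :
    ContinuousOn (fun φ : ℝ => loopLog (circleMap 0 ε φ)) (Icc (Real.pi / 2) (3 * Real.pi / 2)) := by
  have h : ContinuousOn (fun φ : ℝ => (Real.log ε + φ * Complex.I : ℂ))
      (Icc (Real.pi / 2) (3 * Real.pi / 2)) := by fun_prop
  refine h.congr fun φ hφ => ?_
  have := Real.pi_pos
  exact loopLog_circleMap hε (by linarith [hφ.1]) (by linarith [hφ.2])

lemma continuous_loopKernel_circle (hadm : LoopAdmissible ω κ ε) :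
    Continuous (fun φ : ℝ => loopKernel ω κ α β (circleMap 0 ε φ)) := by
  rw [continuous_iff_continuousAt]
  intro φ
  have h1 := (differentiableAt_loopKernel (α := α) (β := β) hadm
    (mem_loopRegion_ball (φ := φ) hadm.1.le le_rfl) (circleMap_ne_center hadm.1.ne')).continuousAt
  exact ContinuousAt.comp (f := fun φ : ℝ => circleMap 0 ε φ) h1
    (continuous_circleMap 0 ε).continuousAt

/-- The integrand of the loop integral. -/
def loopFun (ω : ℂ) (κ α β : ℝ) (s u : ℂ) : ℂ := loopPow u (s - 1) * loopKernel ω κ α β u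

/-- The loop avoids the zeros of the denominators of the kernel, the kernel decays exponentially,
and the power grows at most polynomially; hence convergence for all `s`, locally uniformly. -/
lemma loopIntegrable_and_differentiable (hω : 0 < ω.re) (hκ : 0 < κ) (hα : 0 ≤ α) (hβ : β < 1)
    (hadm : LoopAdmissible ω κ ε) :
    (∀ s, LoopIntegrable ε (loopFun ω κ α β s)) ∧
      Differentiable ℂ (fun s => loopIntegral ε (loopFun ω κ α β s)) := by
  have hε := hadm.1
  have hray : ∀ y : ℝ, |y| ≤ ε → y ≠ 0 →
      (∀ s, IntegrableOn (fun t : ℝ => loopFun ω κ α β s (t + y * Complex.I)) (Ioi 0)) ∧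
      Differentiable ℂ (fun s => ∫ t in Ioi (0 : ℝ), loopFun ω κ α β s (t + y * Complex.I)) := by
    intro y hy hy0
    obtain ⟨h1, h2, h3⟩ := integrableOn_loopKernel_ray (α := α) hω hκ hα hβ hadm hy hy0
    obtain ⟨h4, h5⟩ := differentiable_integral_exp_mul
      ((h1.mono Ioi_subset_Ici_self).aestronglyMeasurable measurableSet_Ioi)
      ((h2.mono Ioi_subset_Ici_self).aestronglyMeasurable measurableSet_Ioi) h3
    exact ⟨fun s => h4 (s - 1), h5.comp (differentiable_id.sub_const 1)⟩
  obtain ⟨t1, t2⟩ := hray ε (abs_of_pos hε).le hε.ne'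
  obtain ⟨b1, b2⟩ := hray (-ε) (by rw [abs_neg, abs_of_pos hε]) (neg_ne_zero.2 hε.ne')
  have hb : ∀ t : ℝ, (t : ℂ) + ((-ε : ℝ) : ℂ) * Complex.I = (t : ℂ) - (ε : ℂ) * Complex.I := by
    intro t; push_cast; ring
  simp_rw [hb] at b1 b2
  have hle : Real.pi / 2 ≤ 3 * Real.pi / 2 := by linarith [Real.pi_pos]
  have hcd : Continuous fun φ : ℝ => loopKernel ω κ α β (circleMap 0 ε φ) *
      deriv (circleMap 0 ε) φ := by
    refine (continuous_loopKernel_circle hadm).mul ?_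
    rw [show deriv (circleMap 0 ε) = fun φ => circleMap 0 ε φ * Complex.I from
      funext fun φ => deriv_circleMap 0 ε φ]
    exact (continuous_circleMap 0 ε).mul continuous_const
  obtain ⟨a1, a2⟩ := differentiable_integral_exp_mul
    (μ := volume.restrict (Ioc (Real.pi / 2) (3 * Real.pi / 2)))
    (ℓ := fun φ : ℝ => loopLog (circleMap 0 ε φ))
    (φ := fun φ : ℝ => loopKernel ω κ α β (circleMap 0 ε φ) * deriv (circleMap 0 ε) φ)
    (((continuousOn_loop_arc hε).mono Ioc_subset_Icc_self).aestronglyMeasurable measurableSet_Ioc)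
    hcd.aestronglyMeasurable (fun x => by
      refine IntegrableOn.mono_set (ContinuousOn.integrableOn_Icc ?_) Ioc_subset_Icc_self
      exact (((continuousOn_loop_arc hε).norm.const_smul x).rexp).mul hcd.continuousOn.norm)
  have harc : ∀ s : ℂ, (fun φ : ℝ => loopFun ω κ α β s (circleMap 0 ε φ) *
      deriv (circleMap 0 ε) φ) = fun φ => cexp ((s - 1) * loopLog (circleMap 0 ε φ)) *
        (loopKernel ω κ α β (circleMap 0 ε φ) * deriv (circleMap 0 ε) φ) := by
    intro s; ext φ
    rw [loopFun, loopPow_eq, mul_assoc]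
  constructor
  · intro s
    refine ⟨t1 s, ?_, b1 s⟩
    rw [harc, intervalIntegrable_iff_integrableOn_Ioc_of_le hle]
    exact a1 (s - 1)
  · unfold loopIntegral
    refine (t2.neg.add ?_).add b2
    simp_rw [harc, intervalIntegral.integral_of_le hle]
    exact a2.comp (differentiable_id.sub_const 1)

end

/-! ### Contraction of the loop to the positive half-line -/

/-- Shifting the half-line `[0, ∞)` vertically, for a function that decays in the strip. -/
lemma integral_Ioi_shift {Φ : ℂ → ℂ} {ε y b C T : ℝ} (hb : 0 < b) (hy : |y| ≤ ε)
    (hc : ∀ u : ℂ, 0 ≤ u.re → |u.im| ≤ ε → ContinuousAt Φ u)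
    (hd : ∀ u : ℂ, 0 < u.re → |u.im| ≤ ε → DifferentiableAt ℂ Φ u)
    (hbound : ∀ t y : ℝ, T ≤ t → |y| ≤ ε → ‖Φ (t + y * Complex.I)‖ ≤ C * Real.exp (-b * t)) :
    ∫ t in Ioi (0 : ℝ), Φ (t + y * Complex.I)
      = (∫ t in Ioi (0 : ℝ), Φ t) - Complex.I * ∫ v in (0 : ℝ)..y, Φ (v * Complex.I) := by
  have hint : ∀ v : ℝ, |v| ≤ ε → IntegrableOn (fun t : ℝ => Φ (t + v * Complex.I)) (Ioi 0) := by
    intro v hv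
    have hcont : ContinuousOn (fun t : ℝ => Φ (t + v * Complex.I)) (Ici 0) := by
      intro t ht
      have h1 : ContinuousAt Φ ((fun t : ℝ => (t + v * Complex.I : ℂ)) t) :=
        hc _ (by simpa using ht) (by simpa using hv)
      exact (ContinuousAt.comp (f := fun t : ℝ => (t + v * Complex.I : ℂ)) h1
        (by fun_prop)).continuousWithinAt
    have h2 : IntegrableOn (fun t : ℝ => ‖Φ (t + v * Complex.I)‖) (Ioi 0) := by
      refine integrable_of_isBigO_exp_neg hb hcont.norm (Asymptotics.IsBigO.of_bound C ?_)
      filter_upwards [eventually_ge_atTop T] with t ht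
      rw [norm_norm, Real.norm_of_nonneg (Real.exp_pos _).le]
      exact hbound t v ht hv
    exact (integrable_norm_iff ((hcont.mono Ioi_subset_Ici_self).aestronglyMeasurable
      measurableSet_Ioi)).1 h2
  have hε : 0 ≤ ε := (abs_nonneg y).trans hy
  have hle : ∀ v ∈ uIcc 0 y, |v| ≤ ε := by
    intro v hv
    refine le_trans ?_ hy
    have := abs_sub_left_of_mem_uIcc hv
    simpa using this
  have h0 : IntegrableOn (fun t : ℝ => Φ t) (Ioi 0) := by
    have := hint 0 (by simpa using hε)
    simpa using this
  have hrect : ∀ᶠ X : ℝ in atTop, (∫ t in (0 : ℝ)..X, Φ t) - (∫ t in (0 : ℝ)..X,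
      Φ (t + y * Complex.I)) + Complex.I * (∫ v in (0 : ℝ)..y, Φ (X + v * Complex.I)) -
        Complex.I * ∫ v in (0 : ℝ)..y, Φ (v * Complex.I) = 0 := by
    filter_upwards [eventually_ge_atTop 0] with X hX
    have h := Complex.integral_boundary_rect_eq_zero_of_continuousOn_of_differentiableOn Φ 0
      (X + y * Complex.I) ?_ ?_
    · simpa using h
    · rintro u ⟨hu1, hu2⟩
      simp only [zero_re, add_re, ofReal_re, mul_re, I_re, mul_zero, ofReal_im, I_im, mul_one,
        sub_self, add_zero, uIcc_of_le hX, mem_preimage, mem_Icc] at hu1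
      simp only [zero_im, add_im, ofReal_im, mul_im, ofReal_re, I_im, mul_one, I_re, mul_zero,
        add_zero, zero_add, mem_preimage] at hu2
      exact (hc u hu1.1 (hle _ hu2)).continuousWithinAt
    · rintro u ⟨hu1, hu2⟩
      simp only [zero_re, add_re, ofReal_re, mul_re, I_re, mul_zero, ofReal_im, I_im, mul_one,
        sub_self, add_zero, min_eq_left hX, max_eq_right hX, mem_preimage, mem_Ioo] at hu1
      simp only [zero_im, add_im, ofReal_im, mul_im, ofReal_re, I_im, mul_one, I_re, mul_zero,
        add_zero, zero_add, mem_preimage] at hu2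
      exact (hd u hu1.1 (hle _ (Ioo_subset_Icc_self hu2))).differentiableWithinAt
  have hvert : Tendsto (fun X : ℝ => ∫ v in (0 : ℝ)..y, Φ (X + v * Complex.I)) atTop (𝓝 0) := by
    refine squeeze_zero_norm' (a := fun X => C * Real.exp (-b * X) * |y - 0|) ?_ ?_
    · filter_upwards [eventually_ge_atTop T] with X hX
      refine intervalIntegral.norm_integral_le_of_norm_le_const fun v hv => ?_
      exact hbound X v hX (hle v (uIoc_subset_uIcc hv))
    · have h1 : Tendsto (fun X : ℝ => Real.exp (-b * X)) atTop (𝓝 0) := by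
        refine Real.tendsto_exp_atBot.comp ?_
        exact tendsto_id.const_mul_atTop_of_neg (by linarith)
      simpa using (h1.const_mul C).mul_const |y - 0|
  have hlim := (((intervalIntegral_tendsto_integral_Ioi 0 h0 tendsto_id).sub
    (intervalIntegral_tendsto_integral_Ioi 0 (hint y hy) tendsto_id)).add
      (hvert.const_mul Complex.I)).sub_const
        (Complex.I * ∫ v in (0 : ℝ)..y, Φ (v * Complex.I))
  have := tendsto_nhds_unique (tendsto_const_nhds (x := (0 : ℂ)) |>.congr'
    (hrect.mono fun X hX => hX.symm)) hlim
  linear_combination this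

section

variable {ω : ℂ} {κ α β ε : ℝ} {s : ℂ} {h : ℂ → ℂ}

/-- The integrand of the loop integral for the principal power; `h` is the kernel freed of its
double pole. -/
def principalFun (s : ℂ) (h : ℂ → ℂ) (u : ℂ) : ℂ := u ^ (s - 3) * h u

lemma principalFun_eq (hk : ∀ u, u ≠ 0 → loopKernel ω κ α β u = h u / u ^ 2) {u : ℂ}
    (hu : u ≠ 0) : principalFun s h u = u ^ (s - 1) * loopKernel ω κ α β u := by
  rw [principalFun, hk u hu, show s - 1 = s - 3 + (2 : ℕ) by push_cast; ring,
    Complex.cpow_add _ _ hu, Complex.cpow_natCast]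
  field_simp

lemma continuousAt_principalFun (hs : 3 < s.re) (hh : ∀ u ∈ loopRegion ε, DifferentiableAt ℂ h u)
    {u : ℂ} (hu : 0 ≤ u.re) (hu' : |u.im| ≤ ε) : ContinuousAt (principalFun s h) u :=
  (Complex.continuousAt_cpow_const_of_re_pos (Or.inl hu) (by simpa using hs)).mul
    (hh u (Or.inr ⟨hu, hu'⟩)).continuousAt

lemma differentiableAt_principalFun (hh : ∀ u ∈ loopRegion ε, DifferentiableAt ℂ h u)
    {u : ℂ} (hu : 0 < u.re) (hu' : |u.im| ≤ ε) : DifferentiableAt ℂ (principalFun s h) u :=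
  (differentiableAt_id.cpow_const (Or.inl hu)).mul (hh u (Or.inr ⟨hu.le, hu'⟩))

lemma exists_principalFun_bound (hω : 0 < ω.re) (hκ : 0 < κ) (hα : 0 ≤ α) (hβ : β < 1) (ε : ℝ)
    (hk : ∀ u, u ≠ 0 → loopKernel ω κ α β u = h u / u ^ 2) (s : ℂ) (hs : 1 ≤ s.re) :
    ∃ b C T : ℝ, 0 < b ∧ ∀ t y : ℝ, T ≤ t → |y| ≤ ε →
      ‖principalFun s h (t + y * Complex.I)‖ ≤ C * Real.exp (-b * t) := by
  obtain ⟨T, hT⟩ := exists_loopKernel_bound (β := β) hω hκ hα ε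
  set η := (1 - β) * κ with hη
  have hη0 : 0 < η := mul_pos (by linarith) hκ
  have hev : ∀ᶠ t : ℝ in atTop, t ^ (s.re - 1) ≤ 1 * Real.exp (η / 2 * t) := by
    have h1 := isLittleO_rpow_exp_pos_mul_atTop (s.re - 1) (half_pos hη0)
    filter_upwards [h1.def one_pos] with t ht
    rw [Real.norm_of_nonneg (Real.exp_pos _).le] at ht
    exact (le_abs_self _).trans ht
  obtain ⟨T', hT'⟩ := eventually_atTop.1 hev
  refine ⟨η / 2, Real.exp (Real.pi * ‖s - 1‖) * 2 ^ (s.re - 1) * 4, max (max T T') (max 1 ε),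
    half_pos hη0, fun t y ht hy => ?_⟩
  have ht1 : T ≤ t := (le_max_left _ _).trans ((le_max_left _ _).trans ht)
  have ht2 : T' ≤ t := (le_max_right _ _).trans ((le_max_left _ _).trans ht)
  have ht3 : 1 ≤ t := (le_max_left _ _).trans ((le_max_right _ _).trans ht)
  have ht4 : ε ≤ t := (le_max_right _ _).trans ((le_max_right _ _).trans ht)
  have hre : 0 < (t + y * Complex.I : ℂ).re := by simp; linarith
  have hne : (t + y * Complex.I : ℂ) ≠ 0 := by
    intro h0; rw [h0] at hre; simp at hre
  have hnorm : ‖(t + y * Complex.I : ℂ)‖ ≤ 2 * t := by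
    refine (norm_add_le _ _).trans ?_
    simp only [norm_real, norm_mul, norm_I, mul_one, Real.norm_eq_abs]
    rw [abs_of_nonneg (by linarith)]
    linarith
  rw [principalFun_eq hk hne, norm_mul, ← branchPow_of_re_pos hre]
  calc _ ≤ (Real.exp (Real.pi * ‖s - 1‖) * (2 * t) ^ (s.re - 1)) * (4 * Real.exp (-η * t)) := by
        gcongr
        · refine (norm_branchPow_le hne _).trans ?_
          rw [Complex.sub_re, Complex.one_re]
          gcongr
        · exact hT t y ht1 hy
    _ ≤ (Real.exp (Real.pi * ‖s - 1‖) * (2 ^ (s.re - 1) * (1 * Real.exp (η / 2 * t)))) *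
          (4 * Real.exp (-η * t)) := by
        rw [Real.mul_rpow (by norm_num) (by linarith)]
        gcongr
        exact hT' t ht2
    _ = Real.exp (Real.pi * ‖s - 1‖) * 2 ^ (s.re - 1) * 4 *
          (Real.exp (η / 2 * t) * Real.exp (-η * t)) := by ring
    _ = _ := by
        rw [← Real.exp_add]
        congr 2; ring

lemma loopLog_of_im_pos {u : ℂ} (hu : 0 < u.im) : loopLog u = Complex.log u := by
  rw [loopLog, Complex.log, Complex.log, norm_neg, Complex.arg_neg_eq_arg_sub_pi_of_im_pos hu]
  push_cast; ring

lemma loopLog_of_im_neg {u : ℂ} (hu : u.im < 0) :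
    loopLog u = Complex.log u + 2 * Real.pi * Complex.I := by
  rw [loopLog, Complex.log, Complex.log, norm_neg, Complex.arg_neg_eq_arg_add_pi_of_im_neg hu]
  push_cast; ring

lemma loopFun_of_im_pos (hk : ∀ u, u ≠ 0 → loopKernel ω κ α β u = h u / u ^ 2) {u : ℂ}
    (hu : 0 < u.im) : loopFun ω κ α β s u = principalFun s h u := by
  have hu0 : u ≠ 0 := by rintro rfl; simp at hu
  rw [principalFun_eq hk hu0, loopFun, loopPow_eq, loopLog_of_im_pos hu,
    Complex.cpow_def_of_ne_zero hu0, mul_comm (s - 1)]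

lemma loopFun_of_im_neg (hk : ∀ u, u ≠ 0 → loopKernel ω κ α β u = h u / u ^ 2) {u : ℂ}
    (hu : u.im < 0) : loopFun ω κ α β s u =
      cexp (2 * Real.pi * Complex.I * s) * principalFun s h u := by
  have hu0 : u ≠ 0 := by rintro rfl; simp at hu
  rw [principalFun_eq hk hu0, loopFun, loopPow_eq, loopLog_of_im_neg hu,
    Complex.cpow_def_of_ne_zero hu0, ← mul_assoc, ← Complex.exp_add]
  congr 1
  refine Complex.exp_eq_exp_iff_exists_int.2 ⟨-1, ?_⟩
  push_cast; ring

/-- The integrand `u ^ (s - 3) h(u) du` of the loop integral in the logarithmic coordinate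
`u = e ^ w`, where the branch of the power becomes irrelevant. -/
def logFun (s : ℂ) (h : ℂ → ℂ) (w : ℂ) : ℂ := cexp ((s - 2) * w) * h (cexp w)

lemma loopFun_exp (hk : ∀ u, u ≠ 0 → loopKernel ω κ α β u = h u / u ^ 2) (x : ℝ) {φ : ℝ}
    (h1 : 0 < φ) (h2 : φ < 2 * Real.pi) :
    loopFun ω κ α β s (circleMap 0 (Real.exp x) φ) * deriv (circleMap 0 (Real.exp x)) φ
      = Complex.I * logFun s h (x + φ * Complex.I) := by
  have e1 : circleMap 0 (Real.exp x) φ = cexp (x + φ * Complex.I) := by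
    rw [circleMap_zero, Complex.exp_add, Complex.ofReal_exp]
  have e2 : loopLog (circleMap 0 (Real.exp x) φ) = x + φ * Complex.I := by
    rw [loopLog_circleMap (Real.exp_pos x) h1 h2, Real.log_exp]
  rw [loopFun, loopPow_eq, e2, deriv_circleMap, e1, hk _ (Complex.exp_ne_zero _), logFun,
    show (s - 2) * ((x : ℂ) + φ * Complex.I)
      = (s - 1) * (x + φ * Complex.I) - (x + φ * Complex.I) by ring, Complex.exp_sub]
  field_simp [Complex.exp_ne_zero]

/-- A radius of the half disc in logarithmic coordinates: `θ` is the angle, `c` the unit vector. -/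
lemma integral_logFun_radius {θ : ℝ} {c m : ℂ} (hθ : cexp (θ * Complex.I) = c)
    (hm : ∀ y : ℝ, 0 < y → cexp ((s - 3) * (Real.log y + θ * Complex.I)) = m * (y * c) ^ (s - 3))
    (hcont : ContinuousOn (fun y : ℝ => principalFun s h (y * c)) (Icc 0 ε)) {x : ℝ} (hε : 0 < ε)
    (hx : x ≤ Real.log ε) :
    ∫ t in x..Real.log ε, logFun s h (t + θ * Complex.I)
      = m * c * ∫ y in (Real.exp x)..ε, principalFun s h (y * c) := by
  have h1 : ∀ t : ℝ, logFun s h (t + θ * Complex.I)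
      = m * c * (principalFun s h ((Real.exp t : ℝ) * c) * (Real.exp t : ℝ)) := by
    intro t
    have e1 : cexp (t + θ * Complex.I) = (Real.exp t : ℝ) * c := by
      rw [Complex.exp_add, hθ, Complex.ofReal_exp]
    have e2 := hm (Real.exp t) (Real.exp_pos t)
    rw [Real.log_exp] at e2
    rw [logFun, principalFun, e1, show (s - 2) * ((t : ℂ) + θ * Complex.I)
      = (s - 3) * (t + θ * Complex.I) + (t + θ * Complex.I) by ring, Complex.exp_add, e2, e1]
    ring
  simp_rw [h1]
  rw [intervalIntegral.integral_const_mul]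
  congr 1
  have hsub : Real.exp '' uIcc x (Real.log ε) ⊆ Icc 0 ε := by
    rintro _ ⟨t, ht, rfl⟩
    rw [uIcc_of_le hx] at ht
    exact ⟨(Real.exp_pos t).le, (Real.le_log_iff_exp_le hε).1 ht.2⟩
  have h2 := intervalIntegral.integral_deriv_smul_comp' (a := x) (b := Real.log ε)
    (f := Real.exp) (f' := Real.exp) (g := fun y : ℝ => principalFun s h (y * c))
    (fun t _ => Real.hasDerivAt_exp t) Real.continuous_exp.continuousOn (hcont.mono hsub)
  rw [Real.exp_log hε] at h2
  rw [← h2]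
  congr 1; ext t
  simp only [Function.comp, Complex.real_smul]
  ring

lemma cpow_mul_I {y : ℝ} (hy : 0 < y) (s : ℂ) :
    cexp (s * (Real.log y + (Real.pi / 2 : ℝ) * Complex.I)) = 1 * (y * Complex.I) ^ s := by
  rw [Complex.cpow_def_of_ne_zero (by simp [hy.ne']), Complex.log_ofReal_mul hy Complex.I_ne_zero,
    Complex.log_I, one_mul, mul_comm]
  push_cast; rfl

lemma cpow_mul_neg_I {y : ℝ} (hy : 0 < y) (s : ℂ) :
    cexp ((s - 3) * (Real.log y + (3 * Real.pi / 2 : ℝ) * Complex.I))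
      = cexp (2 * Real.pi * Complex.I * s) * (y * -Complex.I) ^ (s - 3) := by
  rw [Complex.cpow_def_of_ne_zero (by simp [hy.ne']),
    Complex.log_ofReal_mul hy (neg_ne_zero.2 Complex.I_ne_zero), Complex.log_neg_I,
    ← Complex.exp_add]
  refine Complex.exp_eq_exp_iff_exists_int.2 ⟨-3, ?_⟩
  push_cast; ring

/-- The half circle can be replaced by the two segments that join its ends to `0`. -/
lemma integral_loopFun_arc (hs : 3 < s.re) (hε : 0 < ε)
    (hh : ∀ u ∈ loopRegion ε, DifferentiableAt ℂ h u)
    (hk : ∀ u, u ≠ 0 → loopKernel ω κ α β u = h u / u ^ 2) :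
    ∫ φ in (Real.pi / 2)..(3 * Real.pi / 2),
        loopFun ω κ α β s (circleMap 0 ε φ) * deriv (circleMap 0 ε) φ
      = -(Complex.I * ∫ y in (0 : ℝ)..ε, principalFun s h (y * Complex.I))
        - cexp (2 * Real.pi * Complex.I * s) * Complex.I *
          ∫ y in (0 : ℝ)..ε, principalFun s h (y * -Complex.I) := by
  have hpi := Real.pi_pos
  have hle : Real.pi / 2 ≤ 3 * Real.pi / 2 := by linarith
  have hc1 : ∀ c : ℂ, c.re = 0 → |c.im| = 1 →
      ContinuousOn (fun y : ℝ => principalFun s h (y * c)) (Icc 0 ε) := by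
    intro c hcr hci y hy
    have h1 : ContinuousAt (principalFun s h) ((fun y : ℝ => (y * c : ℂ)) y) := by
      refine continuousAt_principalFun (ε := ε) hs hh ?_ ?_
      · simp [hcr]
      · simp only [Complex.im_ofReal_mul, abs_mul, hci, mul_one]
        rw [abs_of_nonneg hy.1]; exact hy.2
    exact (ContinuousAt.comp (f := fun y : ℝ => (y * c : ℂ)) h1 (by fun_prop)).continuousWithinAt
  have hcI := hc1 Complex.I (by simp) (by simp)
  have hcnI := hc1 (-Complex.I) (by simp) (by simp)
  set A : ℝ → ℂ := fun δ => ∫ y in δ..ε, principalFun s h (y * Complex.I) with hA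
  set B : ℝ → ℂ := fun δ => ∫ y in δ..ε, principalFun s h (y * -Complex.I) with hB
  set m := cexp (2 * Real.pi * Complex.I * s) with hmdef
  have htA : ∀ f : ℝ → ℂ, ContinuousOn f (Icc 0 ε) →
      Tendsto (fun x : ℝ => ∫ y in (Real.exp x)..ε, f y) atBot (𝓝 (∫ y in (0 : ℝ)..ε, f y)) := by
    intro f hf
    have h1 := intervalIntegral.continuousOn_primitive_interval_left (μ := volume) (a := 0) (b := ε)
      (f := f) (by rw [uIcc_of_le hε.le]; exact hf.integrableOn_Icc)
    have h2 := h1 0 left_mem_uIcc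
    refine Tendsto.comp h2 (tendsto_nhdsWithin_iff.2 ⟨Real.tendsto_exp_atBot, ?_⟩)
    filter_upwards [eventually_le_atBot (Real.log ε)] with x hx
    rw [uIcc_of_le hε.le]
    exact ⟨(Real.exp_pos x).le, (Real.le_log_iff_exp_le hε).1 hx⟩
  -- Cauchy's theorem in the rectangle `[x, log ε] × [π / 2, 3π / 2]`
  have hrect : ∀ᶠ x : ℝ in atBot, 1 * Complex.I * A (Real.exp x) - m * -Complex.I * B (Real.exp x) +
      Complex.I * (∫ φ in (Real.pi / 2)..(3 * Real.pi / 2),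
        logFun s h (Real.log ε + φ * Complex.I)) -
      Complex.I * ∫ φ in (Real.pi / 2)..(3 * Real.pi / 2), logFun s h (x + φ * Complex.I) = 0 := by
    filter_upwards [eventually_le_atBot (Real.log ε)] with x hx
    have h1 := Complex.integral_boundary_rect_eq_zero_of_differentiableOn (logFun s h)
      (x + (Real.pi / 2 : ℝ) * Complex.I) (Real.log ε + (3 * Real.pi / 2 : ℝ) * Complex.I) ?_
    · have r1 := integral_logFun_radius (θ := Real.pi / 2) (c := Complex.I) (m := 1) (s := s) (h := h)
        (by push_cast; exact Complex.exp_pi_div_two_mul_I) (fun y hy => cpow_mul_I hy _) hcI hε hx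
      have r2 := integral_logFun_radius (θ := 3 * Real.pi / 2) (c := -Complex.I) (m := m) (s := s)
        (h := h) (by
          rw [show ((3 * Real.pi / 2 : ℝ) : ℂ) * Complex.I
            = Real.pi * Complex.I + Real.pi / 2 * Complex.I by push_cast; ring, Complex.exp_add,
            Complex.exp_pi_mul_I, Complex.exp_pi_div_two_mul_I]; ring)
        (fun y hy => cpow_mul_neg_I hy _) hcnI hε hx
      simp only [add_re, ofReal_re, mul_re, I_re, mul_zero, ofReal_im, I_im, mul_one, sub_self,
        add_zero, add_im, mul_im, zero_add, smul_eq_mul] at h1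
      rw [r1, r2] at h1
      exact h1
    · rintro w ⟨hw1, -⟩
      simp only [add_re, ofReal_re, mul_re, I_re, mul_zero, ofReal_im, I_im, mul_one, sub_self,
        add_zero, mem_preimage, uIcc_of_le hx] at hw1
      have hw2 : cexp w ∈ loopRegion ε := by
        left
        rw [mem_ofPred_eq, Complex.norm_exp]
        exact (Real.le_log_iff_exp_le hε).1 hw1.2
      unfold logFun
      exact (DifferentiableAt.mul (by fun_prop) ((hh _ hw2).comp w
        Complex.differentiableAt_exp)).differentiableWithinAt
  -- the side at `Re w = x` vanishes in the limit `x → -∞` because `Re s > 2`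
  obtain ⟨M, hM⟩ : ∃ M, ∀ u ∈ Metric.closedBall (0 : ℂ) ε, ‖h u‖ ≤ M := by
    refine (isCompact_closedBall (0 : ℂ) ε).exists_bound_of_continuousOn fun u hu => ?_
    exact (hh u (Or.inl (by simpa using hu))).continuousAt.continuousWithinAt
  have hsmall : Tendsto (fun x : ℝ => ∫ φ in (Real.pi / 2)..(3 * Real.pi / 2),
      logFun s h (x + φ * Complex.I)) atBot (𝓝 0) := by
    refine squeeze_zero_norm' (a := fun x => Real.exp ((s.re - 2) * x) *
      (Real.exp (|s.im| * (2 * Real.pi)) * M * |3 * Real.pi / 2 - Real.pi / 2|)) ?_ ?_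
    · filter_upwards [eventually_le_atBot (Real.log ε)] with x hx
      rw [← mul_assoc]
      refine intervalIntegral.norm_integral_le_of_norm_le_const fun φ hφ => ?_
      rw [uIoc_of_le hle] at hφ
      rw [logFun, norm_mul, Complex.norm_exp, ← mul_assoc, ← Real.exp_add]
      gcongr
      · have e1 : ((s - 2) * (x + φ * Complex.I)).re = (s.re - 2) * x - s.im * φ := by simp
        have e2 : -(s.im * φ) ≤ |s.im| * (2 * Real.pi) := by
          refine (neg_le_abs _).trans ?_
          rw [abs_mul]
          gcongr
          rw [abs_le]
          constructor <;> linarith [hφ.1, hφ.2]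
        rw [e1]; linarith
      · apply hM
        rw [mem_closedBall_zero_iff, Complex.norm_exp]
        simpa using (Real.le_log_iff_exp_le hε).1 hx
    · have h1 : Tendsto (fun x : ℝ => Real.exp ((s.re - 2) * x)) atBot (𝓝 0) :=
        Real.tendsto_exp_atBot.comp (tendsto_id.const_mul_atBot (by linarith))
      simpa using h1.mul_const _
  have hlim := (((((htA _ hcI).const_mul (1 * Complex.I)).sub
    ((htA _ hcnI).const_mul (m * -Complex.I))).add_const
      (Complex.I * (∫ φ in (Real.pi / 2)..(3 * Real.pi / 2),
        logFun s h (Real.log ε + φ * Complex.I)))).sub (hsmall.const_mul Complex.I))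
  have hfinal := tendsto_nhds_unique (tendsto_const_nhds (x := (0 : ℂ)) |>.congr'
    (hrect.mono fun X hX => hX.symm)) hlim
  have harc : ∫ φ in (Real.pi / 2)..(3 * Real.pi / 2),
        loopFun ω κ α β s (circleMap 0 ε φ) * deriv (circleMap 0 ε) φ
      = Complex.I * ∫ φ in (Real.pi / 2)..(3 * Real.pi / 2),
        logFun s h (Real.log ε + φ * Complex.I) := by
    rw [← intervalIntegral.integral_const_mul]
    refine intervalIntegral.integral_congr fun φ hφ => ?_
    rw [uIcc_of_le hle] at hφ
    have := loopFun_exp (s := s) hk (Real.log ε) (φ := φ) (by linarith [hφ.1])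
      (by linarith [hφ.2])
    rwa [Real.exp_log hε] at this
  rw [harc]
  linear_combination -hfinal

/-- Hankel's contraction: for large `Re s` the loop integral is `e ^ (2πis) - 1` times the integral
over the positive half-line. -/
lemma loopIntegral_loopFun (hω : 0 < ω.re) (hκ : 0 < κ) (hα : 0 ≤ α) (hβ : β < 1)
    (hadm : LoopAdmissible ω κ ε) (hs : 3 < s.re) :
    loopIntegral ε (loopFun ω κ α β s) = (cexp (2 * Real.pi * Complex.I * s) - 1) *
      ∫ t in Ioi (0 : ℝ), (t : ℂ) ^ (s - 1) * loopKernel ω κ α β t := by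
  have hε := hadm.1
  have hω0 : ω ≠ 0 := by rintro rfl; simp at hω
  obtain ⟨h, hh, hk⟩ := exists_regularization hω0 hκ.ne' hadm α β
  obtain ⟨b, C, T, hb, hbound⟩ := exists_principalFun_bound hω hκ hα hβ ε hk s (by linarith)
  have hshift : ∀ y : ℝ, |y| ≤ ε → ∫ t in Ioi (0 : ℝ), principalFun s h (t + y * Complex.I)
      = (∫ t in Ioi (0 : ℝ), principalFun s h t) -
        Complex.I * ∫ v in (0 : ℝ)..y, principalFun s h (v * Complex.I) := fun y hy =>
    integral_Ioi_shift hb hy (fun u => continuousAt_principalFun hs hh)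
      (fun u => differentiableAt_principalFun hh) hbound
  have htop : ∫ t in Ioi (0 : ℝ), loopFun ω κ α β s (t + ε * Complex.I)
      = ∫ t in Ioi (0 : ℝ), principalFun s h (t + ε * Complex.I) := by
    congr 1; ext t
    exact loopFun_of_im_pos hk (by simpa using hε)
  have hbot : ∫ t in Ioi (0 : ℝ), loopFun ω κ α β s (t - ε * Complex.I)
      = cexp (2 * Real.pi * Complex.I * s) *
        ∫ t in Ioi (0 : ℝ), principalFun s h (t + (-ε : ℝ) * Complex.I) := by
    rw [← integral_const_mul]
    congr 1; ext t
    rw [loopFun_of_im_neg hk (by simpa using hε)]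
    congr 2
    push_cast; ring
  have hneg : ∫ v in (0 : ℝ)..(-ε), principalFun s h (v * Complex.I)
      = -∫ y in (0 : ℝ)..ε, principalFun s h (y * -Complex.I) := by
    have h1 := intervalIntegral.integral_comp_neg (a := 0) (b := ε)
      (fun v : ℝ => principalFun s h (v * Complex.I))
    rw [neg_zero] at h1
    rw [intervalIntegral.integral_symm (-ε) 0, ← h1]
    congr 2; ext y
    congr 1
    push_cast; ring
  have hJ : ∫ t in Ioi (0 : ℝ), principalFun s h t
      = ∫ t in Ioi (0 : ℝ), (t : ℂ) ^ (s - 1) * loopKernel ω κ α β t := by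
    refine setIntegral_congr_fun measurableSet_Ioi fun t ht => ?_
    exact principalFun_eq hk (by exact_mod_cast (mem_Ioi.1 ht).ne')
  rw [loopIntegral, htop, hbot, integral_loopFun_arc hs hε hh hk, hshift ε (abs_of_pos hε).le,
    hshift (-ε) (by rw [abs_neg, abs_of_pos hε]), hneg, hJ]
  ring

end

/-! ### The unimodular substitution -/

lemma im_moebius_pos {a b c d : ℤ} (hdet : a * d - b * c = 1) {z : ℂ} (hz : 0 < z.im) :
    0 < (((a : ℂ) * z + b) / (c * z + d)).im := by
  have hne : (c : ℂ) * z + d ≠ 0 := by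
    have h := lattice_ne_zero hz (x := (c : ℝ)) (y := (d : ℝ)) ?_
    · exact_mod_cast h
    · rintro ⟨h1, h2⟩
      have h1' : c = 0 := by exact_mod_cast h1
      have h2' : d = 0 := by exact_mod_cast h2
      simp [h1', h2'] at hdet
  have hdetR : (a : ℝ) * d - b * c = 1 := by exact_mod_cast hdet
  have hn : 0 < Complex.normSq ((c : ℂ) * z + d) := Complex.normSq_pos.2 hne
  rw [Complex.div_im]
  have : ((a : ℂ) * z + b).im * ((c : ℂ) * z + d).re / Complex.normSq (c * z + d) -
      ((a : ℂ) * z + b).re * ((c : ℂ) * z + d).im / Complex.normSq (c * z + d)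
      = z.im / Complex.normSq (c * z + d) := by
    rw [← sub_div]
    congr 1
    simp
    linear_combination z.im * hdetR
  rw [this]
  positivity

/-- The effect of the substitution `(m, n) = (d M - c N, a N - b M)` on one term: powers multiply
up to the factor `exp (-2πis)` on the cone `M + R₁ ≤ 0`, `d (M + R₁) > c (N + R₂)`. -/
lemma branchPow_mul_latticeTerm {f fstar p q : ℤ → ℂ} {a b c d : ℤ} (hdet : a * d - b * c = 1)
    (hc : 0 < c) {r₁ r₂ R₁ R₂ : ℝ} (hR₁ : R₁ = a * r₁ + c * r₂) (hR₂ : R₂ = b * r₁ + d * r₂)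
    {z : ℂ} (hz : 0 < z.im) (hz_re : -(d : ℝ) / c < z.re)
    (hpq : ∀ M N : ℤ, f (d * M - c * N) * fstar (-b * M + a * N) = p M * q N) (s : ℂ)
    (x : ℤ × ℤ) (hx : x ∈ eisSet R₁ R₂) :
    branchPow ((c : ℂ) * z + d) (-s) * latticeTerm (((a : ℂ) * z + b) / (c * z + d)) f fstar r₁ r₂ s
        (d * x.1 - c * x.2, -b * x.1 + a * x.2)
      = latticeTerm z p q R₁ R₂ s x * (if x.1 + R₁ ≤ 0 ∧ c * (x.2 + R₂) < d * (x.1 + R₁)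
          then cexp (2 * Real.pi * Complex.I * -s) else 1) := by
  set ω : ℂ := (c : ℂ) * z + d with hω
  set V : ℂ := ((a : ℂ) * z + b) / ω with hV
  have hcR : (0 : ℝ) < c := by exact_mod_cast hc
  have hVim : 0 < V.im := im_moebius_pos hdet hz
  have hω1 : 0 < ω.re := by
    rw [div_lt_iff₀ hcR] at hz_re
    simp [hω]; linarith
  have hω2 : 0 < ω.im := by simp [hω]; positivity
  have hω0 : ω ≠ 0 := by intro h; rw [h] at hω1; simp at hω1
  obtain ⟨M, N⟩ := x
  set w : ℂ := (((d * M - c * N : ℤ) : ℂ) + r₁) * V + ((-b * M + a * N : ℤ) : ℂ) + r₂ with hw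
  set W : ℂ := ((M : ℂ) + R₁) * z + N + R₂ with hW
  have hdetC : (a : ℂ) * d - b * c = 1 := by exact_mod_cast hdet
  have hWw : ω * w = W := by
    have hVω : V * ω = (a : ℂ) * z + b := div_mul_cancel₀ _ hω0
    have e1 : ω * w = (((d * M - c * N : ℤ) : ℂ) + r₁) * (V * ω) +
        (((-b * M + a * N : ℤ) : ℂ) + r₂) * ω := by rw [hw]; ring
    rw [e1, hVω, hW, hω, hR₁, hR₂]
    push_cast
    linear_combination (M * z + N) * hdetC
  have hW0 : W ≠ 0 := by
    have h := lattice_ne_zero hz (x := M + R₁) (y := N + R₂) ?_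
    · have e : (((M + R₁ : ℝ) : ℂ) * z + ((N + R₂ : ℝ) : ℂ)) = W := by
        rw [hW]; push_cast; ring
      rwa [e] at h
    · rintro ⟨h1, h2⟩
      exact hx ⟨by simp only; linarith, by simp only; linarith⟩
  have hw0 : w ≠ 0 := by
    rintro h
    rw [h, mul_zero] at hWw
    exact hW0 hWw.symm
  have hWim : W.im = (M + R₁) * z.im := lattice_im R₁ R₂ (M, N)
  have hWre : W.re = (M + R₁) * z.re + N + R₂ := lattice_re R₁ R₂ (M, N)
  have hwim : w.im = ((d * M - c * N : ℤ) + r₁) * V.im :=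
    lattice_im r₁ r₂ (d * M - c * N, -b * M + a * N)
  have hkey : ((d * M - c * N : ℤ) : ℝ) + r₁ = d * (M + R₁) - c * (N + R₂) := by
    have hdetR : (a : ℝ) * d - b * c = 1 := by exact_mod_cast hdet
    rw [hR₁, hR₂]
    push_cast
    linear_combination (-r₁) * hdetR
  have hcond : ((W.im < 0 ∨ (W.im = 0 ∧ W.re < 0)) ∧ 0 < w.im) ↔
      ((M : ℝ) + R₁ ≤ 0 ∧ (c : ℝ) * (N + R₂) < d * (M + R₁)) := by
    have h1 : 0 < w.im ↔ (c : ℝ) * (N + R₂) < d * (M + R₁) := by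
      rw [hwim, hkey, mul_pos_iff_of_pos_right hVim, sub_pos]
    rw [h1]
    refine and_congr_left fun hcone => ?_
    rw [hWim, hWre, mul_eq_zero, or_iff_left hz.ne', ← not_le, mul_nonneg_iff_left_nonneg_of_pos hz,
      not_le]
    constructor
    · rintro (h | h)
      · exact h.le
      · exact h.1.le
    · intro h
      rcases h.lt_or_eq with h | h
      · exact Or.inl h
      · refine Or.inr ⟨h, ?_⟩
        rw [h, mul_zero] at hcone
        rw [h, zero_mul, zero_add]
        exact neg_of_mul_neg_right hcone hcR.le
  have hmul := branchPow_mul_branchPow hω1 hω2 hw0 (-s)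
  rw [hWw] at hmul
  simp only [latticeTerm]
  rw [← hw, ← hW, hpq M N, mul_left_comm, hmul, mul_assoc (p M * q N)]
  congr 2
  by_cases h : (M : ℝ) + R₁ ≤ 0 ∧ (c : ℝ) * (N + R₂) < d * (M + R₁)
  · rw [if_pos (hcond.2 h), if_pos h]
  · rw [if_neg (hcond.not.2 h), if_neg h]

/-- The transformation formula in the half-plane of absolute convergence, with the correction term
as a series over a cone. -/
lemma branchPow_mul_sum {f fstar p q : ℤ → ℂ} {a b c d : ℤ} (hdet : a * d - b * c = 1)
    (hc : 0 < c) {r₁ r₂ R₁ R₂ : ℝ} (hR₁ : R₁ = a * r₁ + c * r₂) (hR₂ : R₂ = b * r₁ + d * r₂)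
    {z : ℂ} (hz : 0 < z.im) (hz_re : -(d : ℝ) / c < z.re)
    (hpq : ∀ M N : ℤ, f (d * M - c * N) * fstar (-b * M + a * N) = p M * q N) {s gV gz S : ℂ}
    (hgV : HasSum (fun i => eisTerm (((a : ℂ) * z + b) / (c * z + d)) f fstar r₁ r₂ i s) gV)
    (hgz : HasSum (fun i => eisTerm z p q R₁ R₂ i s) gz)
    (hS : HasSum ({x : ℤ × ℤ | R₁ ≤ x.1 ∧ d * (x.1 - R₁) < c * (x.2 - R₂)}.indicator
      (latticeTerm z (fun n => p (-n)) (fun n => q (-n)) (-R₁) (-R₂) s)) S) :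
    branchPow ((c : ℂ) * z + d) (-s) * gV
      = gz - 2 * Complex.I * Complex.sin (Real.pi * s) * S := by
  rw [hasSum_eisTerm_iff] at hgV hgz
  have hcR : (0 : ℝ) < c := by exact_mod_cast hc
  let σ : ℤ × ℤ ≃ ℤ × ℤ :=
    { toFun := fun x => (d * x.1 - c * x.2, -b * x.1 + a * x.2)
      invFun := fun x => (a * x.1 + c * x.2, b * x.1 + d * x.2)
      left_inv := fun x => by
        ext
        · simp only; linear_combination x.1 * hdet
        · simp only; linear_combination x.2 * hdet
      right_inv := fun x => by
        ext
        · simp only; linear_combination x.1 * hdet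
        · simp only; linear_combination x.2 * hdet }
  have hS' : HasSum ({x : ℤ × ℤ | x.1 + R₁ ≤ 0 ∧ c * (x.2 + R₂) < d * (x.1 + R₁)}.indicator
      (latticeTerm z p q R₁ R₂ s)) (cexp (Real.pi * Complex.I * s) * S) := by
    rw [← (Equiv.neg (ℤ × ℤ)).hasSum_iff]
    refine (hS.mul_left (cexp (Real.pi * Complex.I * s))).congr_fun fun x => ?_
    simp only [Function.comp, Equiv.neg_apply, indicator_apply, mem_ofPred_eq]
    have hiff : ((-x).1 + R₁ ≤ 0 ∧ c * ((-x).2 + R₂) < d * ((-x).1 + R₁)) ↔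
        (R₁ ≤ x.1 ∧ d * (x.1 - R₁) < c * (x.2 - R₂)) := by
      simp only [Prod.fst_neg, Prod.snd_neg, Int.cast_neg]
      constructor <;> rintro ⟨h1, h2⟩ <;> constructor <;> linarith
    by_cases h : R₁ ≤ x.1 ∧ d * (x.1 - R₁) < c * (x.2 - R₂)
    · rw [if_pos h, if_pos (hiff.2 h), latticeTerm_neg]
      rw [lattice_im, lattice_re]
      rcases h.1.lt_or_eq with h1 | h1
      · exact Or.inl (mul_pos (by linarith) hz)
      · have h2 := h.2
        rw [← h1, sub_self, mul_zero] at h2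
        have h3 := pos_of_mul_pos_right h2 hcR.le
        refine Or.inr ⟨by rw [← h1]; simp, ?_⟩
        rw [← h1]; simp only [add_neg_cancel, zero_mul]; linarith
    · rw [if_neg h, if_neg (hiff.not.2 h), mul_zero]
  have h1 := (hgV.mul_left (branchPow ((c : ℂ) * z + d) (-s)))
  rw [← σ.hasSum_iff] at h1
  have h2 := hgz.add (hS'.mul_left (cexp (2 * Real.pi * Complex.I * -s) - 1))
  have hmem : ∀ x, σ x ∈ eisSet r₁ r₂ ↔ x ∈ eisSet R₁ R₂ := by
    intro x
    have hdetR : (a : ℝ) * d - b * c = 1 := by exact_mod_cast hdet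
    simp only [eisSet, mem_ofPred_eq, σ, Equiv.coe_fn_mk]
    push_cast
    rw [not_iff_not, hR₁, hR₂]
    constructor
    · rintro ⟨e1, e2⟩
      constructor
      · linear_combination a * e1 + c * e2 - x.1 * hdetR
      · linear_combination b * e1 + d * e2 - x.2 * hdetR
    · rintro ⟨e1, e2⟩
      constructor
      · linear_combination d * e1 - c * e2 - r₁ * hdetR
      · linear_combination -b * e1 + a * e2 - r₂ * hdetR
  have h3 := h1.unique (h2.congr_fun fun x => ?_)
  · rw [h3]
    -- reversing the signs gives `exp (πis)`, the jump of the argument `exp (-2πis) - 1`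
    have hsin : (cexp (2 * Real.pi * Complex.I * -s) - 1) * cexp (Real.pi * Complex.I * s)
        = -(2 * Complex.I * Complex.sin (Real.pi * s)) := by
      rw [sub_mul, ← Complex.exp_add, Complex.sin, one_mul]
      rw [show 2 * Real.pi * Complex.I * -s + Real.pi * Complex.I * s
        = -(Real.pi * s) * Complex.I by ring,
        show (Real.pi : ℂ) * Complex.I * s = Real.pi * s * Complex.I by ring]
      linear_combination (cexp (-(Real.pi * s) * Complex.I) - cexp (Real.pi * s * Complex.I)) *
        Complex.I_mul_I
    rw [← mul_assoc, hsin]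
    ring
  · simp only [Function.comp]
    by_cases hx : x ∈ eisSet R₁ R₂
    · rw [indicator_of_mem ((hmem x).2 hx), indicator_of_mem hx]
      have h4 := branchPow_mul_latticeTerm hdet hc hR₁ hR₂ hz hz_re hpq s x hx
      rw [show σ x = (d * x.1 - c * x.2, -b * x.1 + a * x.2) from rfl, h4]
      by_cases hx' : (x.1 : ℝ) + R₁ ≤ 0 ∧ c * (x.2 + R₂) < d * (x.1 + R₁)
      · rw [if_pos hx', indicator_of_mem (by exact hx')]
        ring
      · rw [if_neg hx', indicator_of_notMem (by exact hx')]
        ring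
    · have hx' : ¬ ((x.1 : ℝ) + R₁ ≤ 0 ∧ c * (x.2 + R₂) < d * (x.1 + R₁)) := by
        simp only [eisSet, mem_ofPred_eq, not_not] at hx
        rintro ⟨-, h⟩
        rw [hx.1, hx.2] at h
        simp at h
      rw [indicator_of_notMem ((hmem x).not.2 hx), indicator_of_notMem hx,
        indicator_of_notMem (by exact hx')]
      ring

/-! ### The cone as a union of translates of a lattice cone -/

/-- Splitting a sum over `ℕ × ℕ` into residue classes: the first variable modulo `c` and then
modulo `k`, the second one modulo `k` (with the residues in reverse order). -/
lemma hasSum_nat_prod_residues {c k : ℕ} (hc : 0 < c) (hk : 0 < k) {F : ℕ × ℕ → ℂ}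
    {a : ℕ → ℕ → ℕ → ℂ}
    (h : ∀ j < c, ∀ μ < k, ∀ v < k, HasSum
      (fun x : ℕ × ℕ => F ((x.1 * k + μ) * c + j, x.2 * k + (k - 1 - v))) (a j μ v)) :
    HasSum F (∑ j ∈ Finset.range c, ∑ μ ∈ Finset.range k, ∑ v ∈ Finset.range k, a j μ v) := by
  have : NeZero c := ⟨hc.ne'⟩
  have : NeZero k := ⟨hk.ne'⟩
  let E : (ℕ × ℕ) × (Fin c × Fin k × Fin k) → ℕ × ℕ := fun x =>
    ((x.1.1 * k + (x.2.2.1 : ℕ)) * c + (x.2.1 : ℕ), x.1.2 * k + (k - 1 - (x.2.2.2 : ℕ)))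
  have hE : Function.Bijective E := by
    constructor
    · rintro ⟨⟨l, m⟩, j, μ, v⟩ ⟨⟨l', m'⟩, j', μ', v'⟩ hxy
      simp only [E, Prod.mk.injEq] at hxy
      obtain ⟨h1, h2⟩ := hxy
      have h3 := (Nat.divModEquiv c).symm.injective (a₁ := (l * k + (μ : ℕ), j))
        (a₂ := (l' * k + (μ' : ℕ), j')) h1
      simp only [Prod.mk.injEq] at h3
      have h4 := (Nat.divModEquiv k).symm.injective (a₁ := (l, μ)) (a₂ := (l', μ')) h3.1
      have h5 := (Nat.divModEquiv k).symm.injective (a₁ := (m, Fin.rev v)) (a₂ := (m', Fin.rev v'))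
        (by
          simp only [Nat.divModEquiv_symm_apply, Fin.val_rev]
          omega)
      simp only [Prod.mk.injEq, Fin.rev_inj] at h4 h5
      simp [h3.2, h4, h5]
    · rintro ⟨m, n⟩
      refine ⟨((m / c / k, n / k), ⟨m % c, Nat.mod_lt _ hc⟩, ⟨m / c % k, Nat.mod_lt _ hk⟩,
        Fin.rev ⟨n % k, Nat.mod_lt _ hk⟩), ?_⟩
      simp only [E, Fin.val_rev, Prod.mk.injEq]
      constructor
      · rw [Nat.div_add_mod', Nat.div_add_mod']
      · have := Nat.mod_lt n hk
        rw [show k - 1 - (k - (n % k + 1)) = n % k by omega, Nat.div_add_mod']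
  rw [← (Equiv.ofBijective E hE).hasSum_iff]
  have h1 := hasSum_prod_fintype (f := F ∘ E) (a := fun i : Fin c × Fin k × Fin k =>
    a i.1 i.2.1 i.2.2) fun i => h i.1 i.1.2 i.2.1 i.2.1.2 i.2.2 i.2.2.2
  simp only [Fintype.sum_prod_type] at h1
  simp_rw [Finset.sum_range]
  exact h1

/-- The exponent `(cμ + j - {R₁}) / (ck)` in the first factor of the kernel. -/
def kernelAlpha (k : ℕ) (c : ℤ) (R₁ : ℝ) (j : ℤ) (μ : ℕ) : ℝ :=
  ((c : ℝ) * (μ : ℝ) + (j : ℝ) - Int.fract R₁) / ((c : ℝ) * (k : ℝ))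

/-- The exponent `(v + {(dj + ρ) / c}) / k` in the second factor of the kernel. -/
def kernelBeta (k : ℕ) (c d : ℤ) (R₁ R₂ : ℝ) (j : ℤ) (v : ℕ) : ℝ :=
  ((v : ℝ) + Int.fract (((d : ℝ) * (j : ℝ) + rho R₁ R₂ c d) / (c : ℝ))) / (k : ℝ)

lemma kernelAlpha_pos {k : ℕ} (hk : 0 < k) {c : ℤ} (hc : 0 < c) (R₁ : ℝ) {j : ℤ} (hj : 1 ≤ j)
    (μ : ℕ) : 0 < kernelAlpha k c R₁ j μ := by
  have hcR : (0 : ℝ) < c := by exact_mod_cast hc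
  have hkR : (0 : ℝ) < k := by exact_mod_cast hk
  have hjR : (1 : ℝ) ≤ j := by exact_mod_cast hj
  have h1 := Int.fract_lt_one R₁
  have h2 : (0 : ℝ) ≤ c * μ := by positivity
  exact div_pos (by linarith) (by positivity)

lemma kernelBeta_lt_one {k v : ℕ} (hv : v < k) (c d : ℤ) (R₁ R₂ : ℝ) (j : ℤ) :
    kernelBeta k c d R₁ R₂ j v < 1 := by
  have hkR : (0 : ℝ) < k := by exact_mod_cast (Nat.zero_le v).trans_lt hv
  have hvR : (v : ℝ) + 1 ≤ k := by exact_mod_cast hv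
  rw [kernelBeta, div_lt_one hkR]
  linarith [Int.fract_lt_one (((d : ℝ) * (j : ℝ) + rho R₁ R₂ c d) / (c : ℝ))]

/-- The fractional part in the definition of `I` is that of the boundary point of the row
`M = ⌊R₁⌋ + j` of the cone. -/
lemma fract_rho {c : ℤ} (hc : 0 < c) (d : ℤ) (R₁ R₂ : ℝ) (j : ℤ) :
    Int.fract (((d : ℝ) * (j : ℝ) + rho R₁ R₂ c d) / (c : ℝ))
      = Int.fract (R₂ + (d : ℝ) * ((j : ℝ) - Int.fract R₁) / (c : ℝ)) := by
  have hcR : (c : ℝ) ≠ 0 := by exact_mod_cast hc.ne'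
  have : ((d : ℝ) * (j : ℝ) + rho R₁ R₂ c d) / (c : ℝ)
      = R₂ + (d : ℝ) * ((j : ℝ) - Int.fract R₁) / (c : ℝ) - (⌊R₂⌋ : ℝ) := by
    rw [rho, ← Int.self_sub_floor R₂]
    field_simp
    ring
  rw [this, Int.fract_sub_intCast]

/-- The open cone consists of the rows `M = ⌊R₁⌋ + 1, ⌊R₁⌋ + 2, …`, and row `M` begins to the right
of `R₂ + d (M - R₁) / c`. With `M = ⌊R₁⌋ + (l k + μ) c + j` this boundary moves by the integer
`d (l k + μ)` relative to that of row `⌊R₁⌋ + j`, so that the sums over `l` and over the columns in a fixed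
residue class modulo `k` form a Barnes double series. -/
lemma hasSum_cone {k : ℕ} (hk : 0 < k) {c d : ℤ} (hc : 0 < c) {P Q : ℤ → ℂ}
    (hP : Function.Periodic P (k : ℤ)) (hQ : Function.Periodic Q (k : ℤ)) (R₁ R₂ : ℝ) {z s : ℂ}
    (hz_re : -(d : ℝ) / c < z.re) (hs : 2 < s.re) :
    HasSum ({x : ℤ × ℤ | R₁ < x.1 ∧ d * (x.1 - R₁) < c * (x.2 - R₂)}.indicator
      (latticeTerm z P Q (-R₁) (-R₂) s))
      (∑ j ∈ Finset.Icc 1 c, ∑ μ ∈ Finset.range k, ∑ v ∈ Finset.range k,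
        P ((μ : ℤ) * c + j + ⌊R₁⌋) *
          Q (⌊R₂ + (d : ℝ) * ((j : ℝ) - Int.fract R₁) / (c : ℝ)⌋ - (v : ℤ) + d * (μ : ℤ)) *
          ((Complex.Gamma s)⁻¹ * -∫ t in Ioi (0 : ℝ), (t : ℂ) ^ (s - 1) *
            loopKernel (k * (c * z + d)) k (kernelAlpha k c R₁ j μ)
              (kernelBeta k c d R₁ R₂ j v) t)) := by
  have hcR : (0 : ℝ) < c := by exact_mod_cast hc
  have hkR : (0 : ℝ) < k := by exact_mod_cast hk
  have hω : 0 < ((k : ℂ) * (c * z + d)).re := by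
    have : ((k : ℂ) * (c * z + d)).re = k * (c * z.re + d) := by simp
    rw [this]
    rw [div_lt_iff₀ hcR] at hz_re
    have : 0 < c * z.re + d := by linarith
    positivity
  have hΓ : Complex.Gamma s ≠ 0 := Complex.Gamma_ne_zero_of_re_pos (by linarith)
  obtain ⟨cn, rfl⟩ : ∃ cn : ℕ, c = cn := ⟨c.toNat, by omega⟩
  have hcn : 0 < cn := by exact_mod_cast hc
  -- the rows of the cone
  let row : ℕ → ℤ := fun m => ⌊R₁⌋ + 1 + m
  let X : ℤ → ℝ := fun M => R₂ + d * (M - R₁) / (cn : ℤ)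
  let φ : ℕ × ℕ → ℤ × ℤ := fun x => (row x.1, ⌊X (row x.1)⌋ + 1 + x.2)
  have hφ : Function.Injective φ := by
    rintro ⟨m, n⟩ ⟨m', n'⟩ hmn
    simp only [φ, Prod.mk.injEq] at hmn
    have h1 : m = m' := by have := hmn.1; simp only [row] at this; omega
    subst h1
    have h2 : n = n' := by have := hmn.2; omega
    rw [h2]
  have hrange : range φ
      = {x : ℤ × ℤ | R₁ < x.1 ∧ d * (x.1 - R₁) < ((cn : ℤ) : ℝ) * (x.2 - R₂)} := by
    have hX : ∀ M N : ℤ, d * (M - R₁) < ((cn : ℤ) : ℝ) * (N - R₂) ↔ ⌊X M⌋ < N := by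
      intro M N
      rw [Int.floor_lt]
      simp only [X]
      rw [← lt_sub_iff_add_lt', div_lt_iff₀ hcR, mul_comm ((N : ℝ) - R₂)]
    ext ⟨M, N⟩
    simp only [mem_range, mem_ofPred_eq, hX, ← Int.floor_lt, φ, Prod.mk.injEq, Prod.exists]
    constructor
    · rintro ⟨m, n, h1, h2⟩
      subst h1
      refine ⟨?_, by omega⟩
      simp only [row]; omega
    · rintro ⟨h1, h2⟩
      have h3 : row (M - ⌊R₁⌋ - 1).toNat = M := by simp only [row]; omega
      refine ⟨(M - ⌊R₁⌋ - 1).toNat, (N - ⌊X M⌋ - 1).toNat, h3, ?_⟩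
      rw [h3]; omega
  rw [hasSum_indicator_iff_of_range hφ hrange]
  have hsum := hasSum_nat_prod_residues hcn hk (F := fun x => latticeTerm z P Q (-R₁) (-R₂) s (φ x))
    (a := fun j μ v => P ((μ : ℤ) * cn + (j + 1 : ℕ) + ⌊R₁⌋) *
          Q (⌊R₂ + (d : ℝ) * (((j + 1 : ℕ) : ℝ) - Int.fract R₁) / (cn : ℝ)⌋ - (v : ℤ)
            + d * (μ : ℤ)) *
          ((Complex.Gamma s)⁻¹ * -∫ t in Ioi (0 : ℝ), (t : ℂ) ^ (s - 1) *
            loopKernel (k * ((cn : ℤ) * z + d)) k (kernelAlpha k cn R₁ (j + 1 : ℕ) μ)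
              (kernelBeta k cn d R₁ R₂ (j + 1 : ℕ) v) t)) ?_
  · convert hsum using 1
    symm
    refine Finset.sum_bij (fun j _ => ((j + 1 : ℕ) : ℤ)) ?_ ?_ ?_ ?_
    · intro j hj
      rw [Finset.mem_range] at hj
      rw [Finset.mem_Icc]
      omega
    · intro i _ j _ hij
      omega
    · intro j hj
      rw [Finset.mem_Icc] at hj
      exact ⟨(j - 1).toNat, by rw [Finset.mem_range]; omega, by omega⟩
    · intro j _
      push_cast
      rfl
  · intro j _ μ _ v hv
    have hβ := kernelBeta_lt_one hv cn d R₁ R₂ (j + 1 : ℕ)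
    have hα := kernelAlpha_pos hk hc R₁ (j := (j + 1 : ℕ)) (by omega) μ
    have hB := ((hasSum_barnes hω hkR hα hβ hs).mul_left (Complex.Gamma s)⁻¹).mul_left
      (P ((μ : ℤ) * cn + (j + 1 : ℕ) + ⌊R₁⌋) *
          Q (⌊R₂ + (d : ℝ) * (((j + 1 : ℕ) : ℝ) - Int.fract R₁) / (cn : ℝ)⌋ - (v : ℤ)
            + d * (μ : ℤ)))
    refine hB.congr_fun fun x => ?_
    obtain ⟨l, h⟩ := x
    set θ := Int.fract (R₂ + (d : ℝ) * (((j + 1 : ℕ) : ℝ) - Int.fract R₁) / (cn : ℝ)) with hθ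
    set X₀ := ⌊R₂ + (d : ℝ) * (((j + 1 : ℕ) : ℝ) - Int.fract R₁) / (cn : ℝ)⌋ with hX₀
    have hθX : (X₀ : ℝ) + θ = R₂ + (d : ℝ) * (((j + 1 : ℕ) : ℝ) - Int.fract R₁) / (cn : ℝ) :=
      Int.floor_add_fract _
    have hcn0 : (cn : ℝ) ≠ 0 := by exact_mod_cast hcn.ne'
    have hrow : row ((l * k + μ) * cn + j) = (μ : ℤ) * cn + (j + 1 : ℕ) + ⌊R₁⌋ + (l * cn) * k := by
      simp only [row]; push_cast; ring
    have hfr : (⌊R₁⌋ : ℝ) = R₁ - Int.fract R₁ := (Int.self_sub_fract R₁).symm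
    have hXrow : X (row ((l * k + μ) * cn + j))
        = R₂ + (d : ℝ) * (((j + 1 : ℕ) : ℝ) - Int.fract R₁) / (cn : ℝ)
          + ((d * (μ + l * k) : ℤ) : ℝ) := by
      simp only [X, hrow]
      push_cast
      rw [hfr]
      field_simp
      ring
    have hfl : ⌊X (row ((l * k + μ) * cn + j))⌋ = X₀ + d * (μ + l * k) := by
      rw [hXrow, Int.floor_add_intCast]
    have hcol : ⌊X (row ((l * k + μ) * cn + j))⌋ + 1 + ((h * k + (k - 1 - v) : ℕ) : ℤ)
        = X₀ - v + d * μ + (d * l + h + 1) * k := by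
      rw [hfl]
      have : ((h * k + (k - 1 - v) : ℕ) : ℤ) = h * k + (k - 1 - v) := by
        push_cast [Nat.cast_sub (show v ≤ k - 1 by omega), Nat.cast_sub (show 1 ≤ k by omega)]
        ring
      rw [this]
      ring
    have hPP : P (row ((l * k + μ) * cn + j)) = P ((μ : ℤ) * cn + (j + 1 : ℕ) + ⌊R₁⌋) := by
      rw [hrow]
      exact_mod_cast hP.int_mul (l * cn) _
    have hQQ : Q (⌊X (row ((l * k + μ) * cn + j))⌋ + 1 + ((h * k + (k - 1 - v) : ℕ) : ℤ))
        = Q (X₀ - v + d * μ) := by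
      rw [hcol]
      exact_mod_cast hQ.int_mul (d * l + h + 1) _
    have hlin : ((row ((l * k + μ) * cn + j) : ℂ) + ((-R₁ : ℝ) : ℂ)) * z +
        ((⌊X (row ((l * k + μ) * cn + j))⌋ + 1 + ((h * k + (k - 1 - v) : ℕ) : ℤ) : ℤ) : ℂ)
          + ((-R₂ : ℝ) : ℂ)
        = k * ((cn : ℤ) * z + d) * (l + kernelAlpha k cn R₁ (j + 1 : ℕ) μ)
          + (k : ℝ) * (h + 1 - kernelBeta k cn d R₁ R₂ (j + 1 : ℕ) v) := by
      have e1 : ((row ((l * k + μ) * cn + j) : ℤ) : ℝ) - R₁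
          = k * cn * (l + kernelAlpha k cn R₁ (j + 1 : ℕ) μ) := by
        rw [hrow, kernelAlpha]
        push_cast
        rw [hfr]
        field_simp
        ring
      have e2 : ((⌊X (row ((l * k + μ) * cn + j))⌋ + 1 + ((h * k + (k - 1 - v) : ℕ) : ℤ) : ℤ) : ℝ)
          - R₂ = k * d * (l + kernelAlpha k cn R₁ (j + 1 : ℕ) μ)
            + k * (h + 1 - kernelBeta k cn d R₁ R₂ (j + 1 : ℕ) v) := by
        rw [hcol, kernelAlpha, kernelBeta, fract_rho hc]
        push_cast at hθX hθ ⊢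
        rw [← hθ, ← sub_eq_iff_eq_add.2 hθX.symm]
        field_simp
        ring
      have e1' := congrArg (fun x : ℝ => (x : ℂ)) e1
      have e2' := congrArg (fun x : ℝ => (x : ℂ)) e2
      push_cast at e1' e2' ⊢
      linear_combination z * e1' + e2'
    have hre : 0 < ((k * ((cn : ℤ) * z + d) : ℂ) * (l + kernelAlpha k cn R₁ (j + 1 : ℕ) μ)
          + (k : ℝ) * (h + 1 - kernelBeta k cn d R₁ R₂ (j + 1 : ℕ) v)).re := by
      have e : ((k * ((cn : ℤ) * z + d) : ℂ) * (l + kernelAlpha k cn R₁ (j + 1 : ℕ) μ)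
          + (k : ℝ) * (h + 1 - kernelBeta k cn d R₁ R₂ (j + 1 : ℕ) v))
          = (k * ((cn : ℤ) * z + d) : ℂ) * ((l + kernelAlpha k cn R₁ (j + 1 : ℕ) μ : ℝ) : ℂ)
          + ((k * (h + 1 - kernelBeta k cn d R₁ R₂ (j + 1 : ℕ) v) : ℝ) : ℂ) := by
        push_cast; ring
      rw [e, Complex.add_re, Complex.re_mul_ofReal, Complex.ofReal_re]
      have h1 : 0 < (l : ℝ) + kernelAlpha k cn R₁ (j + 1 : ℕ) μ := by positivity
      have h2 : 0 < (h : ℝ) + 1 - kernelBeta k cn d R₁ R₂ (j + 1 : ℕ) v := by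
        have : (0 : ℝ) ≤ h := by positivity
        linarith
      positivity
    simp only [latticeTerm, φ]
    rw [hPP, hQQ, hlin, branchPow_of_re_pos hre, inv_mul_cancel_left₀ hΓ]

/-- The row `M = R₁` of the cone, present only if `R₁` is an integer. -/
lemma hasSum_boundary_row {c d : ℤ} (hc : 0 < c) (P Q : ℤ → ℂ) (R₁ R₂ : ℝ) (z : ℂ) {s S : ℂ}
    (hS : HasSum (fun n => lTerm Q (-R₂) n s) S) :
    HasSum ({x : ℤ × ℤ | (x.1 : ℝ) = R₁ ∧ d * (x.1 - R₁) < c * (x.2 - R₂)}.indicator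
      (latticeTerm z P Q (-R₁) (-R₂) s)) (S * P ⌊R₁⌋ * charInt R₁) := by
  have hcR : (0 : ℝ) < c := by exact_mod_cast hc
  by_cases hR : R₁ = (⌊R₁⌋ : ℝ)
  · have hRC : (⌊R₁⌋ : ℂ) + ((-R₁ : ℝ) : ℂ) = 0 := by
      have := congrArg (fun x : ℝ => (x : ℂ)) hR
      push_cast at this ⊢
      linear_combination -this
    rw [charInt, if_pos hR, mul_one, hasSum_indicator_iff_of_range
      (φ := fun n : {n : ℤ // -(-R₂) < (n : ℝ)} => (⌊R₁⌋, n.1))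
      (fun a b hab => by simpa [Subtype.ext_iff] using hab)]
    · refine (hS.mul_right (P ⌊R₁⌋)).congr_fun fun n => ?_
      simp only [latticeTerm, lTerm, hRC, zero_mul, zero_add]
      ring
    · ext ⟨M, N⟩
      simp only [mem_range, mem_ofPred_eq, Prod.mk.injEq, Subtype.exists, neg_neg]
      constructor
      · rintro ⟨n, hn, rfl, rfl⟩
        refine ⟨hR.symm, ?_⟩
        rw [← hR, sub_self, mul_zero]
        exact mul_pos hcR (by linarith)
      · rintro ⟨h1, h2⟩
        rw [h1, sub_self, mul_zero] at h2
        have h3 := pos_of_mul_pos_right h2 hcR.le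
        refine ⟨N, by linarith, ?_, rfl⟩
        rw [← h1, Int.floor_intCast]
  · rw [charInt, if_neg hR, mul_zero]
    refine hasSum_zero.congr_fun fun x => indicator_of_notMem (fun hx => hR ?_) _
    rw [← hx.1, Int.floor_intCast]

/-! ### The transformation formulas -/

lemma admissibleLoop_iff {k : ℕ} {c d : ℤ} {z : ℂ} {ε : ℝ} :
    AdmissibleLoop k c d z ε ↔ LoopAdmissible (k * (c * z + d)) k ε := by
  have h : ∀ u : ℂ, (k : ℂ) * u * ((c : ℂ) * z + d) = k * (c * z + d) * u := fun u => by ring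
  simp only [AdmissibleLoop, LoopAdmissible, h]
  push_cast
  rfl

lemma integrand_eq_loopFun (k : ℕ) (c d : ℤ) (R₁ R₂ : ℝ) (j : ℤ) (μ v : ℕ) (z s : ℂ) :
    integrand k c d R₁ R₂ j μ v z s
      = loopFun (k * (c * z + d)) k (kernelAlpha k c R₁ j μ) (kernelBeta k c d R₁ R₂ j v) s := by
  ext u
  rw [integrand, loopFun, loopKernel, mul_assoc]
  congr 3
  · congr 2
    rw [kernelAlpha]; ring
  · congr 2; ring

/-- The periods `2πi / ω` and `2πi / κ` are not real, so that the zeros of the denominators of the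
kernel other than `0` keep a positive distance from the real axis. -/
lemma exists_loopAdmissible {ω : ℂ} (h1 : 0 < ω.re) (h2 : 0 < ω.im) {κ : ℝ} (hκ : 0 < κ) :
    ∃ ε, LoopAdmissible ω κ ε := by
  have hpi := Real.pi_pos
  have hN : 0 < ω.re ^ 2 + ω.im ^ 2 := by positivity
  refine ⟨min (Real.pi / κ) (min (ω.re * Real.pi / (ω.re ^ 2 + ω.im ^ 2))
    (ω.im * Real.pi / (ω.re ^ 2 + ω.im ^ 2))), by positivity, fun u hu h0 => ?_⟩
  set ε := min (Real.pi / κ) (min (ω.re * Real.pi / (ω.re ^ 2 + ω.im ^ 2))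
    (ω.im * Real.pi / (ω.re ^ 2 + ω.im ^ 2))) with hε
  have him : |u.im| ≤ ε := by
    rcases hu with hu | hu
    · exact (Complex.abs_im_le_norm u).trans hu
    · exact hu.2
  have b1 : |u.im| * κ ≤ Real.pi := (le_div_iff₀ hκ).1 (him.trans (min_le_left _ _))
  have b2 : |u.im| * (ω.re ^ 2 + ω.im ^ 2) ≤ ω.re * Real.pi :=
    (le_div_iff₀ hN).1 (him.trans ((min_le_right _ _).trans (min_le_left _ _)))
  -- a zero of either factor is an integer multiple of a period; the imaginary part forces it to
  -- be zero
  have hint : ∀ (n : ℤ) {x y : ℝ}, 0 < y → |x| ≤ y → x = n * (2 * y) → n = 0 := by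
    intro n x y hy hx hn
    by_contra hne
    have h3 : (1 : ℝ) ≤ |(n : ℝ)| := by exact_mod_cast Int.one_le_abs hne
    rw [hn, abs_mul, abs_of_pos (by positivity : 0 < 2 * y)] at hx
    nlinarith
  rcases mul_eq_zero.1 h0 with h | h
  · obtain ⟨n, hn⟩ := Complex.exp_eq_one_iff.1 (sub_eq_zero.1 h)
    have hre := congrArg Complex.re hn
    have him' := congrArg Complex.im hn
    simp at hre him'
    have hx : u.im * (ω.re ^ 2 + ω.im ^ 2) = ((-n : ℤ) : ℝ) * (2 * (ω.re * Real.pi)) := by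
      push_cast
      linear_combination -ω.re * him' + ω.im * hre
    have hn0 := hint (-n) (by positivity) (by
      rw [abs_mul, abs_of_pos hN]; exact b2) hx
    have hn0' : n = 0 := by omega
    rw [hn0', Int.cast_zero, zero_mul, neg_eq_zero] at hn
    rcases mul_eq_zero.1 hn with h3 | h3
    · rw [h3] at h1; simp at h1
    · exact h3
  · obtain ⟨n, hn⟩ := Complex.exp_eq_one_iff.1 (sub_eq_zero.1 h)
    have him' := congrArg Complex.im hn
    simp at him'
    have hn0 := hint n hpi (by rw [abs_mul, abs_of_pos hκ]; exact b1)
      (show u.im * κ = _ by linear_combination him')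
    rw [hn0, Int.cast_zero, zero_mul] at hn
    rcases mul_eq_zero.1 hn with h3 | h3
    · exact absurd h3 (by exact_mod_cast hκ.ne')
    · exact h3

lemma eventually_ne_pole (s₀ : ℂ) :
    ∀ᶠ s in 𝓝[≠] s₀, s ≠ 1 ∧ ∀ N : ℕ, s ≠ -(N : ℂ) := by
  have h1 : ∀ᶠ s in 𝓝[≠] s₀, s ≠ 1 := by
    by_cases h : s₀ = 1
    · subst h; exact self_mem_nhdsWithin
    · exact nhdsWithin_le_nhds (isOpen_ne.mem_nhds h)
  -- the poles of `Γ` are the zeros of the entire function `1 / Γ`, which are isolated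
  have h2 : ∀ᶠ s in 𝓝[≠] s₀, (Complex.Gamma s)⁻¹ ≠ 0 := by
    by_contra hcon
    have h3 : AnalyticOnNhd ℂ (fun s => (Complex.Gamma s)⁻¹) univ := fun s _ =>
      Complex.differentiable_one_div_Gamma.analyticAt s
    have h4 := h3.eqOn_zero_of_preconnected_of_frequently_eq_zero isPreconnected_univ
      (mem_univ s₀) ((Filter.not_eventually.1 hcon).mono fun s hs => not_not.1 hs) (mem_univ 1)
    simp at h4
  filter_upwards [h1, h2] with s hs1 hs2
  refine ⟨hs1, fun N hN => hs2 ?_⟩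
  rw [hN, Complex.Gamma_neg_nat_eq_zero, inv_zero]

/-- An identity `Γ A = Γ B + T` known for large `Re s` extends to all `s` by analytic
continuation. -/
lemma holdsForAll_of_re_gt {A B T : ℂ → ℂ} (hA : DifferentiableOn ℂ A {1}ᶜ)
    (hB : DifferentiableOn ℂ B {1}ᶜ) (hT : Differentiable ℂ T) {σ : ℝ} (hσ : 1 ≤ σ)
    (h : ∀ s : ℂ, σ < s.re → Complex.Gamma s * A s = Complex.Gamma s * B s + T s) :
    HoldsForAll (fun s => Complex.Gamma s * A s) (fun s => Complex.Gamma s * B s) T := by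
  have hopen : IsOpen ({1}ᶜ : Set ℂ) := isOpen_compl_singleton
  have hpre : IsPreconnected ({1}ᶜ : Set ℂ) :=
    (isConnected_compl_singleton_of_one_lt_rank (by simp) 1).isPreconnected
  have hR : DifferentiableOn ℂ (fun s => B s + (Complex.Gamma s)⁻¹ * T s) {1}ᶜ :=
    hB.add (Complex.differentiable_one_div_Gamma.mul hT).differentiableOn
  have hne1 : ∀ s : ℂ, σ < s.re → s ≠ 1 := by
    rintro s hs rfl
    simp at hs; linarith
  have heq : EqOn A (fun s => B s + (Complex.Gamma s)⁻¹ * T s) {1}ᶜ := by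
    refine (hA.analyticOnNhd hopen).eqOn_of_preconnected_of_eventuallyEq
      (hR.analyticOnNhd hopen) hpre (z₀ := ((σ + 1 : ℝ) : ℂ)) (hne1 _ (by simp)) ?_
    have hmem : {s : ℂ | σ < s.re} ∈ 𝓝 ((σ + 1 : ℝ) : ℂ) :=
      (isOpen_lt continuous_const Complex.continuous_re).mem_nhds (by simp)
    filter_upwards [hmem] with s hs
    have hs' : σ < s.re := hs
    have hΓ : Complex.Gamma s ≠ 0 := Complex.Gamma_ne_zero_of_re_pos (by linarith)
    have := h s hs'
    field_simp
    linear_combination this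
  have hpt : ∀ s : ℂ, s ≠ 1 → (∀ N : ℕ, s ≠ -(N : ℂ)) →
      Complex.Gamma s * A s = Complex.Gamma s * B s + T s := by
    intro s hs1 hsN
    have hΓ : Complex.Gamma s ≠ 0 := Complex.Gamma_ne_zero hsN
    rw [heq hs1, mul_add, mul_inv_cancel_left₀ hΓ]
  refine ⟨hpt, fun s₀ => ?_⟩
  refine (hT.continuous.tendsto s₀ |>.mono_left nhdsWithin_le_nhds).congr' ?_
  filter_upwards [eventually_ne_pole s₀] with s hs
  rw [hpt s hs.1 hs.2, add_sub_cancel_left]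

/-- Both formulas at once: all that is used of the congruences is that the coefficients factor in
the new variables. -/
lemma holdsForAll_of_factorization {k : ℕ} (hk : 0 < k) {f fstar p q : ℤ → ℂ}
    (hf : Function.Periodic f (k : ℤ)) (hfstar : Function.Periodic fstar (k : ℤ))
    (hp : Function.Periodic p (k : ℤ)) (hq : Function.Periodic q (k : ℤ))
    {a b c d : ℤ} (hdet : a * d - b * c = 1) (hc : 0 < c) {r₁ r₂ R₁ R₂ : ℝ}
    (hR₁ : R₁ = a * r₁ + c * r₂) (hR₂ : R₂ = b * r₁ + d * r₂) {z : ℂ} (hz : 0 < z.im)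
    (hz_re : -(d : ℝ) / c < z.re)
    (hpq : ∀ M N : ℤ, f (d * M - c * N) * fstar (-b * M + a * N) = p M * q N) {ε : ℝ}
    (hadm : AdmissibleLoop k c d z ε) :
    HoldsForAll
      (fun s => Complex.Gamma s * (branchPow ((c : ℂ) * z + d) (-s) *
        G (((a : ℂ) * z + b) / (c * z + d)) s f fstar r₁ r₂))
      (fun s => Complex.Gamma s * (G z s p q R₁ R₂ - 2 * Complex.I * Complex.sin (Real.pi * s) *
        (L s (fun n => q (-n)) (-R₂) * p (-⌊R₁⌋) * charInt R₁)))
      (fun s => e (-s / 2) * ∑ j ∈ Finset.Icc 1 c, ∑ μ ∈ Finset.range k, ∑ v ∈ Finset.range k,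
        p (-((μ : ℤ) * c + j + ⌊R₁⌋)) *
          q (-(⌊R₂ + (d : ℝ) * ((j : ℝ) - Int.fract R₁) / (c : ℝ)⌋ - (v : ℤ) + d * (μ : ℤ))) *
          I ε k c d R₁ R₂ j μ v z s) := by
  have : NeZero k := ⟨hk.ne'⟩
  have hcR : (0 : ℝ) < c := by exact_mod_cast hc
  have hkR : (0 : ℝ) < k := by exact_mod_cast hk
  have hω : 0 < ((k : ℂ) * (c * z + d)).re := by
    have e1 : ((k : ℂ) * (c * z + d)).re = k * (c * z.re + d) := by simp
    rw [e1]
    have h1 := hz_re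
    rw [div_lt_iff₀ hcR] at h1
    have : 0 < c * z.re + d := by linarith
    positivity
  have hω0 : (c : ℂ) * z + d ≠ 0 := by
    intro h; rw [h] at hω; simp at hω
  have hadm' := admissibleLoop_iff.1 hadm
  have hVim := im_moebius_pos hdet hz
  have hGV := isContinuation_G hVim hf hfstar r₁ r₂
  have hGz := isContinuation_G hz hp hq R₁ R₂
  have hL := isContinuation_L (periodic_comp_neg hq) (-R₂)
  refine holdsForAll_of_re_gt (σ := 3) ?_ ?_ ?_ (by norm_num) fun s hs => ?_
  · refine DifferentiableOn.mul (Differentiable.differentiableOn ?_) hGV.holomorphic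
    unfold branchPow
    fun_prop
  · refine hGz.holomorphic.sub (DifferentiableOn.mul (Differentiable.differentiableOn ?_)
      ((hL.holomorphic.mul_const _).mul_const _))
    fun_prop
  · refine Differentiable.mul (by unfold e; fun_prop) ?_
    refine Differentiable.fun_sum fun j hj => Differentiable.fun_sum fun μ _ =>
      Differentiable.fun_sum fun v hv => Differentiable.const_mul ?_ _
    unfold I
    simp_rw [integrand_eq_loopFun]
    exact (loopIntegrable_and_differentiable hω hkR
      (kernelAlpha_pos hk hc R₁ (Finset.mem_Icc.1 hj).1 μ).le
      (kernelBeta_lt_one (Finset.mem_range.1 hv) c d R₁ R₂ j) hadm').2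
  · have hrow := hasSum_boundary_row (d := d) hc (fun n => p (-n)) (fun n => q (-n)) R₁ R₂ z
      (hL.hasSum s (by linarith))
    have hcone := hasSum_cone hk (d := d) hc (periodic_comp_neg hp) (periodic_comp_neg hq) R₁ R₂
      hz_re (s := s) (by linarith)
    have hsplit := (hrow.add hcone).congr_fun (g := {x : ℤ × ℤ | R₁ ≤ x.1 ∧
      d * (x.1 - R₁) < c * (x.2 - R₂)}.indicator
        (latticeTerm z (fun n => p (-n)) (fun n => q (-n)) (-R₁) (-R₂) s)) fun x => by
      simp only [indicator_apply, mem_ofPred_eq]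
      rcases lt_trichotomy R₁ x.1 with h | h | h
      · simp [h.le, h, h.ne']
      · simp [← h]
      · simp [h.not_ge, h.not_gt, h.ne]
    have hmain := branchPow_mul_sum hdet hc hR₁ hR₂ hz hz_re hpq (hGV.hasSum s (by linarith))
      (hGz.hasSum s (by linarith)) hsplit
    rw [hmain]
    have hΓ : Complex.Gamma s ≠ 0 := Complex.Gamma_ne_zero_of_re_pos (by linarith)
    -- `e (-s / 2) (exp (2πis) - 1) = 2i sin (πs)` turns the loop integrals into the cone sums
    have hsin : e (-s / 2) * (cexp (2 * Real.pi * Complex.I * s) - 1)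
        = 2 * Complex.I * Complex.sin (Real.pi * s) := by
      rw [e, mul_sub, ← Complex.exp_add, Complex.sin, mul_one]
      rw [show 2 * Real.pi * Complex.I * (-s / 2) + 2 * Real.pi * Complex.I * s
        = Real.pi * s * Complex.I by ring,
        show 2 * (Real.pi : ℂ) * Complex.I * (-s / 2) = -(Real.pi * s) * Complex.I by ring]
      linear_combination (cexp (Real.pi * s * Complex.I) - cexp (-(Real.pi * s) * Complex.I)) *
        Complex.I_mul_I
    have hT : e (-s / 2) * ∑ j ∈ Finset.Icc 1 c, ∑ μ ∈ Finset.range k, ∑ v ∈ Finset.range k,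
        p (-((μ : ℤ) * c + j + ⌊R₁⌋)) *
          q (-(⌊R₂ + (d : ℝ) * ((j : ℝ) - Int.fract R₁) / (c : ℝ)⌋ - (v : ℤ) + d * (μ : ℤ))) *
          I ε k c d R₁ R₂ j μ v z s
        = -(Complex.Gamma s * (2 * Complex.I * Complex.sin (Real.pi * s) *
          ∑ j ∈ Finset.Icc 1 c, ∑ μ ∈ Finset.range k, ∑ v ∈ Finset.range k,
        p (-((μ : ℤ) * c + j + ⌊R₁⌋)) *
          q (-(⌊R₂ + (d : ℝ) * ((j : ℝ) - Int.fract R₁) / (c : ℝ)⌋ - (v : ℤ) + d * (μ : ℤ))) *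
          ((Complex.Gamma s)⁻¹ * -∫ t in Ioi (0 : ℝ), (t : ℂ) ^ (s - 1) *
            loopKernel (k * (c * z + d)) k (kernelAlpha k c R₁ j μ)
              (kernelBeta k c d R₁ R₂ j v) t))) := by
      simp only [Finset.mul_sum, ← Finset.sum_neg_distrib]
      refine Finset.sum_congr rfl fun j hj => Finset.sum_congr rfl fun μ _ =>
        Finset.sum_congr rfl fun v hv => ?_
      have hI : I ε k c d R₁ R₂ j μ v z s = (cexp (2 * Real.pi * Complex.I * s) - 1) *
          ∫ t in Ioi (0 : ℝ), (t : ℂ) ^ (s - 1) *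
            loopKernel (k * (c * z + d)) k (kernelAlpha k c R₁ j μ)
              (kernelBeta k c d R₁ R₂ j v) t := by
        rw [I, integrand_eq_loopFun]
        exact loopIntegral_loopFun hω hkR
          (kernelAlpha_pos hk hc R₁ (Finset.mem_Icc.1 hj).1 μ).le
          (kernelBeta_lt_one (Finset.mem_range.1 hv) c d R₁ R₂ j) hadm' hs
      rw [hI, ← hsin]
      field_simp
    rw [hT]
    ring

/-! ### The congruence conditions -/

lemma periodic_add_mul {k : ℕ} {g : ℤ → ℂ} (hg : Function.Periodic g (k : ℤ)) (n m : ℤ) :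
    g (n + k * m) = g n := by
  rw [mul_comm]
  exact_mod_cast hg.int_mul m n

lemma periodic_scaled {k : ℕ} {g : ℤ → ℂ} (hg : Function.Periodic g (k : ℤ)) (α : ℤ) :
    Function.Periodic (scaled α g) (k : ℤ) := fun n => by
  rw [scaled, scaled, mul_add, mul_comm α (k : ℤ), periodic_add_mul hg]

end PeriodicEisenstein

end

theorem mainTheorem1
    (k : ℕ) (hk : 0 < k) (f fstar : ℤ → ℂ)
    (hf : Function.Periodic f (k : ℤ)) (hfstar : Function.Periodic fstar (k : ℤ))
    (a b c d : ℤ) (hdet : a * d - b * c = 1) (hc : 0 < c)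
    (r₁ r₂ R₁ R₂ : ℝ)
    (hR₁ : R₁ = (a : ℝ) * r₁ + (c : ℝ) * r₂) (hR₂ : R₂ = (b : ℝ) * r₁ + (d : ℝ) * r₂)
    (z : ℂ) (hz_im : 0 < z.im) (hz_re : -(d : ℝ) / (c : ℝ) < z.re)
    (Vz : ℂ) (hVz : Vz = ((a : ℂ) * z + (b : ℂ)) / ((c : ℂ) * z + (d : ℂ))) :
    -- the loops in question exist, and the integrals along them converge absolutely
    (∃ ε, PeriodicEisenstein.AdmissibleLoop k c d z ε) ∧
    (∀ ε, PeriodicEisenstein.AdmissibleLoop k c d z ε →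
      ∀ s : ℂ, ∀ j ∈ Finset.Icc 1 c, ∀ μ ∈ Finset.range k, ∀ v ∈ Finset.range k,
        PeriodicEisenstein.LoopIntegrable ε
          (PeriodicEisenstein.integrand k c d R₁ R₂ j μ v z s)) ∧
    -- the continuation in `s` of the function on the left of both formulas
    PeriodicEisenstein.IsContinuation 2 (PeriodicEisenstein.eisTerm Vz f fstar r₁ r₂)
      (fun s => PeriodicEisenstein.G Vz s f fstar r₁ r₂) ∧
    -- first formula
    (a ≡ 0 [ZMOD (k : ℤ)] → d ≡ 0 [ZMOD (k : ℤ)] →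
      PeriodicEisenstein.IsContinuation 2
        (PeriodicEisenstein.eisTerm z (PeriodicEisenstein.scaled (-b) fstar)
          (PeriodicEisenstein.scaled (-c) f) R₁ R₂)
        (fun s => PeriodicEisenstein.G z s (PeriodicEisenstein.scaled (-b) fstar)
          (PeriodicEisenstein.scaled (-c) f) R₁ R₂) ∧
      PeriodicEisenstein.IsContinuation 1
        (PeriodicEisenstein.lTerm (PeriodicEisenstein.scaled c f) (-R₂))
        (fun s => PeriodicEisenstein.L s (PeriodicEisenstein.scaled c f) (-R₂)) ∧
      ∀ ε, PeriodicEisenstein.AdmissibleLoop k c d z ε →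
        PeriodicEisenstein.HoldsForAll
          (fun s => PeriodicEisenstein.branchPow ((c : ℂ) * z + (d : ℂ)) (-s) * Complex.Gamma s *
            PeriodicEisenstein.G Vz s f fstar r₁ r₂)
          (fun s => Complex.Gamma s *
              PeriodicEisenstein.G z s (PeriodicEisenstein.scaled (-b) fstar)
                (PeriodicEisenstein.scaled (-c) f) R₁ R₂
            - 2 * Complex.I * Complex.Gamma s * Complex.sin ((Real.pi : ℂ) * s) *
              PeriodicEisenstein.L s (PeriodicEisenstein.scaled c f) (-R₂) *
              fstar (b * ⌊R₁⌋) * PeriodicEisenstein.charInt R₁)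
          (fun s => PeriodicEisenstein.e (-s / 2) *
            ∑ j ∈ Finset.Icc 1 c, ∑ μ ∈ Finset.range k, ∑ v ∈ Finset.range k,
              f (c * (⌊R₂ + (d : ℝ) * ((j : ℝ) - Int.fract R₁) / (c : ℝ)⌋ - (v : ℤ))) *
              fstar (b * ((μ : ℤ) * c + j + ⌊R₁⌋)) *
              PeriodicEisenstein.I ε k c d R₁ R₂ j μ v z s)) ∧
    -- second formula
    (b ≡ 0 [ZMOD (k : ℤ)] → c ≡ 0 [ZMOD (k : ℤ)] →
      PeriodicEisenstein.IsContinuation 2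
        (PeriodicEisenstein.eisTerm z (PeriodicEisenstein.scaled d f)
          (PeriodicEisenstein.scaled a fstar) R₁ R₂)
        (fun s => PeriodicEisenstein.G z s (PeriodicEisenstein.scaled d f)
          (PeriodicEisenstein.scaled a fstar) R₁ R₂) ∧
      PeriodicEisenstein.IsContinuation 1
        (PeriodicEisenstein.lTerm (PeriodicEisenstein.scaled (-a) fstar) (-R₂))
        (fun s => PeriodicEisenstein.L s (PeriodicEisenstein.scaled (-a) fstar) (-R₂)) ∧
      ∀ ε, PeriodicEisenstein.AdmissibleLoop k c d z ε →
        PeriodicEisenstein.HoldsForAll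
          (fun s => PeriodicEisenstein.branchPow ((c : ℂ) * z + (d : ℂ)) (-s) * Complex.Gamma s *
            PeriodicEisenstein.G Vz s f fstar r₁ r₂)
          (fun s => Complex.Gamma s *
              PeriodicEisenstein.G z s (PeriodicEisenstein.scaled d f)
                (PeriodicEisenstein.scaled a fstar) R₁ R₂
            - 2 * Complex.I * Complex.Gamma s * Complex.sin ((Real.pi : ℂ) * s) *
              PeriodicEisenstein.L s (PeriodicEisenstein.scaled (-a) fstar) (-R₂) *
              f (-d * ⌊R₁⌋) * PeriodicEisenstein.charInt R₁)
          (fun s => PeriodicEisenstein.e (-s / 2) *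
            ∑ j ∈ Finset.Icc 1 c, ∑ μ ∈ Finset.range k, ∑ v ∈ Finset.range k,
              fstar (-a * (⌊R₂ + (d : ℝ) * ((j : ℝ) - Int.fract R₁) / (c : ℝ)⌋ - (v : ℤ)
                + d * (μ : ℤ))) *
              f (-d * (j + ⌊R₁⌋)) *
              PeriodicEisenstein.I ε k c d R₁ R₂ j μ v z s)) := by
  subst hVz
  have : NeZero k := ⟨hk.ne'⟩
  have hkR : (0 : ℝ) < k := by exact_mod_cast hk
  have hcR : (0 : ℝ) < c := by exact_mod_cast hc
  have hre : 0 < ((k : ℂ) * (c * z + d)).re := by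
    rw [div_lt_iff₀ hcR] at hz_re
    have h1 : 0 < c * z.re + d := by linarith
    have h2 : ((k : ℂ) * (c * z + d)).re = k * (c * z.re + d) := by simp
    rw [h2]
    positivity
  have him : 0 < ((k : ℂ) * (c * z + d)).im := by
    have h2 : ((k : ℂ) * (c * z + d)).im = k * (c * z.im) := by simp
    rw [h2]
    positivity
  have hS : ∀ (α : ℤ) {g : ℤ → ℂ}, Function.Periodic g (k : ℤ) →
      Function.Periodic (PeriodicEisenstein.scaled α g) (k : ℤ) := fun α g hg =>
    PeriodicEisenstein.periodic_scaled hg α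
  refine ⟨?_, ?_, PeriodicEisenstein.isContinuation_G
    (PeriodicEisenstein.im_moebius_pos hdet hz_im) hf hfstar r₁ r₂, ?_, ?_⟩
  · obtain ⟨ε, hε⟩ := PeriodicEisenstein.exists_loopAdmissible hre him hkR
    exact ⟨ε, PeriodicEisenstein.admissibleLoop_iff.2 hε⟩
  · intro ε hε s j hj μ _ v hv
    rw [PeriodicEisenstein.integrand_eq_loopFun]
    exact (PeriodicEisenstein.loopIntegrable_and_differentiable hre hkR
      (PeriodicEisenstein.kernelAlpha_pos hk hc R₁ (Finset.mem_Icc.1 hj).1 μ).le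
      (PeriodicEisenstein.kernelBeta_lt_one (Finset.mem_range.1 hv) c d R₁ R₂ j)
      (PeriodicEisenstein.admissibleLoop_iff.1 hε)).1 s
  · intro ha hd
    obtain ⟨a', rfl⟩ := Int.modEq_zero_iff_dvd.1 ha
    obtain ⟨d', rfl⟩ := Int.modEq_zero_iff_dvd.1 hd
    refine ⟨PeriodicEisenstein.isContinuation_G hz_im (hS _ hfstar) (hS _ hf) R₁ R₂,
      PeriodicEisenstein.isContinuation_L (hS _ hf) (-R₂), fun ε hε => ?_⟩
    have h := PeriodicEisenstein.holdsForAll_of_factorization hk hf hfstar (hS (-b) hfstar)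
      (hS (-c) hf) hdet hc hR₁ hR₂ hz_im hz_re (fun M N => by
        simp only [PeriodicEisenstein.scaled]
        -- `d M` and `a N` are multiples of `k` and drop out of the arguments of `f` and `f*`
        rw [mul_comm]
        congr 1
        · rw [← PeriodicEisenstein.periodic_add_mul hfstar (-b * M) (a' * N)]
          congr 1; ring
        · rw [← PeriodicEisenstein.periodic_add_mul hf (-c * N) (d' * M)]
          congr 1; ring) hε
    convert h using 2 with s s s
    · ring
    · have hq : (fun n => PeriodicEisenstein.scaled (-c) f (-n))
          = PeriodicEisenstein.scaled c f := by
        ext n; simp [PeriodicEisenstein.scaled]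
      rw [hq]
      simp only [PeriodicEisenstein.scaled, neg_mul_neg]
      ring
    · refine congrArg _ (Finset.sum_congr rfl fun j _ => Finset.sum_congr rfl fun μ _ =>
        Finset.sum_congr rfl fun v _ => ?_)
      simp only [PeriodicEisenstein.scaled, neg_mul_neg]
      rw [mul_comm (f _)]
      congr 2
      rw [mul_add, mul_assoc (k : ℤ), mul_left_comm c (k : ℤ),
        PeriodicEisenstein.periodic_add_mul hf]
  · intro hb hc'
    obtain ⟨b', rfl⟩ := Int.modEq_zero_iff_dvd.1 hb
    obtain ⟨c', rfl⟩ := Int.modEq_zero_iff_dvd.1 hc'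
    refine ⟨PeriodicEisenstein.isContinuation_G hz_im (hS _ hf) (hS _ hfstar) R₁ R₂,
      PeriodicEisenstein.isContinuation_L (hS _ hfstar) (-R₂), fun ε hε => ?_⟩
    have h := PeriodicEisenstein.holdsForAll_of_factorization hk hf hfstar (hS d hf)
      (hS a hfstar) hdet hc hR₁ hR₂ hz_im hz_re (fun M N => by
        simp only [PeriodicEisenstein.scaled]
        -- `c N` and `b M` are multiples of `k` and drop out of the arguments of `f` and `f*`
        congr 1
        · rw [← PeriodicEisenstein.periodic_add_mul hf (d * M) (-c' * N)]
          congr 1; ring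
        · rw [← PeriodicEisenstein.periodic_add_mul hfstar (a * N) (-b' * M)]
          congr 1; ring) hε
    convert h using 2 with s s s
    · ring
    · have hq : (fun n => PeriodicEisenstein.scaled a fstar (-n))
          = PeriodicEisenstein.scaled (-a) fstar := by
        ext n; simp [PeriodicEisenstein.scaled]
      rw [hq]
      simp only [PeriodicEisenstein.scaled, mul_neg, neg_mul]
      ring
    · refine congrArg _ (Finset.sum_congr rfl fun j _ => Finset.sum_congr rfl fun μ _ =>
        Finset.sum_congr rfl fun v _ => ?_)
      simp only [PeriodicEisenstein.scaled]
      rw [mul_comm (fstar _)]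
      congr 2
      · rw [← PeriodicEisenstein.periodic_add_mul hf (-d * (j + ⌊R₁⌋)) (-d * (μ * c'))]
        congr 1; ring
      · congr 1; ring
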